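/- **Setting.** Graphs are simple, undirected and finite, and $n$ is the number of nodes. $B(v,T)$ is the set of nodes at distance at most $T$ from $v$. The radius-$T$ neighborhood of $v$ is the induced subgraph $G[B(v,T)]$ with center $v$, together with the labels of its nodes. Let $\Sigma$ and $\Gamma$ be finite sets of input and output labels. A *locally checkable labeling problem* (LCL) $\Pi$ consists of a family $\mathcal G$ of graphs of bounded maximum degree, a radius $r$, and an isomorphism-invariant collection $\mathcal T$ of labeled radius-$r$ neighborhoods. For an input $(G,I)$ with $G\in\mathcal G$ and $I\colon V\to\Sigma$, a labeling $L\colon V\to\Gamma$ is feasible if and only if for every node $v$ the radius-$r$ neighborhood of $v$ in $(G,I,L)$ belongs to $\mathcal T$. In both models below, algorithms are deterministic, know $n$, and depend on what they see only up to isomorphism; the locality $T=T(n)$ may depend on $n$. * *LOCAL.* Fix a constant $c\ge 1$. An adversary assigns to the nodes distinct identifiers from $\{1,\dots,n^c\}$. Each node chooses its output as a function of its radius-$T(n)$ neighborhood, including inputs and identifiers. * *online-LOCAL.* An adversary presents the nodes in an order $v_1,\dots,v_n$. When $v_i$ is presented, the algorithm chooses the output of $v_i$ as a function of the sequence $v_1,\dots,v_i$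 and the induced subgraph $G\bigl[\bigcup_{j\le i}B(v_j,T(n))\bigr]$ with its inputs. An algorithm solves $\Pi$ if for every input $(G,I)$ with $G\in\mathcal G$ and every choice of the adversary its output is feasible. The *locality* of $\Pi$ in a model is the pointwise smallest function $T\colon\mathbb N\to\mathbb N$ such that some algorithm of that model solves $\Pi$ with locality at most $T$. **Theorem.** Let $\Pi$ be an LCL problem, possibly with inputs, whose graph family is the family of all paths, or the family of all cycles, or the family of all paths and all cycles. If $\Pi$ has locality $T$ in the online-LOCAL model, then for every constant $c\ge 1$ it has a locality $T'$ in the LOCAL model with identifiers from $\{1,\dots,n^c\}$, and $$T'(n)=O\bigl(T(n)+\log^* n\bigr)\qquad (n\to\infty),$$ where $\log^* n$ is the least number of times that $\log_2$ must be applied to $n$ to reach a value at most $1$. -/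

import Mathlib

open Filter Asymptotics

namespace OnlineLocal

/-- A view: a graph with node labels from `α` and a distinguished sequence of nodes.
A radius-`T` neighborhood of a node `v` is a view whose distinguished sequence is `[v]`. -/
structure View (α : Type*) where
  V : Type
  graph : SimpleGraph V
  label : V → α
  seq : List V

/-- Two views are isomorphic: there is a graph isomorphism that preserves the labels and the
distinguished sequence. -/
def View.Isomorphic {α : Type*} (A B : View α) : Prop :=
  ∃ e : A.graph ≃g B.graph, (∀ v, B.label (e v) = A.label v) ∧ A.seq.map e = B.seq

/-- The set of nodes within distance `T` of some node of the list `s`. -/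
def ballUnion {V : Type} (G : SimpleGraph V) (T : ℕ) (s : List V) : Set V :=
  {u | ∃ v ∈ s, G.edist v u ≤ T}

theorem mem_ballUnion {V : Type} (G : SimpleGraph V) (T : ℕ) (s : List V) :
    ∀ v ∈ s, v ∈ ballUnion G T s := by
  intro v hv
  exact ⟨v, hv, by simp⟩

/-- The subgraph of `G` induced by the union of the radius-`T` balls around the nodes of `s`,
with its labels and with the sequence `s` marked. -/
def ballView {V : Type} {α : Type*} (G : SimpleGraph V) (lab : V → α) (T : ℕ) (s : List V) :
    View α where
  V := ballUnion G T s
  graph := G.induce (ballUnion G T s)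
  label := fun u => lab u
  seq := s.attachWith (fun v => v ∈ ballUnion G T s) (mem_ballUnion G T s)

/-- A family of finite graphs. -/
abbrev GraphFamily := ∀ (V : Type) [Finite V], SimpleGraph V → Prop

/-- The family of all paths. -/
def paths : GraphFamily := fun V _ G =>
  Nonempty (G ≃g SimpleGraph.pathGraph (Nat.card V))

/-- The family of all cycles (on at least three nodes). -/
def cycles : GraphFamily := fun V _ G =>
  3 ≤ Nat.card V ∧ Nonempty (G ≃g SimpleGraph.cycleGraph (Nat.card V))

/-- The family of all paths and all cycles. -/
def pathsAndCycles : GraphFamily := fun V _ G => paths V G ∨ cycles V G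

/-- A locally verifiable problem with input labels `In` and output labels `Out`: a graph family,
a verification radius, and an isomorphism-invariant collection of labeled local neighborhoods. -/
structure Problem (In Out : Type*) where
  family : GraphFamily
  family_iso : ∀ (V W : Type) [Finite V] [Finite W] (G : SimpleGraph V) (H : SimpleGraph W),
    Nonempty (G ≃g H) → family V G → family W H
  radius : ℕ
  allowed : Set (View (In × Out))
  allowed_iso : ∀ A B : View (In × Out), A.Isomorphic B → A ∈ allowed → B ∈ allowed

/-- `L` is a feasible solution for the input `(G, I)`: the radius-`r` neighborhood of every node
in `(G, I, L)` belongs to the collection of allowed neighborhoods. -/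
def Problem.Feasible {In Out : Type*} (P : Problem In Out) {V : Type} (G : SimpleGraph V)
    (I : V → In) (L : V → Out) : Prop :=
  ∀ v, ballView G (fun u => (I u, L u)) P.radius [v] ∈ P.allowed

/-- A locally verifiable problem is an LCL problem if both label sets are finite and the degrees
in the graph family are bounded by a constant. -/
def Problem.IsLCL {In Out : Type*} (P : Problem In Out) : Prop :=
  Finite In ∧ Finite Out ∧
    ∃ Δ : ℕ, ∀ (V : Type) [Finite V] (G : SimpleGraph V), P.family V G →
      ∀ v, (G.neighborSet v).encard ≤ Δ

/-- An algorithm that knows the number `n` of nodes and maps every view to an output label;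
it cannot distinguish isomorphic views. -/
structure Algorithm (α Out : Type*) where
  out : ℕ → View α → Out
  out_iso : ∀ (n : ℕ) (A B : View α), A.Isomorphic B → out n A = out n B

/-- The labeling produced by a LOCAL algorithm with locality `t` on the input `(G, I)` with the
identifiers `ident`. -/
noncomputable def Algorithm.localRun {In Out : Type*} (A : Algorithm (In × ℕ) Out) (t : ℕ) {V : Type}
    (G : SimpleGraph V) (I : V → In) (ident : V → ℕ) : V → Out :=
  fun v => A.out (Nat.card V) (ballView G (fun u => (I u, ident u)) t [v])

/-- The labeling produced by an online-LOCAL algorithm with locality `t` on the input `(G, I)`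
when the nodes are presented in the order `σ`: the node presented at time `i` is labeled on the
basis of the first nodes of the sequence, up to and including that node, and of the subgraph
induced by their radius-`t` neighborhoods. -/
noncomputable def Algorithm.onlineRun {In Out : Type*} (A : Algorithm In Out) (t : ℕ) {V : Type}
    (G : SimpleGraph V) (I : V → In) (σ : Fin (Nat.card V) ≃ V) : V → Out :=
  fun v => A.out (Nat.card V) (ballView G I t ((List.ofFn σ).take ((σ.symm v : ℕ) + 1)))

/-- The algorithm `A` solves `P` in the LOCAL model with locality `T`, where the adversary chooses
unique identifiers from `{1, ..., n ^ c}`. -/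
def SolvesLocal {In Out : Type*} (c : ℕ) (P : Problem In Out) (A : Algorithm (In × ℕ) Out)
    (T : ℕ → ℕ) : Prop :=
  ∀ (V : Type) [Finite V] (G : SimpleGraph V), P.family V G →
    ∀ (I : V → In) (ident : V → ℕ), Function.Injective ident →
      (∀ v, 1 ≤ ident v ∧ ident v ≤ Nat.card V ^ c) →
        P.Feasible G I (A.localRun (T (Nat.card V)) G I ident)

/-- The algorithm `A` solves `P` in the online-LOCAL model with locality `T`, for every order in
which the adversary presents the nodes. -/
def SolvesOnline {In Out : Type*} (P : Problem In Out) (A : Algorithm In Out)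
    (T : ℕ → ℕ) : Prop :=
  ∀ (V : Type) [Finite V] (G : SimpleGraph V), P.family V G →
    ∀ (I : V → In) (σ : Fin (Nat.card V) ≃ V),
      P.Feasible G I (A.onlineRun (T (Nat.card V)) G I σ)

/-- `T` is the locality of `P` in the LOCAL model with identifiers from `{1, ..., n ^ c}`: the
pointwise smallest function such that some algorithm solves `P` with locality at most `T`. -/
def IsLocalityLocal {In Out : Type*} (c : ℕ) (P : Problem In Out) (T : ℕ → ℕ) : Prop :=
  IsLeast {T : ℕ → ℕ | ∃ T₀ ≤ T, ∃ A : Algorithm (In × ℕ) Out, SolvesLocal c P A T₀} T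

/-- `T` is the locality of `P` in the online-LOCAL model: the pointwise smallest function such
that some algorithm solves `P` with locality at most `T`. -/
def IsLocalityOnline {In Out : Type*} (P : Problem In Out) (T : ℕ → ℕ) : Prop :=
  IsLeast {T : ℕ → ℕ | ∃ T₀ ≤ T, ∃ A : Algorithm In Out, SolvesOnline P A T₀} T

/-- The iterated logarithm: the least number of times that the base-2 logarithm has to be applied
to `n` to reach a value that is at most `1`. -/
noncomputable def logStar (n : ℕ) : ℕ :=
  sInf {k : ℕ | (Real.logb 2)^[k] (n : ℝ) ≤ 1}

end OnlineLocal

namespace OnlineLocal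

/-! The proof is a dichotomy (`exists_const_le`). For a constant `C₂` that depends only on the
problem, one of two cases occurs. Either `T N` is at least a fixed fraction of `N` for all `N`, up
to an additive constant, and gathering the whole graph is good enough (`localSolvable_card`). Or
`(C₂ + 3) * (T N + 1) ≤ N` for a single `N`, and then the behavior of the online algorithm on graphs
of that one size yields a finite rule that solves the problem for every `n` with locality `O(log*
n)`.

The rule (`IsCutRule`) tells how to label a window of `2 * r + 1` nodes, given the `h` inputs on
either side, such that any two labeled windows, in any orientation and with any short input word
between them, can be joined by a valid labeling. It is extracted in `exists_isCutRule`. By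
pigeonhole on prefixes, every input word of length `h` is interchangeable with words of length at
least `T N + 1` (`exists_pumping`). Replacing the inputs beside a window by such long words hides
from the online algorithm what lies beyond them. The adversary presents the centers of several
copies of all these segments first. The algorithm sees only disjoint lines, so its answers depend
neither on the order of the segments nor on their orientation nor on what separates them
(`exists_online_answers`). Two copies of each segment get equal labels, which become the rule. Since
the algorithm must succeed on every arrangement of the segments, the gap between any two windows can
be filled, and pumping back gives the same for the original short words.

In the LOCAL model, color reduction and a greedy choice select windows that are far apart but not
too far apart, in `O(log* n)` rounds (`exists_cuts`). The selected windows are labeled by the rule,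
and each bounded gap, or bounded end of a path, is completed by a brute-force choice on which all of
its nodes agree (`IsLayout.check_finish`).

Paths and cycles are treated uniformly as sequences `ℤ → Option β`: a path occupies an interval and
a cycle becomes a periodic sequence (`Unrolling`). A view of radius `t` is then the sequence within
distance `t` up to reflection (`agree_of_isomorphic`), and LOCAL algorithms become functions
satisfying `Loc`. -/

/-! ### Isomorphisms of views and of balls. -/

theorem View.Isomorphic.refl {α : Type*} (A : View α) : A.Isomorphic A :=
  ⟨SimpleGraph.Iso.refl, fun _ => rfl, List.map_id _⟩

theorem View.Isomorphic.symm {α : Type*} {A B : View α} (h : A.Isomorphic B) : B.Isomorphic A := by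
  obtain ⟨e, hl, hs⟩ := h
  refine ⟨e.symm, fun v => ?_, ?_⟩
  · rw [← hl (e.symm v)]; simp
  · rw [← hs, List.map_map]
    convert List.map_id _
    ext v; simp

theorem View.Isomorphic.trans {α : Type*} {A B C : View α} (h : A.Isomorphic B)
    (h' : B.Isomorphic C) : A.Isomorphic C := by
  obtain ⟨e, hl, hs⟩ := h
  obtain ⟨e', hl', hs'⟩ := h'
  refine ⟨e.trans e', fun v => ?_, ?_⟩
  · rw [← hl, ← hl']; rfl
  · rw [← hs', ← hs, List.map_map]; rfl

theorem edist_le_succ_iff {V : Type} {G : SimpleGraph V} {v u : V} {t : ℕ} :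
    G.edist v u ≤ (t + 1 : ℕ) ↔ G.edist v u ≤ t ∨ ∃ w, G.edist v w ≤ t ∧ G.Adj w u := by
  constructor
  · intro h
    have hne : G.edist u v ≠ ⊤ := by
      rw [SimpleGraph.edist_comm]
      exact ne_top_of_le_ne_top (ENat.natCast_ne_top _) h
    obtain ⟨p, hp⟩ := SimpleGraph.exists_walk_of_edist_ne_top hne
    rw [SimpleGraph.edist_comm, ← hp] at h
    cases p with
    | nil => left; simp
    | cons hadj q =>
      right
      refine ⟨_, ?_, hadj.symm⟩
      rw [SimpleGraph.edist_comm]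
      refine (SimpleGraph.edist_le q).trans ?_
      simp only [SimpleGraph.Walk.length_cons, Nat.cast_le] at h ⊢
      omega
  · rintro (h | ⟨w, h, hadj⟩)
    · exact h.trans (by simp)
    · refine (SimpleGraph.edist_triangle (v := w)).trans ?_
      rw [SimpleGraph.edist_eq_one_iff_adj.2 hadj]
      push_cast
      gcongr

theorem mem_ballUnion_zero {V : Type} {G : SimpleGraph V} {s : List V} {u : V} :
    u ∈ ballUnion G 0 s ↔ u ∈ s := by
  simp only [ballUnion, Set.mem_ofPred_eq, Nat.cast_zero, nonpos_iff_eq_zero,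
    SimpleGraph.edist_eq_zero_iff]
  constructor
  · rintro ⟨v, hv, rfl⟩; exact hv
  · exact fun h => ⟨u, h, rfl⟩

theorem mem_ballUnion_succ {V : Type} {G : SimpleGraph V} {s : List V} {t : ℕ} {u : V} :
    u ∈ ballUnion G (t + 1) s ↔ u ∈ ballUnion G t s ∨ ∃ w ∈ ballUnion G t s, G.Adj w u := by
  simp only [ballUnion, Set.mem_ofPred_eq, edist_le_succ_iff]
  constructor
  · rintro ⟨v, hv, h | ⟨w, hw, hadj⟩⟩
    · exact Or.inl ⟨v, hv, h⟩
    · exact Or.inr ⟨w, ⟨v, hv, hw⟩, hadj⟩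
  · rintro (⟨v, hv, h⟩ | ⟨w, ⟨v, hv, hw⟩, hadj⟩)
    · exact ⟨v, hv, Or.inl h⟩
    · exact ⟨v, hv, Or.inr ⟨w, hw, hadj⟩⟩

theorem ballUnion_mono {V : Type} {G : SimpleGraph V} {s : List V} {t t' : ℕ} (h : t ≤ t') :
    ballUnion G t s ⊆ ballUnion G t' s :=
  fun _ ⟨v, hv, hu⟩ => ⟨v, hv, hu.trans (by exact_mod_cast h)⟩

section Transport

variable {U V : Type} {X : SimpleGraph U} {G : SimpleGraph V} {φ : U → V} {t : ℕ} {s : List U}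

/-- Induction on the radius: `adj` pushes a step forward and `lift` pulls it back. Neighbors need
lifting only at radii below `t`, because edges that leave the outermost layer are invisible. -/
theorem image_ballUnion
    (adj : ∀ x ∈ ballUnion X t s, ∀ y ∈ ballUnion X t s, X.Adj x y → G.Adj (φ x) (φ y))
    (lift : ∀ t' < t, ∀ x ∈ ballUnion X t' s, ∀ w, G.Adj (φ x) w → ∃ y, X.Adj x y ∧ φ y = w) :
    φ '' ballUnion X t s = ballUnion G t (s.map φ) := by
  suffices h : ∀ t' ≤ t, φ '' ballUnion X t' s = ballUnion G t' (s.map φ) from h t le_rfl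
  intro t' ht'
  induction t' with
  | zero => ext u; simp [mem_ballUnion_zero]
  | succ k ih =>
    have ih := ih (by omega)
    ext u
    simp only [mem_ballUnion_succ, ← ih, Set.mem_image]
    constructor
    · rintro ⟨x, hx | ⟨w, hw, hadj⟩, rfl⟩
      · exact Or.inl ⟨x, hx, rfl⟩
      · refine Or.inr ⟨φ w, ⟨w, hw, rfl⟩, adj w (ballUnion_mono (by omega) hw) x ?_ hadj⟩
        exact ballUnion_mono ht' (mem_ballUnion_succ.2 (Or.inr ⟨w, hw, hadj⟩))
    · rintro (⟨x, hx, rfl⟩ | ⟨_, ⟨w, hw, rfl⟩, hadj⟩)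
      · exact ⟨x, Or.inl hx, rfl⟩
      · obtain ⟨y, hy, rfl⟩ := lift k (by omega) w hw u hadj
        exact ⟨y, Or.inr ⟨w, hw, hy⟩, rfl⟩

/-- A map that is injective on the balls around the nodes of `s` and is a local isomorphism there
induces an isomorphism of views. -/
theorem isomorphic_ballView_map {α : Type*} {lab : U → α} {lab' : V → α}
    (inj : Set.InjOn φ (ballUnion X t s))
    (adj : ∀ x ∈ ballUnion X t s, ∀ y ∈ ballUnion X t s, G.Adj (φ x) (φ y) ↔ X.Adj x y)
    (lift : ∀ t' < t, ∀ x ∈ ballUnion X t' s, ∀ w, G.Adj (φ x) w → ∃ y, X.Adj x y ∧ φ y = w)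
    (hlab : ∀ x ∈ ballUnion X t s, lab' (φ x) = lab x) :
    (ballView X lab t s).Isomorphic (ballView G lab' t (s.map φ)) := by
  have himg := image_ballUnion (fun x hx y hy => (adj x hx y hy).2) lift
  have hbij : Set.BijOn φ (ballUnion X t s) (ballUnion G t (s.map φ)) :=
    himg ▸ inj.bijOn_image
  refine ⟨⟨hbij.equiv φ, ?_⟩, ?_, ?_⟩
  · intro (a : ballUnion X t s) (b : ballUnion X t s)
    exact adj a a.2 b b.2
  · intro (v : ballUnion X t s)
    exact hlab v v.2
  · apply List.map_injective_iff.2 Subtype.val_injective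
    have h1 : ∀ l : List (ballUnion X t s),
        (l.map (hbij.equiv φ)).map Subtype.val = (l.map Subtype.val).map φ := by
      intro l; simp only [List.map_map]; rfl
    refine (h1 _).trans ?_
    simp [ballView]

end Transport

theorem isomorphic_ballView_iso {U V : Type} {α : Type*} {X : SimpleGraph U} {G : SimpleGraph V}
    {lab : U → α} {lab' : V → α} (e : X ≃g G) (hlab : ∀ x, lab' (e x) = lab x) (t : ℕ)
    (s : List U) : (ballView X lab t s).Isomorphic (ballView G lab' t (s.map e)) :=
  isomorphic_ballView_map e.injective.injOn (fun _ _ _ _ => e.map_adj_iff)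
    (fun _ _ x _ w h => ⟨e.symm w, by
      rw [← e.map_adj_iff]; simpa using h, by simp⟩) (fun x _ => hlab x)

theorem Problem.Feasible.of_iso {In Out : Type*} {P : Problem In Out} {U V : Type}
    {X : SimpleGraph U} {G : SimpleGraph V} {I : U → In} {J : V → In} {L : U → Out} {M : V → Out}
    (e : X ≃g G) (hI : ∀ x, J (e x) = I x) (hL : ∀ x, M (e x) = L x) (h : P.Feasible X I L) :
    P.Feasible G J M := by
  intro v
  have := isomorphic_ballView_iso (lab := fun u => (I u, L u)) (lab' := fun u => (J u, M u)) e
    (by simp [hI, hL]) P.radius [e.symm v]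
  simp only [List.map_cons, List.map_nil, RelIso.apply_symm_apply] at this
  exact P.allowed_iso _ _ this (h _)

/-! ### Functions on isomorphism classes of views, and least localities. -/

/-- A function on views that does not distinguish isomorphic views may be prescribed on any family
of views, as long as isomorphic views get the same value. -/
theorem exists_view_function {α Out : Type*} [Nonempty Out] {ι : Sort*} (view : ι → View α)
    (val : ι → Out) (h : ∀ i j, (view i).Isomorphic (view j) → val i = val j) :
    ∃ out : View α → Out, (∀ A B, A.Isomorphic B → out A = out B) ∧ ∀ i, out (view i) = val i := by
  classical
  -- The predicate under `Classical.epsilon` is literally the same for isomorphic views, so the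
  -- chosen value is too.
  refine ⟨fun A => Classical.epsilon fun o => ∃ i, A.Isomorphic (view i) ∧ val i = o, ?_, ?_⟩
  · intro A B hAB
    refine congrArg Classical.epsilon (funext fun o => propext ?_)
    exact ⟨fun ⟨i, hi, ho⟩ => ⟨i, hAB.symm.trans hi, ho⟩, fun ⟨i, hi, ho⟩ => ⟨i, hAB.trans hi, ho⟩⟩
  · intro i
    have : ∃ o, ∃ j, (view i).Isomorphic (view j) ∧ val j = o := ⟨_, i, View.Isomorphic.refl _, rfl⟩
    obtain ⟨j, hj, ho⟩ := Classical.epsilon_spec this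
    exact ho.symm.trans (h _ _ hj).symm

/-- The problem `P` can be solved on graphs with `n` nodes in the LOCAL model with locality `t`. -/
def LocalSolvable {In Out : Type*} (c : ℕ) (P : Problem In Out) (n t : ℕ) : Prop :=
  ∃ out : View (In × ℕ) → Out, (∀ A B, A.Isomorphic B → out A = out B) ∧
    ∀ (V : Type) [Finite V] (G : SimpleGraph V), P.family V G → Nat.card V = n →
    ∀ (I : V → In) (ident : V → ℕ), Function.Injective ident →
      (∀ v, 1 ≤ ident v ∧ ident v ≤ Nat.card V ^ c) →
        P.Feasible G I fun v => out (ballView G (fun u => (I u, ident u)) t [v])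

/-- Algorithms know `n`, so solvability is a separate question for each `n`. The best locations of
`T` for the individual sizes can therefore be attained by one algorithm, and a pointwise least
function exists. -/
theorem exists_isLocalityLocal {In Out : Type*} {c : ℕ} {P : Problem In Out} {F : ℕ → ℕ}
    (h : ∀ n, LocalSolvable c P n (F n)) :
    ∃ T', IsLocalityLocal c P T' ∧ ∀ n t, LocalSolvable c P n t → T' n ≤ t := by
  classical
  have hex : ∀ n, ∃ t, LocalSolvable c P n t := fun n => ⟨_, h n⟩
  have hmin : ∀ n t, LocalSolvable c P n t → Nat.find (hex n) ≤ t := fun n t => Nat.find_min' _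
  refine ⟨fun n => Nat.find (hex n), ⟨⟨_, le_rfl, ?_⟩, ?_⟩, hmin⟩
  · have hspec : ∀ n, LocalSolvable c P n (Nat.find (hex n)) := fun n => Nat.find_spec (hex n)
    choose out hout hsol using hspec
    exact ⟨⟨out, hout⟩, fun V _ G hG I ident hinj hid => hsol _ V G hG rfl I ident hinj hid⟩
  · rintro T ⟨T₀, hT₀, A, hA⟩ n
    refine (hmin n (T₀ n) ⟨A.out n, A.out_iso n, ?_⟩).trans (hT₀ n)
    rintro V _ G hG rfl I ident hinj hid
    exact hA V G hG I ident hinj hid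

theorem exists_feasible {In Out : Type*} {P : Problem In Out} {A : Algorithm In Out} {T : ℕ → ℕ}
    (hA : SolvesOnline P A T) {V : Type} [Finite V] {G : SimpleGraph V} (hG : P.family V G)
    (I : V → In) : ∃ L, P.Feasible G I L :=
  ⟨_, hA V G hG I (Finite.equivFin V).symm⟩

/-- In a connected graph, gathering everything suffices. -/
theorem localSolvable_card {In Out : Type*} [Nonempty Out] {c : ℕ} {P : Problem In Out}
    (hconn : ∀ (V : Type) [Finite V] (G : SimpleGraph V), P.family V G → G.Preconnected)
    (hex : ∀ (V : Type) [Finite V] (G : SimpleGraph V), P.family V G →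
      ∀ I : V → In, ∃ L, P.Feasible G I L) (n : ℕ) :
    LocalSolvable c P n n := by
  let good : (Σ' (V : Type) (_ : SimpleGraph V) (_ : V → In) (_ : V → ℕ), V) → Prop :=
    fun i => i.2.1.Preconnected ∧ Finite i.1 ∧ Nat.card i.1 = n
  let view : Subtype good → View (In × ℕ) :=
    fun i => ballView i.1.2.1 (fun u => (i.1.2.2.1 u, i.1.2.2.2.1 u)) n [i.1.2.2.2.2]
  -- The solution is chosen as a function of identifiers instead of nodes. Isomorphic views then
  -- pose the same predicate, and all nodes of a graph settle on the same solution.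
  let val : Subtype good → Out :=
    fun i => Classical.epsilon
      (fun L : ℕ → Out => P.Feasible i.1.2.1 i.1.2.2.1 (L ∘ i.1.2.2.2.1)) (i.1.2.2.2.1 i.1.2.2.2.2)
  obtain ⟨out, hiso, hout⟩ := exists_view_function view val (by
    have huniv : ∀ i : Subtype good, ∀ u, u ∈ ballUnion i.1.2.1 n [i.1.2.2.2.2] := by
      rintro ⟨⟨V, G, I, ident, v⟩, hc, hfin, hcard⟩ u
      simp only at hc hfin hcard ⊢
      refine ⟨v, by simp, ?_⟩
      obtain ⟨p, hp⟩ := (hc v u).exists_isPath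
      refine (SimpleGraph.edist_le p).trans ?_
      have := Fintype.ofFinite V
      have := hp.length_lt
      rw [← Nat.card_eq_fintype_card, hcard] at this
      exact_mod_cast this.le
    rintro i j ⟨e, hl, hs⟩
    let gi : (ballView i.1.2.1 (fun u => (i.1.2.2.1 u, i.1.2.2.2.1 u)) n [i.1.2.2.2.2]).graph ≃g
        i.1.2.1 := ⟨Equiv.subtypeUnivEquiv (huniv i), Iff.rfl⟩
    let gj : (ballView j.1.2.1 (fun u => (j.1.2.2.1 u, j.1.2.2.2.1 u)) n [j.1.2.2.2.2]).graph ≃g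
        j.1.2.1 := ⟨Equiv.subtypeUnivEquiv (huniv j), Iff.rfl⟩
    let f : i.1.2.1 ≃g j.1.2.1 := (gi.symm.trans e).trans gj
    have hf : ∀ v, (j.1.2.2.1 (f v), j.1.2.2.2.1 (f v)) = (i.1.2.2.1 v, i.1.2.2.2.1 v) :=
      fun v => hl ⟨v, huniv i v⟩
    have hf1 : ∀ v, j.1.2.2.1 (f v) = i.1.2.2.1 v := fun v => congrArg Prod.fst (hf v)
    have hf2 : ∀ v, j.1.2.2.2.1 (f v) = i.1.2.2.2.1 v := fun v => congrArg Prod.snd (hf v)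
    have hcenter : f i.1.2.2.2.2 = j.1.2.2.2.2 := by
      have := congrArg (List.map Subtype.val) hs
      simp only [view, ballView, List.attachWith_cons, List.attachWith_nil, List.map_cons,
        List.map_nil, List.cons.injEq, and_true] at this
      exact this
    have hpred : (fun L : ℕ → Out => P.Feasible i.1.2.1 i.1.2.2.1 (L ∘ i.1.2.2.2.1)) =
        fun L : ℕ → Out => P.Feasible j.1.2.1 j.1.2.2.1 (L ∘ j.1.2.2.2.1) := by
      ext L
      constructor
      · exact fun h => h.of_iso f hf1 (by simp [hf2])
      · refine fun h => h.of_iso f.symm (fun x => ?_) (fun x => ?_)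
        · rw [← hf1]; simp
        · simp only [Function.comp]; rw [← hf2]; simp
    simp only [val, hpred]
    rw [← hcenter, hf2])
  refine ⟨out, hiso, ?_⟩
  intro V _ G hG hcard I ident hinj hid
  have hval : ∀ v, out (ballView G (fun u => (I u, ident u)) n [v]) = Classical.epsilon
      (fun L : ℕ → Out => P.Feasible G I (L ∘ ident)) (ident v) :=
    fun v => hout ⟨⟨V, G, I, ident, v⟩, hconn V G hG, ‹_›, hcard⟩
  simp only [hval]
  have hex' : ∃ L : ℕ → Out, P.Feasible G I (L ∘ ident) := by
    obtain ⟨L, hL⟩ := hex V G hG I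
    refine ⟨Function.extend ident L fun _ => Classical.arbitrary Out, ?_⟩
    rwa [Function.extend_comp hinj]
  exact Classical.epsilon_spec hex'

/-! ### Sequences over the integers and their views. -/

/-- The positions at which a bi-infinite sequence has a letter. -/
def supp {β : Type*} (x : ℤ → Option β) : Set ℤ := {i | x i ≠ none}

theorem mem_supp {β : Type*} {x : ℤ → Option β} {i : ℤ} : i ∈ supp x ↔ x i ≠ none := Iff.rfl

/-- The graph on the integers in which consecutive positions are adjacent if both have a letter. -/
def lineGraph {β : Type*} (x : ℤ → Option β) : SimpleGraph ℤ where
  Adj i j := (j = i + 1 ∨ i = j + 1) ∧ x i ≠ none ∧ x j ≠ none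
  symm := ⟨fun _ _ ⟨h, hi, hj⟩ => ⟨h.symm, hj, hi⟩⟩
  loopless := ⟨fun i ⟨h, _⟩ => by omega⟩

theorem lineGraph_adj {β : Type*} {x : ℤ → Option β} {i j : ℤ} :
    (lineGraph x).Adj i j ↔ (j = i + 1 ∨ i = j + 1) ∧ x i ≠ none ∧ x j ≠ none := Iff.rfl

/-- The radius-`t` view of position `i` in a bi-infinite sequence. -/
noncomputable def lineView {β : Type*} [Nonempty β] (x : ℤ → Option β) (t : ℕ) (i : ℤ) : View β :=
  ballView (lineGraph x) (fun j => (x j).getD (Classical.arbitrary β)) t [i]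

theorem abs_sub_le_of_mem_ballUnion {β : Type*} {x : ℤ → Option β} {t : ℕ} {i j : ℤ}
    (h : j ∈ ballUnion (lineGraph x) t [i]) : |j - i| ≤ t := by
  induction t generalizing j with
  | zero => simp only [mem_ballUnion_zero, List.mem_singleton] at h; simp [h]
  | succ t ih =>
    rw [mem_ballUnion_succ] at h
    push_cast
    obtain h | ⟨w, hw, hadj⟩ := h
    · have := ih h; omega
    · have := ih hw
      rw [lineGraph_adj] at hadj
      rw [abs_le] at *
      omega

/-- As the letters occupy an interval, no letter is missing on the way from `i` to `j`, and graph
distance is distance of integers. -/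
theorem mem_ballUnion_lineGraph {β : Type*} {x : ℤ → Option β} (hx : (supp x).OrdConnected)
    {t : ℕ} {i j : ℤ} (hi : x i ≠ none) :
    j ∈ ballUnion (lineGraph x) t [i] ↔ |j - i| ≤ t ∧ x j ≠ none := by
  refine ⟨fun h => ⟨abs_sub_le_of_mem_ballUnion h, ?_⟩, ?_⟩
  · cases t with
    | zero => simp only [mem_ballUnion_zero, List.mem_singleton] at h; simpa [h]
    | succ t =>
      induction t generalizing j with
      | zero =>
        rw [mem_ballUnion_succ] at h
        obtain h | ⟨w, hw, hadj⟩ := h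
        · simp only [mem_ballUnion_zero, List.mem_singleton] at h; simpa [h]
        · exact hadj.2.2
      | succ t ih =>
        rw [mem_ballUnion_succ] at h
        obtain h | ⟨w, hw, hadj⟩ := h
        · exact ih h
        · exact hadj.2.2
  · induction t generalizing j with
    | zero =>
      rintro ⟨h, -⟩
      have : j = i := by rw [abs_le] at h; push_cast at h; omega
      simp [mem_ballUnion_zero, this]
    | succ t ih =>
      rintro ⟨h, hj⟩
      rw [mem_ballUnion_succ]
      by_cases hle : |j - i| ≤ t
      · exact Or.inl (ih ⟨hle, hj⟩)
      · right
        push_cast at h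
        rcases lt_or_ge i j with hlt | hge
        · rw [abs_of_pos (by omega)] at h hle
          have hw : x (j - 1) ≠ none := hx.out hi hj ⟨by omega, by omega⟩
          exact ⟨j - 1, ih ⟨by rw [abs_le]; omega, hw⟩, Or.inl (by omega), hw, hj⟩
        · rw [abs_of_nonpos (by omega)] at h hle
          have hw : x (j + 1) ≠ none := hx.out hj hi ⟨by omega, by omega⟩
          exact ⟨j + 1, ih ⟨by rw [abs_le]; omega, hw⟩, Or.inr (by omega), hw, hj⟩

/-- The sequences `x` and `x'`, seen from `i` and `i'`, agree up to distance `t` and up to a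
reflection. -/
def Agree {γ : Type*} (t : ℕ) (x : ℤ → γ) (i : ℤ) (x' : ℤ → γ) (i' : ℤ) : Prop :=
  ∃ ε : ℤ, (ε = 1 ∨ ε = -1) ∧ ∀ j : ℤ, |j| ≤ t → x (i + j) = x' (i' + ε * j)

theorem Agree.isomorphic {β : Type*} [Nonempty β] {t : ℕ} {x x' : ℤ → Option β} {i i' : ℤ}
    (h : Agree t x i x' i') : (lineView x t i).Isomorphic (lineView x' t i') := by
  obtain ⟨ε, hε, h⟩ := h
  have h' : ∀ j, |j - i| ≤ t → x' (i' + ε * (j - i)) = x j := by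
    intro j hj
    rw [← h _ hj]; congr 1; omega
  have := isomorphic_ballView_map (X := lineGraph x) (G := lineGraph x') (t := t) (s := [i])
    (φ := fun j => i' + ε * (j - i)) (lab := fun j => (x j).getD (Classical.arbitrary β))
    (lab' := fun j => (x' j).getD (Classical.arbitrary β)) ?_ ?_ ?_ ?_
  · simpa [lineView] using this
  · intro a _ b _ hab
    rcases hε with rfl | rfl <;> simp at hab <;> omega
  · intro a ha b hb
    have ha := abs_sub_le_of_mem_ballUnion ha
    have hb := abs_sub_le_of_mem_ballUnion hb
    simp only [lineGraph_adj, h' _ ha, h' _ hb]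
    rcases hε with rfl | rfl <;> refine and_congr_left' ?_ <;> omega
  · intro t' ht' a ha w hw
    have ha := abs_sub_le_of_mem_ballUnion ha
    simp only [lineGraph_adj, h' a (by omega)] at hw
    obtain ⟨hw, hxa, hxw⟩ := hw
    have hwe : i' + ε * (i + ε * (w - i') - i) = w := by rcases hε with rfl | rfl <;> ring
    refine ⟨i + ε * (w - i'), ⟨?_, hxa, ?_⟩, hwe⟩
    · rcases hε with rfl | rfl <;> omega
    · rw [← h', hwe]
      · exact hxw
      · rw [abs_le] at ha ⊢
        rcases hε with rfl | rfl <;> omega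
  · intro a ha
    simp only [h' a (abs_sub_le_of_mem_ballUnion ha)]

/-- An isomorphism between intervals that matches the centers is determined by the images of the
neighbors of the center: it is a translation or a reflection. -/
theorem agree_of_isomorphic {β : Type*} [Nonempty β] {t : ℕ} {x x' : ℤ → Option β} {i i' : ℤ}
    (hx : (supp x).OrdConnected) (hx' : (supp x').OrdConnected) (hi : x i ≠ none)
    (hi' : x' i' ≠ none) (h : (lineView x t i).Isomorphic (lineView x' t i')) :
    Agree t x i x' i' := by
  obtain ⟨e, hl, hs⟩ := h
  obtain ⟨B, hB⟩ : ∃ B, B = ballUnion (lineGraph x) t [i] := ⟨_, rfl⟩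
  obtain ⟨B', hB'⟩ : ∃ B', B' = ballUnion (lineGraph x') t [i'] := ⟨_, rfl⟩
  have mB : ∀ {j}, j ∈ B ↔ |j - i| ≤ t ∧ x j ≠ none := hB ▸ mem_ballUnion_lineGraph hx hi
  have mB' : ∀ {j}, j ∈ B' ↔ |j - i'| ≤ t ∧ x' j ≠ none := hB' ▸ mem_ballUnion_lineGraph hx' hi'
  let d := Classical.arbitrary β
  -- The isomorphism and its inverse are extended by junk to functions on all integers, which
  -- removes the subtypes from the rest of the argument.
  obtain ⟨f, hfB, hfl, hfi, hfa, hfinj, g, hgB, hgf, hfg⟩ : ∃ f : ℤ → ℤ, (∀ j ∈ B, f j ∈ B') ∧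
      (∀ j ∈ B, (x' (f j)).getD d = (x j).getD d) ∧ f i = i' ∧
      (∀ j ∈ B, ∀ k ∈ B, k = j + 1 ∨ j = k + 1 → f k = f j + 1 ∨ f j = f k + 1) ∧
      (∀ j ∈ B, ∀ k ∈ B, f j = f k → j = k) ∧
      ∃ g : ℤ → ℤ, (∀ j ∈ B', g j ∈ B) ∧ (∀ j ∈ B, g (f j) = j) ∧ (∀ j ∈ B', f (g j) = j) := by
    subst hB hB'
    classical
    let e' : ballUnion (lineGraph x) t [i] ≃ ballUnion (lineGraph x') t [i'] := e.toEquiv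
    have hadj : ∀ a b : ballUnion (lineGraph x) t [i], (lineGraph x').Adj (e' a) (e' b) ↔
        (lineGraph x).Adj a b := fun a b => e.map_rel_iff'
    let f : ℤ → ℤ := fun j => if h : j ∈ ballUnion (lineGraph x) t [i] then e' ⟨j, h⟩ else 0
    let g : ℤ → ℤ := fun j => if h : j ∈ ballUnion (lineGraph x') t [i'] then e'.symm ⟨j, h⟩ else 0
    have hf : ∀ j (h : j ∈ ballUnion (lineGraph x) t [i]), f j = e' ⟨j, h⟩ :=
      fun j h => by simp only [f, dif_pos h]
    have hg : ∀ j (h : j ∈ ballUnion (lineGraph x') t [i']), g j = e'.symm ⟨j, h⟩ :=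
      fun j h => by simp only [g, dif_pos h]
    refine ⟨f, ?_, ?_, ?_, ?_, ?_, g, ?_, ?_, ?_⟩
    · intro j hj; rw [hf j hj]; exact (e' _).2
    · intro j hj; rw [hf j hj]; exact hl ⟨j, hj⟩
    · have hi0 : i ∈ ballUnion (lineGraph x) t [i] := mB.2 ⟨by simp, hi⟩
      rw [hf i hi0]
      have := congrArg (List.map Subtype.val) hs
      simp only [lineView, ballView, List.attachWith_cons, List.attachWith_nil, List.map_cons,
        List.map_nil, List.cons.injEq, and_true] at this
      exact this
    · intro j hj k hk hjk
      rw [hf j hj, hf k hk]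
      exact ((hadj ⟨j, hj⟩ ⟨k, hk⟩).2 ⟨hjk, (mB.1 hj).2, (mB.1 hk).2⟩).1
    · intro j hj k hk hjk
      rw [hf j hj, hf k hk] at hjk
      exact congrArg Subtype.val (e'.injective (Subtype.ext hjk))
    · intro j hj; rw [hg j hj]; exact (e'.symm _).2
    · intro j hj
      rw [hf j hj, hg _ (e' _).2]; simp
    · intro j hj
      rw [hg j hj, hf _ (e'.symm _).2]; simp
  clear hl hs e hB hB'
  have hiB : i ∈ B := mB.2 ⟨by simp, hi⟩
  have hiB' : i' ∈ B' := mB'.2 ⟨by simp, hi'⟩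
  have hgi : g i' = i := by rw [← hfi, hgf i hiB]
  -- propagation along one direction
  have prop : ∀ δ η : ℤ, (δ = 1 ∨ δ = -1) → (η = 1 ∨ η = -1) →
      (i + δ ∈ B → f (i + δ) = i' + η) → ∀ k : ℕ, i + δ * k ∈ B → f (i + δ * k) = i' + η * k := by
    intro δ η hδ hη h1 k
    induction k using Nat.strong_induction_on with
    | _ k ih =>
      intro hk
      match k, ih, hk with
      | 0, _, _ => simpa using hfi
      | 1, _, hk => simpa using h1 (by simpa using hk)
      | k + 2, ih, hk =>
        have hle := (mB.1 hk).1
        have hsub : ∀ m : ℕ, m ≤ k + 2 → i + δ * m ∈ B := by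
          intro m hm
          refine mB.2 ⟨?_, ?_⟩
          · rw [abs_le] at *; push_cast at *
            rcases hδ with rfl | rfl <;> omega
          · rcases hδ with rfl | rfl
            · exact hx.out hi (mB.1 hk).2 ⟨by omega, by push_cast; omega⟩
            · exact hx.out (mB.1 hk).2 hi ⟨by push_cast; omega, by omega⟩
        have h0 := ih k (by omega) (hsub k (by omega))
        have h1 := ih (k + 1) (by omega) (hsub (k + 1) (by omega))
        have ha := hfa _ (hsub (k + 1) (by omega)) _ hk
          (by push_cast; rcases hδ with rfl | rfl <;> omega)
        -- Injectivity forbids turning back, so the image continues in its direction.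
        have hne : f (i + δ * ↑(k + 2)) ≠ f (i + δ * k) := fun h => by
          have := hfinj _ hk _ (hsub k (by omega)) h
          push_cast at this
          rcases hδ with rfl | rfl <;> omega
        rw [h1] at ha
        rw [h0] at hne
        push_cast at *
        rcases hη with rfl | rfl <;> omega
  have hstep : ∀ δ : ℤ, (δ = 1 ∨ δ = -1) → i + δ ∈ B → f (i + δ) = i' + 1 ∨ f (i + δ) = i' - 1 := by
    intro δ hδ h
    have := hfa i hiB _ h (by omega)
    omega
  obtain ⟨ε, hε, hfε⟩ : ∃ ε : ℤ, (ε = 1 ∨ ε = -1) ∧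
      ∀ δ : ℤ, (δ = 1 ∨ δ = -1) → i + δ ∈ B → f (i + δ) = i' + ε * δ := by
    by_cases h1 : i + 1 ∈ B
    · refine ⟨f (i + 1) - i', by have := hstep 1 (by simp) h1; omega, ?_⟩
      rintro δ (rfl | rfl) hδ
      · omega
      · have h2 := hstep _ (by simp) h1
        have h3 := hstep _ (by simp) hδ
        have h4 : f (i + 1) ≠ f (i + -1) := fun h => by
          have := hfinj _ h1 _ hδ h; omega
        omega
    · by_cases h2 : i + -1 ∈ B
      · refine ⟨i' - f (i + -1), by have := hstep (-1) (by simp) h2; omega, ?_⟩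
        rintro δ (rfl | rfl) hδ
        · exact absurd hδ h1
        · omega
      · refine ⟨1, by simp, ?_⟩
        rintro δ (rfl | rfl) hδ
        · exact absurd hδ h1
        · exact absurd hδ h2
  have hfk : ∀ k : ℤ, i + k ∈ B → f (i + k) = i' + ε * k := by
    intro k hk
    rcases le_or_gt 0 k with h0 | h0
    · have := prop 1 ε (by simp) hε (fun h => by simpa using hfε 1 (by simp) h) k.toNat
      rw [Int.toNat_of_nonneg h0, one_mul] at this
      exact this hk
    · have := prop (-1) (-ε) (by simp) (by omega)
        (fun h => by simpa using hfε (-1) (by simp) h) (-k).toNat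
      rw [Int.toNat_of_nonneg (by omega)] at this
      simpa using this (by simpa using hk)
  refine ⟨ε, hε, fun k hk => ?_⟩
  by_cases hxk : x (i + k) = none
  · rw [hxk]
    -- A letter at the corresponding position would have a preimage in the ball, and this preimage
    -- could only be the empty position `i + k`.
    by_contra hne
    have hk' : i' + ε * k ∈ B' := by
      refine mB'.2 ⟨?_, Ne.symm hne⟩
      rw [abs_le] at *
      rcases hε with rfl | rfl <;> omega
    -- the reflected position is the image of some position of `B`
    have hgm := hgB _ hk'
    have h1 := hfk (g (i' + ε * k) - i) (by simpa using hgm)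
    rw [show i + (g (i' + ε * k) - i) = g (i' + ε * k) by ring, hfg _ hk'] at h1
    have h2 : g (i' + ε * k) = i + k := by rcases hε with rfl | rfl <;> omega
    rw [h2] at hgm
    exact (mB.1 hgm).2 hxk
  · have hkB : i + k ∈ B := mB.2 ⟨by simpa using hk, hxk⟩
    have h1 := hfl _ hkB
    have h2 := (mB'.1 (hfB _ hkB)).2
    rw [hfk _ hkB] at h1 h2
    obtain ⟨a, ha⟩ := Option.ne_none_iff_exists'.1 hxk
    obtain ⟨b, hb⟩ := Option.ne_none_iff_exists'.1 h2
    rw [ha, hb] at h1 ⊢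
    simpa using h1.symm

/-! ### Unrolling paths and cycles. -/

/-- The graph `G` on `n` nodes is traversed by the positions in `S`. -/
structure Unrolling {V : Type} (G : SimpleGraph V) (n : ℕ) (ψ : ℤ → V) (S : Set ℤ) : Prop where
  surj : ∀ v, ∃ i ∈ S, ψ i = v
  conn : S.OrdConnected
  inj : ∀ i ∈ S, ∀ j ∈ S, |i - j| < n → ψ i = ψ j → i = j
  adj : ∀ i ∈ S, ∀ w, G.Adj (ψ i) w ↔ (i + 1 ∈ S ∧ w = ψ (i + 1)) ∨ (i - 1 ∈ S ∧ w = ψ (i - 1))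

open Classical in
/-- The sequence of labels along an unrolling. -/
noncomputable def unrolled {V : Type} {β : Type*} (ψ : ℤ → V) (S : Set ℤ) (lab : V → β) (i : ℤ) :
    Option β :=
  if i ∈ S then some (lab (ψ i)) else none

theorem unrolled_ne_none {V : Type} {β : Type*} {ψ : ℤ → V} {S : Set ℤ} {lab : V → β} {i : ℤ} :
    unrolled ψ S lab i ≠ none ↔ i ∈ S := by
  simp [unrolled]

theorem unrolled_of_mem {V : Type} {β : Type*} {ψ : ℤ → V} {S : Set ℤ} {lab : V → β} {i : ℤ}
    (h : i ∈ S) : unrolled ψ S lab i = some (lab (ψ i)) := by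
  simp [unrolled, h]

theorem supp_unrolled {V : Type} {β : Type*} (ψ : ℤ → V) (S : Set ℤ) (lab : V → β) :
    supp (unrolled ψ S lab) = S := by
  ext i; exact unrolled_ne_none

/-- The bound on `t` keeps the view from closing up around a cycle: testing adjacency compares
positions up to `2 * t + 1` apart, and this must be less than `n`. -/
theorem Unrolling.isomorphic {V : Type} {β : Type*} [Nonempty β] {G : SimpleGraph V} {n : ℕ}
    {ψ : ℤ → V} {S : Set ℤ} (h : Unrolling G n ψ S) (lab : V → β) {t : ℕ} (ht : 2 * t + 2 ≤ n)
    {i : ℤ} (hi : i ∈ S) :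
    (lineView (unrolled ψ S lab) t i).Isomorphic (ballView G lab t [ψ i]) := by
  have hconn : (supp (unrolled ψ S lab)).OrdConnected := by rw [supp_unrolled]; exact h.conn
  have mB : ∀ {t j}, j ∈ ballUnion (lineGraph (unrolled ψ S lab)) t [i] ↔ |j - i| ≤ t ∧ j ∈ S := by
    intro t j
    rw [mem_ballUnion_lineGraph hconn (unrolled_ne_none.2 hi), unrolled_ne_none]
  refine isomorphic_ballView_map (s := [i]) ?_ ?_ ?_ ?_
  · intro a ha b hb hab
    rw [mB] at ha hb
    refine h.inj a ha.2 b hb.2 ?_ hab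
    rw [abs_le] at ha hb; rw [abs_lt]; omega
  · intro a ha b hb
    rw [mB, abs_le] at ha hb
    rw [h.adj a ha.2, lineGraph_adj, unrolled_ne_none, unrolled_ne_none]
    constructor
    · rintro (⟨hm, he⟩ | ⟨hm, he⟩)
      · have := h.inj b hb.2 _ hm (by rw [abs_lt]; omega) he
        exact ⟨by omega, ha.2, hb.2⟩
      · have := h.inj b hb.2 _ hm (by rw [abs_lt]; omega) he
        exact ⟨by omega, ha.2, hb.2⟩
    · rintro ⟨rfl | rfl, -, -⟩
      · exact Or.inl ⟨hb.2, rfl⟩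
      · exact Or.inr ⟨by simpa using hb.2, by simp⟩
  · intro t' ht' a ha w hw
    rw [mB] at ha
    rw [h.adj a ha.2] at hw
    simp only [lineGraph_adj, unrolled_ne_none]
    obtain ⟨hm, he⟩ | ⟨hm, he⟩ := hw
    · exact ⟨a + 1, ⟨by omega, ha.2, hm⟩, he.symm⟩
    · exact ⟨a - 1, ⟨by omega, ha.2, hm⟩, he.symm⟩
  · intro a ha
    rw [mB] at ha
    rw [unrolled_of_mem ha.2]; rfl

theorem exists_unrolling_path {V : Type} {G : SimpleGraph V} {n : ℕ} (hn : 0 < n)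
    (h : Nonempty (G ≃g SimpleGraph.pathGraph n)) : ∃ ψ, Unrolling G n ψ (Set.Ico 0 n) := by
  obtain ⟨e⟩ := h
  have hval : ∀ i ∈ Set.Ico (0 : ℤ) n, ∃ k : Fin n, (k : ℤ) = i := fun i hi =>
    ⟨⟨i.toNat, by have := hi.2; have := hi.1; omega⟩, by simpa using hi.1⟩
  refine ⟨fun i => e.symm ⟨i.toNat % n, Nat.mod_lt _ hn⟩, ?_⟩
  have hψ : ∀ k : Fin n, (⟨((k : ℕ) : ℤ).toNat % n, Nat.mod_lt _ hn⟩ : Fin n) = k := fun k => by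
    ext; simp [Nat.mod_eq_of_lt k.2]
  constructor
  · intro v
    refine ⟨((e v : ℕ) : ℤ), ⟨by simp, by exact_mod_cast (e v).2⟩, ?_⟩
    simp only [hψ]; simp
  · exact Set.ordConnected_Ico
  · intro i hi j hj _ hij
    obtain ⟨k, rfl⟩ := hval i hi
    obtain ⟨l, rfl⟩ := hval j hj
    simp only [hψ] at hij
    rw [e.symm.injective hij]
  · intro i hi w
    obtain ⟨k, rfl⟩ := hval i hi
    obtain ⟨l, rfl⟩ : ∃ l, w = e.symm l := ⟨e w, by simp⟩
    simp only [hψ]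
    rw [e.symm.map_adj_iff, SimpleGraph.pathGraph_adj]
    simp only [e.symm.injective.eq_iff, Fin.ext_iff, Set.mem_Ico]
    have := k.2
    have := l.2
    constructor
    · rintro (h | h)
      · refine Or.inl ⟨by omega, ?_⟩
        rw [Nat.mod_eq_of_lt (by omega)]; omega
      · refine Or.inr ⟨by omega, ?_⟩
        rw [Nat.mod_eq_of_lt (by omega)]; omega
    · rintro (⟨h1, h2⟩ | ⟨h1, h2⟩)
      · rw [Nat.mod_eq_of_lt (by omega)] at h2; omega
      · rw [Nat.mod_eq_of_lt (by omega)] at h2; omega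

theorem exists_unrolling_cycle {V : Type} {G : SimpleGraph V} {n : ℕ} (hn : 3 ≤ n)
    (h : Nonempty (G ≃g SimpleGraph.cycleGraph n)) : ∃ ψ, Unrolling G n ψ Set.univ := by
  obtain ⟨e⟩ := h
  have hlt : ∀ i : ℤ, (i % n).toNat < n := fun i => by
    have := Int.emod_nonneg i (show (n : ℤ) ≠ 0 by omega)
    have := Int.emod_lt_of_pos i (show (0 : ℤ) < n by omega)
    omega
  refine ⟨fun i => e.symm ⟨(i % n).toNat, hlt i⟩, ?_⟩
  have hcast : ∀ i : ℤ, (((i % n).toNat : ℕ) : ℤ) = i % n := fun i =>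
    Int.toNat_of_nonneg (Int.emod_nonneg i (by omega))
  have key : ∀ i j : ℤ, (⟨(i % n).toNat, hlt i⟩ : Fin n) = ⟨(j % n).toNat, hlt j⟩ ↔
      (n : ℤ) ∣ i - j := by
    intro i j
    rw [Fin.mk.injEq, ← Int.natCast_inj, hcast, hcast]
    exact Int.modEq_iff_dvd.trans (by rw [← dvd_neg, neg_sub])
  have hsub : ∀ i j : ℤ, ((⟨(i % n).toNat, hlt i⟩ - ⟨(j % n).toNat, hlt j⟩ : Fin n).val = 1) ↔
      (n : ℤ) ∣ i - j - 1 := by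
    intro i j
    rw [Fin.sub_def]
    simp only
    have hj := hlt j
    rw [← Int.natCast_inj]
    push_cast [Nat.cast_sub hj.le]
    rw [hcast, hcast]
    have h1 : ((n : ℤ) - j % n + i % n) % n = (i - j) % n := by
      rw [show (n : ℤ) - j % n + i % n = (i % n - j % n) + n * 1 by ring,
        Int.add_mul_emod_self_left, ← Int.sub_emod]
    rw [h1]
    constructor
    · intro h
      rw [Int.dvd_iff_emod_eq_zero, Int.sub_emod, h]; simp
    · intro h
      have := (Int.modEq_iff_dvd (a := 1) (b := i - j)).2 h
      rw [← this, Int.emod_eq_of_lt] <;> omega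
  constructor
  · intro v
    refine ⟨((e v : ℕ) : ℤ), trivial, ?_⟩
    rw [RelIso.symm_apply_eq]
    ext
    have : ((e v : ℕ) : ℤ) % n = (e v : ℕ) := Int.emod_eq_of_lt (by omega) (by omega)
    simp [this]
  · exact Set.ordConnected_univ
  · intro i _ j _ hlt hij
    have := e.symm.injective hij
    rw [key] at this
    have := Int.eq_zero_of_abs_lt_dvd this hlt
    omega
  · intro i _ w
    obtain ⟨j, rfl⟩ : ∃ j : ℤ, w = e.symm ⟨(j % n).toNat, hlt j⟩ := by
      refine ⟨((e w : ℕ) : ℤ), ?_⟩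
      rw [RelIso.eq_symm_apply]
      ext
      have : ((e w : ℕ) : ℤ) % n = (e w : ℕ) := Int.emod_eq_of_lt (by omega) (by omega)
      simp [this]
    rw [e.symm.map_adj_iff, SimpleGraph.cycleGraph_adj', hsub, hsub]
    simp only [Set.mem_univ, true_and, e.symm.injective.eq_iff, key]
    rw [or_comm]
    refine or_congr ?_ ?_
    · rw [show j - i - 1 = j - (i + 1) by ring]
    · rw [← Int.dvd_neg, show -(i - j - 1) = j - (i - 1) by ring]

/-! ### Windows, fillings and pumping of words. -/

/-- All infixes of `l` of length `2 * r + 1` satisfy `W`. -/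
def AllWindows {γ : Type*} (r : ℕ) (W : List γ → Prop) (l : List γ) : Prop :=
  ∀ w : List γ, w.length = 2 * r + 1 → w <:+: l → W w

section Windows

variable {γ : Type*} {r : ℕ} {W : List γ → Prop}

theorem AllWindows.infix {l l' : List γ} (h : AllWindows r W l) (hl : l' <:+: l) :
    AllWindows r W l' :=
  fun w hw hwl => h w hw (hwl.trans hl)

theorem AllWindows.reverse (hW : ∀ w : List γ, w.length = 2 * r + 1 → W w → W w.reverse)
    {l : List γ} (h : AllWindows r W l) : AllWindows r W l.reverse := by
  intro w hw hwl
  rw [← List.reverse_reverse w]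
  refine hW _ (by simpa using hw) (h _ (by simpa using hw) ?_)
  rw [← List.reverse_infix]; simpa using hwl

/-- A window that meets both parts reaches at most `2 * r` letters into `q`. -/
theorem allWindows_append_take {p q : List γ} :
    AllWindows r W (p ++ q) ↔ AllWindows r W (p ++ q.take (2 * r)) ∧ AllWindows r W q := by
  refine ⟨fun h => ⟨h.infix ?_, h.infix (List.suffix_append _ _).isInfix⟩, ?_⟩
  · exact (List.prefix_append_right_inj p).2 (List.take_prefix _ _) |>.isInfix
  · rintro ⟨h1, h2⟩ w hw hwl
    rcases List.infix_append_iff_ne_nil.1 hwl with h | h | ⟨l₁, l₂, hl₁, hl₂, rfl, hp, hq⟩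
    · exact h1 w hw (h.trans (List.prefix_append _ _).isInfix)
    · exact h2 w hw h
    · refine h1 _ hw (List.infix_append_iff.2 (Or.inr (Or.inr ⟨l₁, l₂, rfl, hp, ?_⟩)))
      rw [List.prefix_take_iff]
      have := List.length_pos_of_ne_nil hl₁
      rw [List.length_append] at hw
      exact ⟨hq, by omega⟩

theorem allWindows_append_drop {p q : List γ} :
    AllWindows r W (p ++ q) ↔
      AllWindows r W p ∧ AllWindows r W (p.drop (p.length - 2 * r) ++ q) := by
  refine ⟨fun h => ⟨h.infix (List.prefix_append _ _).isInfix, h.infix ?_⟩, ?_⟩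
  · exact by
      obtain ⟨s, hs⟩ := List.drop_suffix (p.length - 2 * r) p
      exact ⟨s, [], by rw [← List.append_assoc, hs, List.append_nil]⟩
  · rintro ⟨h1, h2⟩ w hw hwl
    rcases List.infix_append_iff_ne_nil.1 hwl with h | h | ⟨l₁, l₂, hl₁, hl₂, rfl, hp, hq⟩
    · exact h1 w hw h
    · exact h2 w hw (h.trans (List.suffix_append _ _).isInfix)
    · refine h2 _ hw (List.infix_append_iff.2 (Or.inr (Or.inr ⟨l₁, l₂, rfl, ?_, hq⟩)))
      have := List.length_pos_of_ne_nil hl₂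
      rw [List.length_append] at hw
      have := hp.length_le
      refine List.suffix_of_suffix_length_le hp (List.drop_suffix _ _) ?_
      rw [List.length_drop]; omega

end Windows

section Words

variable {In Out : Type*} {r : ℕ} {W : List (Option (In × Out)) → Prop}

/-- The input word `w` has a labeling that is compatible with the labeled words `a` and `b` on its
left and on its right. -/
def Fillable (r : ℕ) (W : List (Option (In × Out)) → Prop) (a : List (Option (In × Out)))
    (w : List In) (b : List (Option (In × Out))) : Prop :=
  ∃ s : List (In × Out), s.map Prod.fst = w ∧ AllWindows r W (a ++ s.map some ++ b)

/-- The filling interacts only with the nearest `2 * r` letters on each side. This is what leaves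
only finitely many classes of input words. -/
theorem fillable_iff_restrict {a b : List (Option (In × Out))} {w : List In} :
    Fillable r W a w b ↔ AllWindows r W a ∧ AllWindows r W b ∧
      Fillable r W (a.drop (a.length - 2 * r)) w (b.take (2 * r)) := by
  have key : ∀ s : List (In × Out), AllWindows r W (a ++ s.map some ++ b) ↔
      AllWindows r W a ∧ AllWindows r W b ∧
        AllWindows r W (a.drop (a.length - 2 * r) ++ s.map some ++ b.take (2 * r)) := by
    intro s
    rw [allWindows_append_take, List.append_assoc, allWindows_append_drop, ← List.append_assoc]
    tauto
  constructor
  · rintro ⟨s, rfl, h⟩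
    rw [key] at h
    exact ⟨h.1, h.2.1, s, rfl, h.2.2⟩
  · rintro ⟨h1, h2, s, rfl, h⟩
    exact ⟨s, rfl, (key s).2 ⟨h1, h2, h⟩⟩

theorem Fillable.reverse (hW : ∀ w, w.length = 2 * r + 1 → W w → W w.reverse)
    {a b : List (Option (In × Out))} {w : List In} (h : Fillable r W a w b) :
    Fillable r W b.reverse w.reverse a.reverse := by
  obtain ⟨s, rfl, h⟩ := h
  refine ⟨s.reverse, by simp, ?_⟩
  have := h.reverse hW
  simpa using this

/-- A labeled part of the word can be moved into its context. Hence `WordEquiv` is a congruence for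
concatenation. -/
theorem fillable_append {a b : List (Option (In × Out))} {u v : List In} :
    Fillable r W a (u ++ v) b ↔
      ∃ s : List (In × Out), s.map Prod.fst = v ∧ Fillable r W a u (s.map some ++ b) := by
  constructor
  · rintro ⟨s, hs, h⟩
    obtain ⟨s₁, s₂, rfl, h₁, h₂⟩ := List.map_eq_append_iff.1 hs
    exact ⟨s₂, h₂, s₁, h₁, by simpa using h⟩
  · rintro ⟨s₂, h₂, s₁, h₁, h⟩
    exact ⟨s₁ ++ s₂, by simp [h₁, h₂], by simpa using h⟩

theorem fillable_append' {a b : List (Option (In × Out))} {u v : List In} :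
    Fillable r W a (u ++ v) b ↔
      ∃ s : List (In × Out), s.map Prod.fst = u ∧ Fillable r W (a ++ s.map some) v b := by
  constructor
  · rintro ⟨s, hs, h⟩
    obtain ⟨s₁, s₂, rfl, h₁, h₂⟩ := List.map_eq_append_iff.1 hs
    exact ⟨s₁, h₁, s₂, h₂, by simpa using h⟩
  · rintro ⟨s₁, h₁, s₂, h₂, h⟩
    exact ⟨s₁ ++ s₂, by simp [h₁, h₂], by simpa using h⟩

/-- Two input words are equivalent if they can be labeled in the same contexts. -/
def WordEquiv (r : ℕ) (W : List (Option (In × Out)) → Prop) (w w' : List In) : Prop :=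
  ∀ a b, Fillable r W a w b ↔ Fillable r W a w' b

theorem WordEquiv.append_right {u u' : List In} (h : WordEquiv r W u u') (v : List In) :
    WordEquiv r W (u ++ v) (u' ++ v) := by
  intro a b
  simp only [fillable_append, h a _]

theorem WordEquiv.append_left {u u' : List In} (h : WordEquiv r W u u') (v : List In) :
    WordEquiv r W (v ++ u) (v ++ u') := by
  intro a b
  simp only [fillable_append', h _ b]

/-- Every word of a suitable length is equivalent to words that are as long as desired. -/
theorem exists_pumping [Finite In] [Finite Out] (r : ℕ) (W : List (Option (In × Out)) → Prop) :
    ∃ h, 1 ≤ h ∧ ∀ w : List In, w.length = h → ∀ k : ℕ, ∃ w' : List In,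
      WordEquiv r W w w' ∧ k ≤ w'.length ∧ w'.length ≤ (k + 1) * h := by
  classical
  let B := {l : List (Option (In × Out)) // l.length ≤ 2 * r}
  have : Finite B := List.finite_length_le _ _
  have : Fintype (Set (B × B)) := Fintype.ofFinite _
  -- The profile of a word records the short contexts in which it can be filled. It determines the
  -- class of the word, and `h` will be the number of possible profiles.
  let profile : List In → Set (B × B) := fun w => {p | Fillable r W p.1 w p.2}
  have hprofile : ∀ u v, profile u = profile v → WordEquiv r W u v := by
    intro u v huv a b
    rw [fillable_iff_restrict, fillable_iff_restrict (w := v)]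
    refine and_congr_right' (and_congr_right' ?_)
    have := Set.ext_iff.1 huv (⟨a.drop (a.length - 2 * r), by rw [List.length_drop]; omega⟩,
      ⟨b.take (2 * r), by rw [List.length_take]; omega⟩)
    exact this
  refine ⟨Fintype.card (Set (B × B)), Fintype.card_pos, fun w hw k => ?_⟩
  -- The word has `h + 1` prefixes, so two of them share a profile.
  obtain ⟨i, j, hij, he⟩ : ∃ i j : Fin (Fintype.card (Set (B × B)) + 1), i < j ∧
      profile (w.take i) = profile (w.take j) := by
    obtain ⟨i, j, hne, he⟩ := Fintype.exists_ne_map_eq_of_card_lt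
      (fun i : Fin (Fintype.card (Set (B × B)) + 1) => profile (w.take i)) (by simp)
    rcases lt_or_gt_of_ne hne with h | h
    · exact ⟨i, j, h, he⟩
    · exact ⟨j, i, h, he.symm⟩
  obtain ⟨x, hx⟩ : ∃ x, x = w.take i := ⟨_, rfl⟩
  obtain ⟨y, hy⟩ : ∃ y, y = (w.take j).drop i := ⟨_, rfl⟩
  obtain ⟨z, hz⟩ : ∃ z, z = w.drop j := ⟨_, rfl⟩
  have hi := i.2
  have hj := j.2
  have hij' : (i : ℕ) < j := hij
  have hxy : x ++ y = w.take j := by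
    rw [hx, hy]
    conv_rhs => rw [← List.take_append_drop i (w.take j)]
    rw [List.take_take, min_eq_left hij'.le]
  have hxyz : w = x ++ y ++ z := by rw [hxy, hz, List.take_append_drop]
  have hylen : 1 ≤ y.length := by
    rw [hy, List.length_drop, List.length_take]; omega
  have hequiv : WordEquiv r W x (x ++ y) := by
    rw [hxy, hx]; exact hprofile _ _ he
  have hpow : ∀ m, WordEquiv r W x (x ++ (List.replicate m y).flatten) := by
    intro m
    induction m with
    | zero => simp [WordEquiv]
    | succ m ih =>
      intro a b
      rw [ih a b, List.replicate_succ, List.flatten_cons, ← List.append_assoc]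
      exact hequiv.append_right _ a b
  -- The factor `y` between the two prefixes is nonempty, so `k` repetitions give length at least
  -- `k`. Each of the `k` copies has length at most `h`, and so has `x ++ z`.
  refine ⟨x ++ (List.replicate k y).flatten ++ z, ?_, ?_, ?_⟩
  · intro a b
    rw [hxyz, ← (hequiv.append_right z) a b]
    exact (hpow k).append_right z a b
  · simp only [List.length_append, List.length_flatten, List.map_replicate, List.sum_replicate,
      smul_eq_mul]
    nlinarith
  · have hlen : x.length + y.length + z.length = Fintype.card (Set (B × B)) := by
      rw [← hw, hxyz]; simp [add_assoc]
    simp only [List.length_append, List.length_flatten, List.map_replicate, List.sum_replicate,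
      smul_eq_mul]
    rw [← hlen]
    nlinarith [Nat.zero_le (k * x.length), Nat.zero_le (k * z.length)]

end Words

/-! ### Segments of sequences and verification by windows. -/

/-- The `n` consecutive values of the sequence `u` from position `a` on. -/
def seg {γ : Type*} (u : ℤ → γ) (a : ℤ) (n : ℕ) : List γ :=
  (List.range n).map fun k : ℕ => u (a + k)

section Seg

variable {γ δ : Type*} {u v : ℤ → γ} {a : ℤ} {m n : ℕ}

@[simp]
theorem length_seg : (seg u a n).length = n := by simp [seg]

theorem getElem?_seg {k : ℕ} (hk : k < n) : (seg u a n)[k]? = some (u (a + k)) := by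
  simp [seg, hk]

@[simp]
theorem getElem_seg {k : ℕ} (hk : k < (seg u a n).length) : (seg u a n)[k] = u (a + k) := by
  simp [seg]

theorem seg_add : seg u a (m + n) = seg u a m ++ seg u (a + m) n := by
  simp [seg, List.range_add, add_assoc, Function.comp_def]

theorem seg_congr (h : ∀ i, a ≤ i → i < a + n → u i = v i) : seg u a n = seg v a n := by
  refine List.map_congr_left fun k hk => h _ (by omega) ?_
  have := List.mem_range.1 hk; omega

theorem map_seg (f : γ → δ) : (seg u a n).map f = seg (fun i => f (u i)) a n := by
  simp [seg, Function.comp_def]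

theorem seg_reflect {b : ℤ} {ε : ℤ} (hε : ε = -1) :
    seg (fun i => u (b + ε * i)) a n = (seg u (b - a - n + 1) n).reverse := by
  subst hε
  refine List.ext_getElem (by simp) fun k hk _ => ?_
  simp only [getElem_seg, List.getElem_reverse, length_seg] at hk ⊢
  congr 1
  omega

theorem seg_translate {b : ℤ} : seg (fun i => u (b + i)) a n = seg u (b + a) n := by
  simp [seg, add_assoc]

theorem infix_seg_iff {w : List γ} (hw : w.length = m) :
    w <:+: seg u a n ↔ ∃ k : ℕ, k + m ≤ n ∧ w = seg u (a + k) m := by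
  constructor
  · rintro ⟨s, t, h⟩
    have hlen : s.length + m + t.length = n := by
      have := congrArg List.length h; simpa [hw, add_assoc] using this
    refine ⟨s.length, by omega, ?_⟩
    rw [← hlen, seg_add, seg_add] at h
    have h1 := (List.append_inj h (by simp [hw])).1
    exact (List.append_inj h1 (by simp)).2
  · rintro ⟨k, hk, rfl⟩
    obtain ⟨l, rfl⟩ := Nat.exists_eq_add_of_le hk
    rw [seg_add, seg_add]
    exact ⟨_, _, rfl⟩

theorem allWindows_seg {r : ℕ} {W : List γ → Prop} :
    AllWindows r W (seg u a n) ↔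
      ∀ i, a + r ≤ i → i + r + 1 ≤ a + n → W (seg u (i - r) (2 * r + 1)) := by
  constructor
  · intro h i h1 h2
    refine h _ (by simp) ((infix_seg_iff length_seg).2 ⟨(i - r - a).toNat, by omega, ?_⟩)
    congr 1; omega
  · intro h w hw hwl
    obtain ⟨k, hk, rfl⟩ := (infix_seg_iff hw).1 hwl
    have := h (a + k + r) (by omega) (by omega)
    rwa [show a + k + r - r = a + k by ring] at this

end Seg

/-- The bi-infinite sequence that starts at position `0` with the letters of a list. -/
def ofList {γ : Type*} (l : List (Option γ)) (j : ℤ) : Option γ :=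
  if 0 ≤ j then (l[j.toNat]?).join else none

section Check

variable {In Out : Type*} [Nonempty In] [Nonempty Out] (P : Problem In Out)

/-- The verification of `P` on a window of length `2 * P.radius + 1`. -/
def Problem.check (l : List (Option (In × Out))) : Prop :=
  ofList l P.radius = none ∨ lineView (ofList l) P.radius P.radius ∈ P.allowed

theorem ofList_seg {γ : Type*} {u : ℤ → Option γ} {a : ℤ} {n : ℕ} {j : ℤ} (h0 : 0 ≤ j)
    (hj : j < n) : ofList (seg u a n) j = u (a + j) := by
  rw [ofList, if_pos h0, getElem?_seg (by omega), Int.toNat_of_nonneg h0]; rfl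

variable {P}

theorem agree_zero {γ : Type*} {t : ℕ} {x x' : ℤ → γ} {i i' : ℤ} (h : Agree t x i x' i') :
    x i = x' i' := by
  obtain ⟨ε, -, h⟩ := h
  simpa using h 0 (by simp)

/-- The allowed neighborhoods are closed under isomorphism, so the verdict depends only on the
sequence near the position, up to reflection. In particular, it is invariant under reversal of
windows. -/
theorem check_congr_aux {x x' : ℤ → Option (In × Out)} {i i' : ℤ}
    (h : Agree P.radius x i x' i') :
    (x i = none ∨ lineView x P.radius i ∈ P.allowed) ↔
      (x' i' = none ∨ lineView x' P.radius i' ∈ P.allowed) := by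
  rw [agree_zero h]
  exact or_congr_right
    ⟨P.allowed_iso _ _ h.isomorphic, P.allowed_iso _ _ h.isomorphic.symm⟩

theorem Problem.check_seg {y : ℤ → Option (In × Out)} {i : ℤ} :
    P.check (seg y (i - P.radius) (2 * P.radius + 1)) ↔
      (y i = none ∨ lineView y P.radius i ∈ P.allowed) := by
  refine check_congr_aux ⟨1, by simp, fun j hj => ?_⟩
  rw [abs_le] at hj
  rw [ofList_seg (by omega) (by push_cast; omega)]
  congr 1; ring

theorem Problem.check_reverse {l : List (Option (In × Out))} (hl : l.length = 2 * P.radius + 1)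
    (h : P.check l) : P.check l.reverse := by
  refine (check_congr_aux ⟨-1, by simp, fun j hj => ?_⟩).1 h
  rw [abs_le] at hj
  simp only [ofList]
  rw [if_pos (by omega), if_pos (by omega), List.getElem?_reverse (by omega)]
  congr 2
  omega

/-- A labeling is feasible if and only if the windows along an unrolling pass the check. -/
theorem Unrolling.feasible_iff {V : Type} {G : SimpleGraph V} {n : ℕ} {ψ : ℤ → V} {S : Set ℤ}
    (h : Unrolling G n ψ S) (hn : 2 * P.radius + 2 ≤ n) {I : V → In} {L : V → Out} :
    P.Feasible G I L ↔ ∀ i, P.check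
      (seg (unrolled ψ S fun u => (I u, L u)) (i - P.radius) (2 * P.radius + 1)) := by
  simp only [Problem.check_seg]
  constructor
  · intro hf i
    by_cases hi : i ∈ S
    · exact Or.inr (P.allowed_iso _ _ (h.isomorphic _ hn hi).symm (hf _))
    · exact Or.inl (by simpa using mt unrolled_ne_none.1 hi)
  · intro hf v
    obtain ⟨i, hi, rfl⟩ := h.surj v
    exact P.allowed_iso _ _ (h.isomorphic _ hn hi) ((hf i).resolve_left (unrolled_ne_none.2 hi))

end Check

/-! ### Online algorithms that see only disjoint segments. -/

/-- The disjoint union of bi-infinite lines indexed by `Ξ`. -/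
def linesGraph (Ξ : Type) : SimpleGraph (Ξ × ℤ) where
  Adj x y := x.1 = y.1 ∧ (y.2 = x.2 + 1 ∨ x.2 = y.2 + 1)
  symm := ⟨fun _ _ ⟨h, h'⟩ => ⟨h.symm, h'.symm⟩⟩
  loopless := ⟨fun i ⟨_, h⟩ => by omega⟩

theorem exists_near_of_mem_ballUnion {Ξ : Type} {t : ℕ} {s : List (Ξ × ℤ)} {x : Ξ × ℤ}
    (h : x ∈ ballUnion (linesGraph Ξ) t s) : ∃ y ∈ s, x.1 = y.1 ∧ |x.2 - y.2| ≤ t := by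
  induction t generalizing x with
  | zero => exact ⟨x, mem_ballUnion_zero.1 h, rfl, by simp⟩
  | succ t ih =>
    obtain h | ⟨w, hw, hadj⟩ := mem_ballUnion_succ.1 h
    · obtain ⟨y, hy, h1, h2⟩ := ih h
      exact ⟨y, hy, h1, by push_cast; omega⟩
    · obtain ⟨y, hy, h1, h2⟩ := ih hw
      refine ⟨y, hy, hadj.1.symm.trans h1, ?_⟩
      have := hadj.2
      rw [abs_le] at *
      push_cast
      omega

theorem exists_enumeration {V : Type} [Finite V] (l : List V) (hl : l.Nodup) :
    ∃ (σ : Fin (Nat.card V) ≃ V) (l' : List V), List.ofFn σ = l ++ l' := by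
  classical
  have := Fintype.ofFinite V
  let l' := (Finset.univ \ l.toFinset).toList
  have hnodup : (l ++ l').Nodup := by
    refine List.nodup_append'.2 ⟨hl, Finset.nodup_toList _, ?_⟩
    intro a ha ha'
    simp only [l', Finset.mem_toList, Finset.mem_sdiff, List.mem_toFinset] at ha'
    exact ha'.2 ha
  have hmem : ∀ v, v ∈ l ++ l' := by
    intro v
    by_cases hv : v ∈ l <;> simp [l', hv]
  let e := hnodup.getEquivOfForallMemList _ hmem
  have hcard : Nat.card V = (l ++ l').length := by
    rw [Nat.card_congr e.symm, Nat.card_eq_fintype_card, Fintype.card_fin]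
  refine ⟨(finCongr hcard).trans e, l', ?_⟩
  refine List.ext_getElem (by simpa using hcard) fun k hk hk' => ?_
  simp [e]

/-- If the adversary first presents the nodes within distance `r` from the centers of long disjoint
segments, then the answers of an online algorithm do not depend on how these segments are placed
in the graph. -/
theorem exists_online_answers {In Out : Type*} {Ξ : Type} [Finite Ξ] (A : Algorithm In Out)
    (N t r : ℕ) (lab : Ξ → ℤ → In) :
    ∃ g : Ξ → ℤ → Out, ∀ (V : Type) [Finite V] (G : SimpleGraph V) (ψ : ℤ → V) (S : Set ℤ),
      Unrolling G N ψ S → Nat.card V = N → Set.Ico 0 (N : ℤ) ⊆ S →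
      ∀ (I : V → In) (p ε : Ξ → ℤ), (∀ ξ, ε ξ = 1 ∨ ε ξ = -1) →
      (∀ ξ (a : ℤ), |a| ≤ (t + r + 1 : ℕ) → 0 ≤ p ξ + ε ξ * a ∧ p ξ + ε ξ * a < N ∧
        I (ψ (p ξ + ε ξ * a)) = lab ξ a) →
      (∀ ξ ξ', ξ ≠ ξ' → 2 * (t + r + 1 : ℕ) < |p ξ - p ξ'|) →
      ∃ σ : Fin (Nat.card V) ≃ V, ∀ ξ (a : ℤ), |a| ≤ (r : ℤ) →
        A.onlineRun t G I σ (ψ (p ξ + ε ξ * a)) = g ξ a := by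
  classical
  have := Fintype.ofFinite Ξ
  -- The order of presentation is fixed here, before the graph and the placement of the segments are
  -- known.
  let s : List (Ξ × ℤ) := (Finset.univ ×ˢ Finset.Icc (-r : ℤ) r).toList
  have hs : s.Nodup := Finset.nodup_toList _
  have hmem : ∀ x : Ξ × ℤ, x ∈ s ↔ |x.2| ≤ (r : ℤ) := fun x => by
    simp [s, abs_le]
  -- The answers are read off from an abstract run on disjoint infinite lines. Any actual placement
  -- shows the algorithm isomorphic views.
  refine ⟨fun ξ a => A.out N (ballView (linesGraph Ξ) (fun x => lab x.1 x.2) t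
    (s.take (s.idxOf (ξ, a) + 1))), ?_⟩
  intro V _ G ψ S hψ hcard hS I p ε hε hp hsep
  let pos : Ξ × ℤ → ℤ := fun x => p x.1 + ε x.1 * x.2
  have hpS : ∀ x : Ξ × ℤ, |x.2| ≤ (t + r + 1 : ℕ) → pos x ∈ Set.Ico (0 : ℤ) N := fun x hx =>
    ⟨(hp x.1 x.2 hx).1, (hp x.1 x.2 hx).2.1⟩
  have hpos : ∀ x y : Ξ × ℤ, |x.2| ≤ (t + r + 1 : ℕ) → |y.2| ≤ (t + r + 1 : ℕ) →
      pos x = pos y → x = y := by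
    rintro ⟨ξ, a⟩ ⟨ξ', b⟩ ha hb h
    simp only [pos] at ha hb h
    -- The centers are separated by more than twice `t + r + 1`: the balls reach `t + r` from the
    -- centers, and one more step is needed to compare neighbors.
    have hξ : ξ = ξ' := by
      by_contra hne
      have := hsep ξ ξ' hne
      rw [lt_abs] at this
      rw [abs_le] at ha hb
      rcases hε ξ with h1 | h1 <;> rcases hε ξ' with h2 | h2 <;> rw [h1, h2] at h <;> omega
    subst hξ
    rcases hε ξ with h1 | h1 <;> rw [h1] at h <;> rw [Prod.mk.injEq] <;> exact ⟨rfl, by omega⟩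
  have hψinj : ∀ i ∈ Set.Ico (0 : ℤ) N, ∀ j ∈ Set.Ico (0 : ℤ) N, ψ i = ψ j → i = j := by
    intro i hi j hj h
    refine hψ.inj i (hS hi) j (hS hj) ?_ h
    rw [abs_lt]
    have := hi.1; have := hi.2; have := hj.1; have := hj.2
    omega
  have hinj : ∀ x y : Ξ × ℤ, |x.2| ≤ (t + r + 1 : ℕ) → |y.2| ≤ (t + r + 1 : ℕ) →
      ψ (pos x) = ψ (pos y) → x = y := fun x y hx hy h =>
    hpos x y hx hy (hψinj _ (hpS x hx) _ (hpS y hy) h)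
  have hadj : ∀ x : Ξ × ℤ, |x.2| ≤ (t + r : ℕ) → ∀ w, G.Adj (ψ (pos x)) w ↔
      ∃ y, (linesGraph Ξ).Adj x y ∧ w = ψ (pos y) := by
    rintro ⟨ξ, a⟩ ha w
    simp only at ha
    have h1 := hpS (ξ, a) (by push_cast at *; omega)
    have h2 := hpS (ξ, a + 1) (by rw [abs_le] at *; push_cast at *; omega)
    have h3 := hpS (ξ, a - 1) (by rw [abs_le] at *; push_cast at *; omega)
    rw [hψ.adj _ (hS h1)]
    simp only [pos] at *
    constructor
    · rintro (⟨-, rfl⟩ | ⟨-, rfl⟩)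
      · rcases hε ξ with h | h
        · exact ⟨(ξ, a + 1), ⟨rfl, by simp⟩, by rw [h]; ring_nf⟩
        · exact ⟨(ξ, a - 1), ⟨rfl, by simp⟩, by rw [h]; ring_nf⟩
      · rcases hε ξ with h | h
        · exact ⟨(ξ, a - 1), ⟨rfl, by simp⟩, by rw [h]; ring_nf⟩
        · exact ⟨(ξ, a + 1), ⟨rfl, by simp⟩, by rw [h]; ring_nf⟩
    · rintro ⟨⟨ξ', b⟩, ⟨rfl, hb⟩, rfl⟩
      simp only at hb
      rcases hε ξ with h | h <;> rw [h] at h2 h3 <;> simp only [h] <;> rcases hb with rfl | hb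
      · exact Or.inl ⟨by convert hS h2 using 1; ring, by ring_nf⟩
      · obtain rfl : b = a - 1 := by omega
        exact Or.inr ⟨by convert hS h3 using 1; ring, by ring_nf⟩
      · exact Or.inr ⟨by convert hS h2 using 1; ring, by ring_nf⟩
      · obtain rfl : b = a - 1 := by omega
        exact Or.inl ⟨by convert hS h3 using 1; ring, by ring_nf⟩
  have hnodup : (s.map fun x => ψ (pos x)).Nodup := by
    refine List.Nodup.map_on (fun x hx y hy h => ?_) hs
    rw [hmem] at hx hy
    exact hinj x y (by push_cast; omega) (by push_cast; omega) h
  obtain ⟨σ, l', hσ⟩ := exists_enumeration _ hnodup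
  refine ⟨σ, fun ξ a ha => ?_⟩
  have hlt : s.idxOf (ξ, a) < s.length := List.idxOf_lt_length_iff.2 ((hmem _).2 ha)
  have hsymm : ((σ.symm (ψ (pos (ξ, a))) : Fin _) : ℕ) = s.idxOf (ξ, a) := by
    have hlen : s.idxOf (ξ, a) < (List.ofFn σ).length := by
      rw [hσ, List.length_append, List.length_map]; omega
    have h1 : (List.ofFn σ)[s.idxOf (ξ, a)] = ψ (pos (ξ, a)) := by
      simp only [hσ]
      rw [List.getElem_append_left (by simpa using hlt), List.getElem_map,
        List.getElem_idxOf hlt]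
    rw [List.getElem_ofFn] at h1
    rw [← h1]; simp
  have hrun : A.onlineRun t G I σ (ψ (pos (ξ, a))) = A.out N (ballView G I t
      ((s.take (s.idxOf (ξ, a) + 1)).map fun x => ψ (pos x))) := by
    rw [Algorithm.onlineRun, hsymm, hσ, hcard, List.take_append_of_le_length (by simpa using hlt),
      List.map_take]
  refine hrun.trans (A.out_iso _ _ _ (View.Isomorphic.symm ?_))
  have hball : ∀ t', ∀ x ∈ ballUnion (linesGraph Ξ) t' (s.take (s.idxOf (ξ, a) + 1)),
      |x.2| ≤ (t' + r : ℕ) := by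
    intro t' x hx
    obtain ⟨y, hy, -, h⟩ := exists_near_of_mem_ballUnion hx
    have := (hmem y).1 (List.mem_of_mem_take hy)
    rw [abs_le] at *
    push_cast; omega
  refine isomorphic_ballView_map ?_ ?_ ?_ ?_
  · intro x hx y hy h
    have := hball t x hx
    have := hball t y hy
    exact hinj x y (by push_cast at *; omega) (by push_cast at *; omega) h
  · intro x hx y hy
    have hx := hball t x hx
    have hy := hball t y hy
    rw [hadj x hx]
    constructor
    · rintro ⟨z, hz, h⟩
      have hz' : |z.2| ≤ (t + r + 1 : ℕ) := by
        have := hz.2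
        rw [abs_le] at *; push_cast at *; omega
      rwa [hinj y z (by push_cast at *; omega) hz' h]
    · exact fun h => ⟨y, h, rfl⟩
  · intro t' ht' x hx w hw
    have hx := hball t' x hx
    obtain ⟨y, hy, h⟩ := (hadj x (by push_cast at *; omega) w).1 hw
    exact ⟨y, hy, h.symm⟩
  · intro x hx
    have hx := hball t x hx
    exact (hp x.1 x.2 (by push_cast at *; omega)).2.2

/-! ### Arrangements of segments in one graph. -/

/-- A word that is split into a left part, a center and a right part. -/
abbrev Triple (α : Type*) := List α × List α × List α

/-- The underlying word of a triple. -/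
def Triple.word {α : Type*} (T : Triple α) : List α := T.1 ++ T.2.1 ++ T.2.2

/-- The mirror image of a triple. -/
def Triple.mirror {α : Type*} (T : Triple α) : Triple α :=
  (T.2.2.reverse, T.2.1.reverse, T.1.reverse)

/-- The triple itself or its mirror image. -/
def Triple.orient {α : Type*} (b : Bool) (T : Triple α) : Triple α := if b then T.mirror else T

section Arrangement

variable {Ξ In Out : Type*}

/-- The word contributed by an item of an arrangement: an oriented segment, then a filler. -/
def itemWord (T : Ξ → Triple In) (it : Ξ × Bool × List In) : List In :=
  ((T it.1).orient it.2.1).word ++ it.2.2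

open Classical in
/-- The position at which the segment `ξ` starts when the items are written from position `s`. -/
noncomputable def startPos (T : Ξ → Triple In) : List (Ξ × Bool × List In) → ℕ → Ξ → ℕ
  | [], s, _ => s
  | it :: its, s, ξ => if it.1 = ξ then s else startPos T its (s + (itemWord T it).length) ξ

variable {T : Ξ → Triple In} {its : List (Ξ × Bool × List In)}

theorem le_startPos (s : ℕ) (ξ : Ξ) : s ≤ startPos T its s ξ := by
  induction its generalizing s with
  | nil => exact le_rfl
  | cons it its ih =>
    rw [startPos]
    split_ifs
    · exact le_rfl
    · exact le_trans (by omega) (ih _)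

theorem exists_split_startPos (hnodup : (its.map Prod.fst).Nodup) (pre : List In)
    {it : Ξ × Bool × List In} (hit : it ∈ its) :
    ∃ u v, pre ++ its.flatMap (itemWord T) = u ++ itemWord T it ++ v ∧
      u.length = startPos T its pre.length it.1 := by
  induction its generalizing pre with
  | nil => simp at hit
  | cons hd tl ih =>
    rw [List.map_cons, List.nodup_cons] at hnodup
    rw [startPos]
    rcases List.mem_cons.1 hit with rfl | hmem
    · exact ⟨pre, tl.flatMap (itemWord T), by simp, by simp⟩
    · have hne : hd.1 ≠ it.1 := fun h => hnodup.1 (h ▸ List.mem_map_of_mem hmem)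
      obtain ⟨u, v, h, hu⟩ := ih hnodup.2 (pre ++ itemWord T hd) hmem
      refine ⟨u, v, by rw [← h]; simp, ?_⟩
      rw [if_neg hne, hu, List.length_append]

theorem startPos_separated (hnodup : (its.map Prod.fst).Nodup) (s : ℕ)
    {it it' : Ξ × Bool × List In} (hit : it ∈ its) (hit' : it' ∈ its) (hne : it.1 ≠ it'.1) :
    startPos T its s it.1 + (itemWord T it).length ≤ startPos T its s it'.1 ∨
      startPos T its s it'.1 + (itemWord T it').length ≤ startPos T its s it.1 := by
  induction its generalizing s with
  | nil => simp at hit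
  | cons hd tl ih =>
    rw [List.map_cons, List.nodup_cons] at hnodup
    simp only [startPos]
    rcases List.mem_cons.1 hit with rfl | hmem
    · left
      rw [if_pos rfl, if_neg hne]
      exact le_startPos _ _
    · have hne1 : hd.1 ≠ it.1 := fun h => hnodup.1 (h ▸ List.mem_map_of_mem hmem)
      rcases List.mem_cons.1 hit' with rfl | hmem'
      · right
        rw [if_pos rfl, if_neg hne.symm]
        exact le_startPos _ _
      · have hne2 : hd.1 ≠ it'.1 := fun h => hnodup.1 (h ▸ List.mem_map_of_mem hmem')
        rw [if_neg hne1, if_neg hne2]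
        exact ih hnodup.2 _ hmem hmem'

end Arrangement

theorem take_drop_seg {γ : Type*} {u : ℤ → γ} {s m n : ℕ} (h : s + m ≤ n) :
    ((seg u 0 n).drop s).take m = seg u s m := by
  refine List.ext_getElem (by simp; omega) fun k _ _ => ?_
  simp

/-- The letters of a segment, by their position relative to the middle of its center. -/
def Triple.letter {α : Type*} [Inhabited α] (r : ℕ) (T : Triple α) (a : ℤ) : α :=
  (T.word[(T.1.length + r + a).toNat]?).getD default

theorem Triple.length_word {α : Type*} (T : Triple α) :
    T.word.length = T.1.length + T.2.1.length + T.2.2.length := by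
  simp [Triple.word]; omega

theorem Triple.word_mirror {α : Type*} (T : Triple α) : T.mirror.word = T.word.reverse := by
  simp [Triple.word, Triple.mirror]

/-- Coordinates are relative to the middle of the center, so mirroring a segment just changes their
sign. -/
theorem Triple.orient_letter {α : Type*} [Inhabited α] {r : ℕ} {T : Triple α} {b : Bool} {a : ℤ}
    (hz : T.2.1.length = 2 * r + 1) (h1 : -(T.1.length + r : ℕ) ≤ a)
    (h2 : a ≤ (T.2.2.length + r : ℕ)) :
    (T.orient b).word[((T.orient b).1.length + r + (if b then -1 else 1) * a).toNat]? =
      some (T.letter r a) := by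
  have hlen := T.length_word
  have hsome : ∀ k : ℕ, k < T.word.length → T.word[k]? = some ((T.word[k]?).getD default) := by
    intro k hk; simp [hk]
  cases b
  · simp only [Triple.orient, Bool.false_eq_true, if_false, one_mul]
    exact hsome _ (by omega)
  · simp only [Triple.orient, if_true, Triple.word_mirror]
    rw [List.getElem?_reverse (by simp only [Triple.mirror, List.length_reverse]; omega)]
    rw [Triple.letter, ← hsome _ (by omega)]
    congr 1
    simp only [Triple.mirror, List.length_reverse]
    omega

/-- The adversary writes the segments and fillers along the graph and presents the centers first.
The labels `g` of the centers are thus fixed before the arrangement `its` is chosen, while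
feasibility of the final labeling supplies a valid word around them for each arrangement. The filler
`pre` leaves room in front of the first segment. -/
theorem exists_arranged_labeling {Ξ : Type} [Finite Ξ] {In Out : Type*} [Inhabited In]
    [Nonempty Out] (P : Problem In Out) (A : Algorithm In Out) {N t : ℕ} {G : SimpleGraph (Fin N)}
    (hA : ∀ (I : Fin N → In) (σ : Fin (Nat.card (Fin N)) ≃ Fin N),
      P.Feasible G I (A.onlineRun t G I σ)) {ψ : ℤ → Fin N} {S : Set ℤ} (hψ : Unrolling G N ψ S)
    (hS : Set.Ico 0 (N : ℤ) ⊆ S) (T : Ξ → Triple In)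
    (hT : ∀ ξ, t + 1 ≤ (T ξ).1.length ∧ (T ξ).2.1.length = 2 * P.radius + 1 ∧
      t + 1 ≤ (T ξ).2.2.length) (hN : 2 * P.radius + 2 ≤ N) :
    ∃ g : Ξ → ℤ → Out, ∀ (its : List (Ξ × Bool × List In)) (pre : List In),
      (its.map Prod.fst).Nodup → (∀ ξ, ξ ∈ its.map Prod.fst) →
      (pre ++ its.flatMap (itemWord T)).length ≤ N →
      ∃ l : List (In × Out), pre ++ its.flatMap (itemWord T) <+: l.map Prod.fst ∧
        AllWindows P.radius P.check (l.map some) ∧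
        (S = Set.Ico 0 (N : ℤ) →
          AllWindows P.radius P.check (List.replicate (2 * P.radius) none ++ l.map some)) ∧
        ∀ it ∈ its, (l.drop (startPos T its pre.length it.1 +
          ((T it.1).orient it.2.1).1.length)).take (2 * P.radius + 1) =
          if it.2.1 then
            (seg (fun a => ((T it.1).letter P.radius a, g it.1 a)) (-P.radius)
              (2 * P.radius + 1)).reverse
          else seg (fun a => ((T it.1).letter P.radius a, g it.1 a)) (-P.radius)
              (2 * P.radius + 1) := by
  classical
  obtain ⟨g, hg⟩ := exists_online_answers A N t P.radius fun ξ => (T ξ).letter P.radius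
  refine ⟨g, fun its pre hnodup hcover hlen => ?_⟩
  -- The rest of the graph is padded with default inputs.
  obtain ⟨w, hpre, hw⟩ : ∃ w : List In, pre ++ its.flatMap (itemWord T) <+: w ∧ w.length = N :=
    ⟨_, List.prefix_append _ (List.replicate (N - (pre ++ its.flatMap (itemWord T)).length)
      default), by rw [List.length_append, List.length_replicate]; omega⟩
  have hψinj : ∀ i ∈ Set.Ico (0 : ℤ) N, ∀ j ∈ Set.Ico (0 : ℤ) N, ψ i = ψ j → i = j := by
    intro i hi j hj h
    refine hψ.inj i (hS hi) j (hS hj) ?_ h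
    rw [abs_lt]
    have := hi.1; have := hi.2; have := hj.1; have := hj.2
    omega
  obtain ⟨I, hI⟩ : ∃ I : Fin N → In, ∀ k ∈ Set.Ico (0 : ℤ) N, w[k.toNat]? = some (I (ψ k)) := by
    refine ⟨fun v => (w[(Classical.epsilon fun k => k ∈ Set.Ico (0 : ℤ) N ∧
      ψ k = v).toNat]?).getD default, fun k hk => ?_⟩
    have hex : ∃ k', k' ∈ Set.Ico (0 : ℤ) N ∧ ψ k' = ψ k := ⟨k, hk, rfl⟩
    obtain ⟨h1, h2⟩ := Classical.epsilon_spec hex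
    beta_reduce
    rw [hψinj _ h1 _ hk h2]
    have : k.toNat < w.length := by have := hk.1; have := hk.2; omega
    simp [this]
  have hit : ∀ ξ, ∃ it ∈ its, it.1 = ξ := fun ξ => by
    simpa using hcover ξ
  choose it hitm hit1 using hit
  have hlenO : ∀ ξ b, t + 1 ≤ ((T ξ).orient b).1.length ∧
      ((T ξ).orient b).2.1.length = 2 * P.radius + 1 ∧
      t + 1 ≤ ((T ξ).orient b).2.2.length := by
    intro ξ b
    obtain ⟨h1, h2, h3⟩ := hT ξ
    cases b <;> simp only [Triple.orient, Triple.mirror, Bool.false_eq_true, if_false, if_true,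
      List.length_reverse] <;> exact ⟨by omega, by omega, by omega⟩
  -- The position of the middle of the center of segment `ξ`; `ε ξ` below is its direction.
  let p : Ξ → ℕ := fun ξ => startPos T its pre.length ξ +
    ((T ξ).orient (it ξ).2.1).1.length + P.radius
  let ε : Ξ → ℤ := fun ξ => if (it ξ).2.1 then -1 else 1
  have hε : ∀ ξ, ε ξ = 1 ∨ ε ξ = -1 := fun ξ => by
    simp only [ε]; split_ifs <;> simp
  have hword : ∀ ξ, ∃ u v, w = u ++ ((T ξ).orient (it ξ).2.1).word ++ v ∧
      u.length = startPos T its pre.length ξ := by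
    intro ξ
    obtain ⟨u, v, h1, h2⟩ := exists_split_startPos (T := T) hnodup pre (hitm ξ)
    obtain ⟨v', hv'⟩ := hpre
    rw [hit1] at h2
    refine ⟨u, (it ξ).2.2 ++ v ++ v', ?_, h2⟩
    rw [← hv', h1, itemWord, hit1]
    simp
  have hposN : ∀ ξ, (p ξ : ℤ) + (t + P.radius + 1 : ℕ) < N := by
    intro ξ
    obtain ⟨u, v, h1, h2⟩ := hword ξ
    obtain ⟨h3, h4, h5⟩ := hlenO ξ (it ξ).2.1
    have := congrArg List.length h1
    rw [hw, List.length_append, List.length_append, Triple.length_word, h2] at this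
    simp only [p]
    omega
  have hp0 : ∀ ξ, (t + P.radius + 1 : ℕ) ≤ (p ξ : ℤ) := by
    intro ξ
    obtain ⟨h3, h4, h5⟩ := hlenO ξ (it ξ).2.1
    simp only [p]
    omega
  have hinput : ∀ ξ (a : ℤ), |a| ≤ (t + P.radius + 1 : ℕ) → 0 ≤ p ξ + ε ξ * a ∧
      p ξ + ε ξ * a < N ∧ I (ψ (p ξ + ε ξ * a)) = (T ξ).letter P.radius a := by
    intro ξ a ha
    have h1 := hposN ξ
    have h2 := hp0 ξ
    rw [abs_le] at ha
    have hb : 0 ≤ p ξ + ε ξ * a ∧ p ξ + ε ξ * a < N := by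
      rcases hε ξ with h | h <;> rw [h] <;> constructor <;> omega
    refine ⟨hb.1, hb.2, ?_⟩
    have h3 := hI _ ⟨hb.1, hb.2⟩
    obtain ⟨u, v, hw', hu⟩ := hword ξ
    obtain ⟨hT1, hT2, hT3⟩ := hT ξ
    have h4 := Triple.orient_letter (b := (it ξ).2.1) (a := a) hT2
      (by push_cast at *; omega) (by push_cast at *; omega)
    have hk : (((T ξ).orient (it ξ).2.1).1.length + P.radius +
        (if (it ξ).2.1 then -1 else 1) * a : ℤ).toNat + u.length = (p ξ + ε ξ * a).toNat := by
      obtain ⟨h5, h6, h7⟩ := hlenO ξ (it ξ).2.1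
      have h8 : ((p ξ : ℕ) : ℤ) = u.length + ((T ξ).orient (it ξ).2.1).1.length + P.radius := by
        simp only [p, hu]; push_cast; ring
      have h9 : (if (it ξ).2.1 then -1 else 1 : ℤ) = ε ξ := rfl
      rw [h9, h8]
      rcases hε ξ with h | h <;> rw [h] <;> omega
    obtain ⟨hlt, -⟩ := List.getElem?_eq_some_iff.1 h4
    rw [hw', List.append_assoc, List.getElem?_append_right (by omega), ← hk,
      Nat.add_sub_cancel, List.getElem?_append_left hlt, h4] at h3
    exact (Option.some.inj h3).symm
  have hsep : ∀ ξ ξ', ξ ≠ ξ' → 2 * (t + P.radius + 1 : ℕ) < |(p ξ : ℤ) - p ξ'| := by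
    intro ξ ξ' hne
    have h1 := startPos_separated (T := T) hnodup pre.length (hitm ξ) (hitm ξ')
      (by simpa [hit1] using hne)
    obtain ⟨h2, h3, h4⟩ := hlenO ξ (it ξ).2.1
    obtain ⟨h5, h6, h7⟩ := hlenO ξ' (it ξ').2.1
    simp only [hit1, itemWord, List.length_append, Triple.length_word] at h1
    rw [lt_abs]
    simp only [p]
    push_cast
    omega
  obtain ⟨σ, hσ⟩ := hg (Fin N) G ψ S hψ (Nat.card_fin N) hS I (fun ξ => p ξ) ε hε hinput hsep
  have hfeas := (hψ.feasible_iff hN).1 (hA I σ)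
  obtain ⟨L, hL⟩ : ∃ L, L = A.onlineRun t G I σ := ⟨_, rfl⟩
  rw [← hL] at hfeas
  simp only [← hL] at hσ
  have hsome : (seg (fun k => (I (ψ k), L (ψ k))) 0 N).map some =
      seg (unrolled ψ S fun u => (I u, L u)) 0 N := by
    rw [map_seg]
    exact seg_congr fun i h0 h1 => 
      (unrolled_of_mem (lab := fun u => (I u, L u)) (hS ⟨h0, by omega⟩)).symm
  refine ⟨seg (fun k => (I (ψ k), L (ψ k))) 0 N, ?_, ?_, ?_, ?_⟩
  · rw [map_seg]
    convert hpre using 1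
    refine List.ext_getElem (by simp [hw]) fun k hk _ => ?_
    have hk : k < N := by simpa using hk
    have := hI k ⟨by simp, by exact_mod_cast hk⟩
    rw [Int.toNat_natCast] at this
    obtain ⟨_, h⟩ := List.getElem?_eq_some_iff.1 this
    rw [h]; simp
  · rw [hsome]
    exact allWindows_seg.2 fun i _ _ => hfeas i
  · intro hSN
    -- On a path nothing precedes position `0`, so the windows there see `none`.
    have hnone : List.replicate (2 * P.radius) none =
        seg (unrolled ψ S fun u => (I u, L u)) (-(2 * P.radius : ℕ)) (2 * P.radius) := by
      refine List.ext_getElem (by simp) fun k hk _ => ?_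
      have hk : k < 2 * P.radius := by simpa using hk
      have : unrolled ψ S (fun u => (I u, L u)) (-(2 * P.radius : ℕ) + k) = none := by
        by_contra hne
        have := unrolled_ne_none.1 hne
        rw [hSN] at this
        have := this.1
        push_cast at this
        omega
      simp only [getElem_seg, this, List.getElem_replicate]
    have h0 := seg_add (u := unrolled ψ S fun u => (I u, L u)) (a := -(2 * P.radius : ℕ))
      (m := 2 * P.radius) (n := N)
    rw [neg_add_cancel] at h0
    rw [hsome, hnone, ← h0]
    exact allWindows_seg.2 fun i _ _ => hfeas i
  · intro it' hit'
    obtain ⟨ξ, hξ⟩ : ∃ ξ, ξ = it'.1 := ⟨_, rfl⟩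
    have hii : it' = it ξ := by
      refine List.inj_on_of_nodup_map hnodup hit' (hitm ξ) ?_
      rw [hit1, hξ]
    have hb : it'.2.1 = (it ξ).2.1 := by rw [← hii]
    rw [← hξ, hb]
    have h1 := hposN ξ
    have h2 := hp0 ξ
    have h3 : (p ξ : ℤ) - P.radius = (startPos T its pre.length ξ +
      ((T ξ).orient (it ξ).2.1).1.length : ℕ) := by
      simp only [p]; push_cast; ring
    rw [take_drop_seg (by push_cast at *; omega), ← h3]
    have h4 : seg (fun a => ((T ξ).letter P.radius a, g ξ a)) (-P.radius) (2 * P.radius + 1) =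
        seg (fun a => (I (ψ (p ξ + ε ξ * a)), L (ψ (p ξ + ε ξ * a)))) (-P.radius)
          (2 * P.radius + 1) := by
      refine seg_congr fun a ha1 ha2 => ?_
      have ha : |a| ≤ (P.radius : ℤ) := by rw [abs_le]; push_cast at *; omega
      rw [hσ ξ a ha, (hinput ξ a (by push_cast; omega)).2.2]
    rw [h4]
    cases hbb : (it ξ).2.1
    · have hε1 : ε ξ = 1 := by simp [ε, hbb]
      simp only [hε1, one_mul, Bool.false_eq_true, if_false]
      rw [seg_translate (u := fun k => (I (ψ k), L (ψ k)))]
      congr 1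
    · have hε1 : ε ξ = -1 := by simp [ε, hbb]
      simp only [if_true]
      rw [seg_reflect (u := fun k => (I (ψ k), L (ψ k))) hε1, List.reverse_reverse]
      congr 1
      push_cast; ring

theorem Triple.seg_letter {α : Type*} [Inhabited α] {r : ℕ} {T : Triple α}
    (hz : T.2.1.length = 2 * r + 1) : seg (T.letter r) (-r) (2 * r + 1) = T.2.1 := by
  refine List.ext_getElem (by simp [hz]) fun k h1 h2 => ?_
  rw [length_seg] at h1
  rw [getElem_seg, Triple.letter, Triple.word, show (T.1.length + r + (-r + k) : ℤ).toNat =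
    T.1.length + k by omega, List.append_assoc, List.getElem?_append_right (by omega),
    Nat.add_sub_cancel_left, List.getElem?_append_left h2]
  simp [h2]

/-! ### Extraction of a cut rule from an online algorithm. -/

section Fill

variable {In Out : Type*} {r : ℕ} {W : List (Option (In × Out)) → Prop}

theorem fillable_of_allWindows {l z z' : List (In × Out)} {i j n : ℕ}
    (h : AllWindows r W (l.map some)) (hz : (l.drop i).take n = z) (hz' : (l.drop j).take n = z')
    (hij : i + n ≤ j) :
    Fillable r W (z.map some) (((l.map Prod.fst).drop (i + n)).take (j - (i + n)))
      (z'.map some) := by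
  refine ⟨(l.drop (i + n)).take (j - (i + n)), by simp [List.map_take, List.map_drop], ?_⟩
  rw [← List.map_append, ← List.map_append]
  refine h.infix (List.IsInfix.map _ ?_)
  have : (l.drop i).take (n + (j - (i + n)) + n) =
      z ++ (l.drop (i + n)).take (j - (i + n)) ++ z' := by
    rw [List.take_add, List.take_add, hz, List.drop_drop, List.drop_drop, ← hz']
    congr 3
    omega
  rw [← this]
  exact (List.take_prefix _ _).isInfix.trans (List.drop_suffix _ _).isInfix

theorem fillable_of_allWindows_none {l z : List (In × Out)} {j n : ℕ}
    {a : List (Option (In × Out))} (h : AllWindows r W (a ++ l.map some))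
    (hz : (l.drop j).take n = z) :
    Fillable r W a ((l.map Prod.fst).take j) (z.map some) := by
  refine ⟨l.take j, by simp [List.map_take], ?_⟩
  rw [List.append_assoc, ← List.map_append, ← hz, ← List.take_add]
  refine h.infix ?_
  obtain ⟨v, hv⟩ := List.IsPrefix.map some (List.take_prefix (j + n) l)
  exact ⟨[], v, by rw [List.nil_append, List.append_assoc, hv]⟩

theorem WordEquiv.reverse (hW : ∀ w, w.length = 2 * r + 1 → W w → W w.reverse) {w w' : List In}
    (h : WordEquiv r W w w') : WordEquiv r W w.reverse w'.reverse := by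
  have key : ∀ {u u' : List In}, WordEquiv r W u u' → ∀ a b,
      Fillable r W a u.reverse b → Fillable r W a u'.reverse b := by
    intro u u' h a b hf
    have := (h _ _).1 (by simpa using hf.reverse hW)
    simpa using this.reverse hW
  exact fun a b => ⟨key h a b, key (fun a b => (h a b).symm) a b⟩

theorem Fillable.congr_words {a b : List (Option (In × Out))} {u u' v v' m : List In}
    (hu : WordEquiv r W u u') (hv : WordEquiv r W v v') (h : Fillable r W a (u' ++ m ++ v') b) :
    Fillable r W a (u ++ m ++ v) b := by
  rw [List.append_assoc, (hu.append_right (m ++ v)) a b, ← List.append_assoc,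
    (hv.append_left (u' ++ m)) a b]
  exact h

end Fill

/-- A rule for labeling short windows so that any two labeled windows, in any orientation, can be
joined by labeling the nodes between them. A member of `D` consists of the inputs to the left of
the window, the window itself and the inputs to its right. -/
structure IsCutRule {In Out : Type*} (r : ℕ) (W : List (Option (In × Out)) → Prop) (h B : ℕ)
    (ends : Prop) (D : Set (List In × List (In × Out) × List In)) : Prop where
  lengths : ∀ d ∈ D, d.1.length = h ∧ d.2.1.length = 2 * r + 1 ∧ d.2.2.length = h
  mirror : ∀ d ∈ D, (d.2.2.reverse, d.2.1.reverse, d.1.reverse) ∈ D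
  total : ∀ a z b : List In, a.length = h → z.length = 2 * r + 1 → b.length = h →
    ∃ z' : List (In × Out), z'.map Prod.fst = z ∧ (a, z', b) ∈ D
  fill : ∀ d ∈ D, ∀ d' ∈ D, ∀ m : List In, m.length ≤ B →
    Fillable r W (d.2.1.map some) (d.2.2 ++ m ++ d'.1) (d'.2.1.map some)
  fill_end : ends → ∀ d ∈ D, ∀ m : List In, m.length ≤ B →
    Fillable r W (d.2.1.map some) (d.2.2 ++ m) (List.replicate (2 * r) none)

/-- The order of the quantifiers matters: `h` depends only on the problem, the bound `B` on the gaps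
may be chosen in terms of `h`, and after that a single sufficiently large `N` provides the rule. -/
theorem exists_isCutRule {In Out : Type*} [Finite In] [Finite Out] [Inhabited In] [Nonempty Out]
    (P : Problem In Out) : ∃ h, 1 ≤ h ∧ ∀ B, ∃ C, ∀ (A : Algorithm In Out) (N t : ℕ)
      (G : SimpleGraph (Fin N)), C * (t + 1) ≤ N →
      (∀ (I : Fin N → In) (σ : Fin (Nat.card (Fin N)) ≃ Fin N),
        P.Feasible G I (A.onlineRun t G I σ)) → ∀ (ψ : ℤ → Fin N) (S : Set ℤ),
      Unrolling G N ψ S → Set.Ico 0 (N : ℤ) ⊆ S →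
      ∃ D, IsCutRule P.radius P.check h B (S = Set.Ico 0 (N : ℤ)) D := by
  classical
  obtain ⟨h, hh, hpump⟩ := exists_pumping P.radius P.check
  have hrev : ∀ w : List (Option (In × Out)), w.length = 2 * P.radius + 1 →
      P.check w → P.check w.reverse := fun w hw => Problem.check_reverse hw
  refine ⟨h, hh, fun B => ?_⟩
  obtain ⟨r, hr⟩ : ∃ r, P.radius = r := ⟨_, rfl⟩
  rw [hr] at hpump hrev ⊢
  let Q := {w : List In // w.length = h} × {w : List In // w.length = 2 * r + 1} ×
    {w : List In // w.length = h}
  have hfin : ∀ n, Finite {w : List In // w.length = n} := fun n => List.finite_length_eq _ _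
  have hfin' : ∀ n, Finite {w : List Out // w.length = n} := fun n => List.finite_length_eq _ _
  have := Fintype.ofFinite {w : List Out // w.length = 2 * r + 1}
  -- One copy more than there are labelings of a window.
  obtain ⟨J, hJ⟩ : ∃ J, J = Fintype.card {w : List Out // w.length = 2 * r + 1} + 1 := ⟨_, rfl⟩
  obtain ⟨M, hM⟩ : ∃ M, M = Nat.card (Q × Fin J) := ⟨_, rfl⟩
  have e : Q × Fin J ≃ Fin M := hM ▸ Finite.equivFin _
  -- Each of the `M` items has length at most `(4 * h + 2 * r + 1) * (t + 1) + B`, a prefix costs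
  -- another `B`, and `2 * r + 2` nodes are needed for verification on an unrolling.
  refine ⟨M * (4 * h + 2 * r + 1 + B) + B + (2 * r + 2), fun A N t G hN hA ψ S hψ hS => ?_⟩
  -- the pumped segments
  have hpump' : ∀ w : {w : List In // w.length = h}, ∃ w' : List In,
      WordEquiv r P.check w w' ∧ t + 1 ≤ w'.length ∧ w'.length ≤ (t + 1 + 1) * h :=
    fun w => hpump w.1 w.2 (t + 1)
  choose pump hpE hpl hpu using hpump'
  -- The pumped sides have length at least `t + 1`, so the algorithm cannot see past them when it
  -- labels the center.
  let T' : Q → Triple In := fun q => (pump q.1, q.2.1.1, pump q.2.2)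
  let T : Fin M → Triple In := fun ξ => T' (e.symm ξ).1
  have hT' : ∀ q, t + 1 ≤ (T' q).1.length ∧ (T' q).2.1.length = 2 * r + 1 ∧
      t + 1 ≤ (T' q).2.2.length := fun q => ⟨hpl _, q.2.1.2, hpl _⟩
  have hN2 : 2 * r + 2 ≤ N := by
    refine le_trans ?_ hN
    nlinarith [Nat.zero_le (M * (4 * h + 2 * r + 1 + B) + B),
      Nat.zero_le ((M * (4 * h + 2 * r + 1 + B) + B + (2 * r + 2)) * t)]
  obtain ⟨g, hg⟩ := exists_arranged_labeling P A hA hψ hS T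
    (by rw [hr]; exact fun ξ => hT' _) (by rw [hr]; exact hN2)
  rw [hr] at hg
  -- two copies of each segment that get the same labels
  have hpigeon : ∀ q : Q, ∃ j j' : Fin J, j ≠ j' ∧
      seg (g (e (q, j))) (-r) (2 * r + 1) = seg (g (e (q, j'))) (-r) (2 * r + 1) := by
    intro q
    obtain ⟨j, j', hne, he⟩ := Fintype.exists_ne_map_eq_of_card_lt
      (fun j : Fin J => (⟨seg (g (e (q, j))) (-r) (2 * r + 1), length_seg⟩ :
        {w : List Out // w.length = 2 * r + 1})) (by simp [hJ])
    exact ⟨j, j', hne, congrArg Subtype.val he⟩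
  choose j₁ j₂ hj hjg using hpigeon
  let Z : Q → List (In × Out) := fun q =>
    seg (fun a => ((T' q).letter r a, g (e (q, j₁ q)) a)) (-r) (2 * r + 1)
  have hZ : ∀ ξ q, (ξ = e (q, j₁ q) ∨ ξ = e (q, j₂ q)) →
      seg (fun a => ((T ξ).letter r a, g ξ a)) (-r) (2 * r + 1) = Z q := by
    rintro ξ q (rfl | rfl)
    · simp [T, Z]
    · refine List.ext_getElem (by simp [Z]) fun k hk _ => ?_
      have := congrArg (fun l => l[k]?) (hjg q)
      rw [length_seg] at hk
      simp only [getElem?_seg hk, Option.some.injEq] at this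
      simp [T, Z, this]
  have hsegLen : ∀ q b, ((T' q).orient b).word.length ≤ (4 * h + 2 * r + 1) * (t + 1) := by
    intro q b
    have h1 : ((T' q).orient b).word.length = (T' q).word.length := by
      cases b <;> simp [Triple.orient, Triple.word_mirror]
    rw [h1, Triple.length_word, (hT' q).2.1]
    have h2 := hpu q.1
    have h3 := hpu q.2.2
    simp only [T']
    nlinarith [Nat.zero_le (h * t), Nat.zero_le (r * t)]
  -- arrangements with a prescribed first item
  have hlen : ∀ (pre : List In) (its : List (Fin M × Bool × List In)), (its.map Prod.fst).Nodup →
      pre.length ≤ B → (∀ it ∈ its, it.2.2.length ≤ B) →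
      (pre ++ its.flatMap (itemWord T)).length ≤ N := by
    intro pre its hnodup hpre hits
    have h1 : its.length ≤ M := by
      have := hnodup.length_le_card
      simpa using this
    have h2 : (its.flatMap (itemWord T)).length ≤
        its.length * ((4 * h + 2 * r + 1) * (t + 1) + B) := by
      rw [List.length_flatMap]
      have := List.sum_le_card_nsmul (its.map fun a => (itemWord T a).length)
        ((4 * h + 2 * r + 1) * (t + 1) + B) (by
          intro n hn
          obtain ⟨it, hit, rfl⟩ := List.mem_map.1 hn
          rw [itemWord, List.length_append]
          exact Nat.add_le_add (hsegLen _ _) (hits it hit))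
      simpa using this
    rw [List.length_append]
    calc pre.length + (its.flatMap (itemWord T)).length
        ≤ B + M * ((4 * h + 2 * r + 1) * (t + 1) + B) :=
          Nat.add_le_add hpre (h2.trans (Nat.mul_le_mul_right _ h1))
      _ ≤ (M * (4 * h + 2 * r + 1 + B) + B + (2 * r + 2)) * (t + 1) := by
          have h3 : M * ((4 * h + 2 * r + 1) * (t + 1) + B) ≤
              M * ((4 * h + 2 * r + 1 + B) * (t + 1)) :=
            Nat.mul_le_mul_left _ (by nlinarith [Nat.zero_le (B * t)])
          nlinarith [Nat.zero_le (B * t), Nat.zero_le (r * t)]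
      _ ≤ N := hN
  -- All segments must occur, since all of them are presented. Those not used in an arrangement are
  -- put behind the others.
  have hcomplete : ∀ its : List (Fin M × Bool × List In), (its.map Prod.fst).Nodup →
      ∃ its' : List (Fin M × Bool × List In), ((its ++ its').map Prod.fst).Nodup ∧
        (∀ ξ, ξ ∈ (its ++ its').map Prod.fst) ∧ ∀ it ∈ its', it.2.2 = [] := by
    intro its hnodup
    refine ⟨((Finset.univ \ (its.map Prod.fst).toFinset).toList).map fun ξ => (ξ, false, []),
      ?_, ?_, by simp⟩
    · rw [List.map_append, List.map_map]
      refine List.nodup_append'.2 ⟨hnodup, ?_, ?_⟩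
      · have : (Prod.fst ∘ fun ξ : Fin M => (ξ, false, ([] : List In))) = id := rfl
        rw [this, List.map_id]
        exact Finset.nodup_toList _
      · intro a ha ha'
        simp only [List.mem_map, Finset.mem_toList, Finset.mem_sdiff, List.mem_toFinset,
          Function.comp] at ha'
        obtain ⟨b, hb, rfl⟩ := ha'
        exact hb.2 (by simpa using ha)
    · intro ξ
      by_cases hξ : ξ ∈ its.map Prod.fst
      · rw [List.map_append]; exact List.mem_append_left _ hξ
      · rw [List.map_append]
        refine List.mem_append_right _ ?_
        simpa using hξ
  have hOl : ∀ ξ b, ((T ξ).orient b).2.1.length = 2 * r + 1 := by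
    intro ξ b
    cases b <;> simp [Triple.orient, Triple.mirror, T, (hT' _).2.1]
  -- The rule pairs the original short sides with the label of the pumped segment, closed under
  -- mirror images.
  let D : Set (List In × List (In × Out) × List In) := {d | ∃ q : Q,
    d = (q.1.1, Z q, q.2.2.1) ∨ d = (q.2.2.1.reverse, (Z q).reverse, q.1.1.reverse)}
  have hD : ∀ d ∈ D, ∃ (q : Q) (b : Bool), WordEquiv r P.check d.1 ((T' q).orient b).1 ∧
      WordEquiv r P.check d.2.2 ((T' q).orient b).2.2 ∧
      d.2.1 = if b then (Z q).reverse else Z q := by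
    rintro d ⟨q, rfl | rfl⟩
    · exact ⟨q, false, hpE _, hpE _, rfl⟩
    · exact ⟨q, true, (hpE _).reverse hrev, (hpE _).reverse hrev, rfl⟩
  have hfill : ∀ d ∈ D, ∀ d' ∈ D, ∀ m : List In, m.length ≤ B →
      Fillable r P.check (d.2.1.map some) (d.2.2 ++ m ++ d'.1) (d'.2.1.map some) := by
    intro d hd d' hd' m hm
    obtain ⟨q, b, -, hE, hz⟩ := hD d hd
    obtain ⟨q', b', hE', -, hz'⟩ := hD d' hd'
    refine Fillable.congr_words hE hE' ?_
    -- Using one copy for each role makes the two segments distinct even if `q = q'`.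
    have hne : e (q, j₁ q) ≠ e (q', j₂ q') := by
      intro heq
      have := e.injective heq
      rw [Prod.mk.injEq] at this
      obtain ⟨rfl, h2⟩ := this
      exact hj _ h2
    obtain ⟨its', hnodup, hcover, hempty⟩ := hcomplete
      [(e (q, j₁ q), b, m), (e (q', j₂ q'), b', [])] (by simpa using hne)
    obtain ⟨l, hl, hwin, -, hlab⟩ := hg _ [] hnodup hcover (hlen _ _ hnodup (by simp) (by
      intro it hit
      simp only [List.cons_append, List.nil_append, List.mem_cons] at hit
      rcases hit with rfl | rfl | hit
      · exact hm
      · simp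
      · rw [hempty it hit]; simp))
    have h1 := hlab (e (q, j₁ q), b, m) (by simp)
    have h2 := hlab (e (q', j₂ q'), b', []) (by simp)
    simp only [hZ _ q (Or.inl rfl), ← hz] at h1
    simp only [hZ _ q' (Or.inr rfl), ← hz'] at h2
    simp only [List.cons_append, List.nil_append, startPos, if_true, List.length_nil, zero_add,
      if_neg hne] at h1 h2
    have hT1 : T (e (q, j₁ q)) = T' q := by simp [T]
    have hT2 : T (e (q', j₂ q')) = T' q' := by simp [T]
    have hO := hOl (e (q, j₁ q)) b
    simp only [hT1, hT2, itemWord, Triple.word, List.cons_append, List.nil_append,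
      List.flatMap_cons, List.append_nil] at hl h1 h2 hO
    have h3 := fillable_of_allWindows hwin h1 h2 (by simp only [List.length_append, hO]; omega)
    obtain ⟨v, hv⟩ := hl
    have hv' : l.map Prod.fst = (((T' q).orient b).1 ++ ((T' q).orient b).2.1) ++
        ((((T' q).orient b).2.2 ++ m ++ ((T' q').orient b').1) ++ (((T' q').orient b').2.1 ++
          ((T' q').orient b').2.2 ++ its'.flatMap (itemWord T) ++ v)) := by
      rw [← hv]; simp
    rw [hv', List.drop_left' (by simp [hO]), List.take_left' (by
      simp only [List.length_append, hO]; omega)] at h3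
    exact h3
  have hbegin : S = Set.Ico 0 (N : ℤ) → ∀ d ∈ D, ∀ m : List In, m.length ≤ B →
      Fillable r P.check (List.replicate (2 * r) none) (m ++ d.1) (d.2.1.map some) := by
    intro hSN d hd m hm
    obtain ⟨q, b, hE, -, hz⟩ := hD d hd
    rw [(hE.append_left m) _ _]
    obtain ⟨its', hnodup, hcover, hempty⟩ := hcomplete [(e (q, j₁ q), b, [])] (by simp)
    obtain ⟨l, hl, -, hwin, hlab⟩ := hg _ m hnodup hcover (hlen _ _ hnodup hm (by
      intro it hit
      simp only [List.cons_append, List.nil_append, List.mem_cons] at hit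
      rcases hit with rfl | hit
      · simp
      · rw [hempty it hit]; simp))
    have h1 := hlab (e (q, j₁ q), b, []) (by simp)
    simp only [hZ _ q (Or.inl rfl), ← hz] at h1
    simp only [List.cons_append, List.nil_append, startPos, if_true] at h1
    have hT1 : T (e (q, j₁ q)) = T' q := by simp [T]
    simp only [hT1, itemWord, Triple.word, List.cons_append, List.nil_append,
      List.flatMap_cons, List.append_nil] at hl h1
    have h3 := fillable_of_allWindows_none (hwin hSN) h1
    obtain ⟨v, hv⟩ := hl
    have hv' : l.map Prod.fst = (m ++ ((T' q).orient b).1) ++ (((T' q).orient b).2.1 ++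
          ((T' q).orient b).2.2 ++ its'.flatMap (itemWord T) ++ v) := by
      rw [← hv]; simp
    rw [hv', List.take_left' (by simp)] at h3
    exact h3
  have hmirror : ∀ d ∈ D, (d.2.2.reverse, d.2.1.reverse, d.1.reverse) ∈ D := by
    rintro d ⟨q, rfl | rfl⟩
    · exact ⟨q, Or.inr rfl⟩
    · exact ⟨q, Or.inl (by simp)⟩
  refine ⟨D, ?_, hmirror, ?_, hfill, ?_⟩
  · rintro d ⟨q, rfl | rfl⟩
    · exact ⟨q.1.2, by simp [Z], q.2.2.2⟩
    · exact ⟨by simp [q.2.2.2], by simp [Z], by simp [q.1.2]⟩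
  · intro a z b ha hz hb
    refine ⟨Z (⟨a, ha⟩, ⟨z, hz⟩, ⟨b, hb⟩), ?_, (⟨a, ha⟩, ⟨z, hz⟩, ⟨b, hb⟩), Or.inl rfl⟩
    simp only [Z, map_seg]
    exact Triple.seg_letter (T := T' (⟨a, ha⟩, ⟨z, hz⟩, ⟨b, hb⟩)) hz
  -- Arrangements were only made at the left end of a path; the right end follows by mirroring.
  · intro hSN d hd m hm
    have := (hbegin hSN _ (hmirror d hd) m.reverse (by simpa using hm)).reverse hrev
    simpa using this

/-! ### Small numbers that do not divide a given number. -/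

theorem two_pow_le_centralBinom (n : ℕ) : 2 ^ n ≤ n.centralBinom := by
  induction n with
  | zero => simp
  | succ n ih =>
    have h := Nat.succ_mul_centralBinom_succ n
    have : (n + 1) * 2 ^ (n + 1) ≤ (n + 1) * (n + 1).centralBinom := by
      rw [h, pow_succ]; nlinarith
    exact Nat.le_of_mul_le_mul_left this (by omega)

/-- Every prime power in the factorization of the central binomial coefficient is at most `2 * n`.
Together with `two_pow_le_centralBinom` this shows that a nonzero number below `2 ^ n` has a
non-divisor of size at most `2 * n`. -/
theorem centralBinom_dvd {n X : ℕ} (hn : 0 < n) (hX : X ≠ 0)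
    (h : ∀ d, 0 < d → d ≤ 2 * n → d ∣ X) : n.centralBinom ∣ X := by
  rw [← Nat.factorization_prime_le_iff_dvd n.centralBinom_ne_zero hX]
  intro p hp
  rw [← hp.pow_dvd_iff_le_factorization hX]
  exact h _ (pow_pos hp.pos _) (Nat.pow_factorization_choose_le (by omega))

theorem exists_not_dvd {n X : ℕ} (hX : X ≠ 0) (hlt : X < 2 ^ n) :
    ∃ d, 0 < d ∧ d ≤ 2 * n ∧ ¬ d ∣ X := by
  by_contra! h
  have hn : 0 < n := by
    rcases Nat.eq_zero_or_pos n with rfl | hn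
    · simp at hlt; exact absurd hlt hX
    · exact hn
  have := Nat.le_of_dvd (Nat.pos_of_ne_zero hX) (centralBinom_dvd hn hX h)
  have := two_pow_le_centralBinom n
  omega

/-- The least positive number that does not divide `X`. -/
noncomputable def leastNonDvd (X : ℕ) : ℕ := sInf {d | 0 < d ∧ ¬ d ∣ X}

theorem leastNonDvd_spec {X : ℕ} (hX : X ≠ 0) : 0 < leastNonDvd X ∧ ¬ leastNonDvd X ∣ X := by
  have : {d | 0 < d ∧ ¬ d ∣ X}.Nonempty :=
    ⟨X + 1, by omega, fun h => by have := Nat.le_of_dvd (Nat.pos_of_ne_zero hX) h; omega⟩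
  exact Nat.sInf_mem this

theorem leastNonDvd_le {n X : ℕ} (hX : X ≠ 0) (hlt : X < 2 ^ n) : leastNonDvd X ≤ 2 * n := by
  obtain ⟨d, h1, h2, h3⟩ := exists_not_dvd hX hlt
  exact (Nat.sInf_le (show d ∈ {d | 0 < d ∧ ¬ d ∣ X} from ⟨h1, h3⟩)).trans h2

/-! ### Local functions on sequences. -/

/-- A function of sequences and positions that only depends on the sequence within distance `t` of
the position, and neither on the position nor on the orientation of the sequence. -/
def Loc {β γ : Type*} (t : ℕ) (F : (ℤ → β) → ℤ → γ) : Prop :=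
  ∀ x i x' i', Agree t x i x' i' → F x i = F x' i'

section Loc

variable {α β γ δ : Type*} {s t : ℕ}

theorem Agree.mono {x x' : ℤ → β} {i i' : ℤ} (h : Agree t x i x' i') (hst : s ≤ t) :
    Agree s x i x' i' := by
  obtain ⟨ε, hε, h⟩ := h
  exact ⟨ε, hε, fun j hj => h j (hj.trans (by exact_mod_cast hst))⟩

theorem Loc.mono {F : (ℤ → β) → ℤ → γ} (h : Loc s F) (hst : s ≤ t) : Loc t F :=
  fun _ _ _ _ ha => h _ _ _ _ (ha.mono hst)

/-- A local function at positions that correspond to each other. -/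
theorem Loc.apply_eq {F : (ℤ → β) → ℤ → γ} (hF : Loc s F) {x x' : ℤ → β} {i i' ε : ℤ}
    (hε : ε = 1 ∨ ε = -1) (h : ∀ j : ℤ, |j| ≤ (s + t : ℕ) → x (i + j) = x' (i' + ε * j)) {j : ℤ}
    (hj : |j| ≤ t) : F x (i + j) = F x' (i' + ε * j) := by
  refine hF _ _ _ _ ⟨ε, hε, fun k hk => ?_⟩
  rw [add_assoc, h (j + k) ((abs_add_le j k).trans (by push_cast; omega))]
  congr 1; ring

theorem Agree.map_loc {F : (ℤ → β) → ℤ → γ} (hF : Loc s F) {x x' : ℤ → β} {i i' : ℤ}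
    (h : Agree (s + t) x i x' i') : Agree t (F x) i (F x') i' := by
  obtain ⟨ε, hε, h⟩ := h
  exact ⟨ε, hε, fun j hj => hF.apply_eq hε h hj⟩

theorem Loc.comp {F : (ℤ → β) → ℤ → γ} {H : (ℤ → γ) → ℤ → δ} (hF : Loc s F) (hH : Loc t H) :
    Loc (s + t) fun x => H (F x) :=
  fun _ _ _ _ h => hH _ _ _ _ (h.map_loc hF)

theorem Loc.map₂ {F : (ℤ → β) → ℤ → γ} {H : (ℤ → β) → ℤ → δ} (hF : Loc t F) (hH : Loc t H)
    (f : γ → δ → α) : Loc t fun x i => f (F x i) (H x i) :=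
  fun x i x' i' h => by beta_reduce; rw [hF x i x' i' h, hH x i x' i' h]

theorem Loc.map {F : (ℤ → β) → ℤ → γ} (hF : Loc t F) (f : γ → α) : Loc t fun x i => f (F x i) :=
  fun x i x' i' h => by beta_reduce; rw [hF x i x' i' h]

theorem loc_id : Loc t fun (x : ℤ → β) i => x i := fun _ _ _ _ h => agree_zero h

end Loc

/-! ### Color reduction. -/

/-- The contribution of a color to the product that guides the recoloring of a node of color `c`. -/
def colorDiff (c : ℕ) (o : Option ℕ) : ℕ :=
  o.elim 1 fun c' => if c' = c then 1 else (c - c') + (c' - c)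

/-- Missing and equal colors contribute `1`. This matters because the product runs over the position
itself as well. -/
theorem colorDiff_ne_zero (c : ℕ) (o : Option ℕ) : colorDiff c o ≠ 0 := by
  cases o with
  | none => simp [colorDiff]
  | some c' =>
    simp only [colorDiff, Option.elim_some]
    split_ifs <;> omega

/-- The product of the differences between the color `c` and the colors near position `i`. -/
noncomputable def colorProd (K : ℕ) (u : ℤ → Option ℕ) (i : ℤ) (c : ℕ) : ℕ :=
  ∏ j ∈ Finset.Icc (-K : ℤ) K, colorDiff c (u (i + j))

theorem colorProd_ne_zero (K : ℕ) (u : ℤ → Option ℕ) (i : ℤ) (c : ℕ) : colorProd K u i c ≠ 0 :=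
  Finset.prod_ne_zero_iff.2 fun _ _ => colorDiff_ne_zero _ _

/-- One round of color reduction. -/
noncomputable def recolor (K : ℕ) (u : ℤ → Option ℕ) (i : ℤ) : Option ℕ :=
  (u i).map fun c => Nat.pair (leastNonDvd (colorProd K u i c))
    (c % leastNonDvd (colorProd K u i c))

/-- Positions within distance `K` of each other have different colors. -/
def ProperColoring (K : ℕ) (u : ℤ → Option ℕ) : Prop :=
  ∀ i j : ℤ, i ≠ j → |j - i| ≤ K → u i ≠ none → u i ≠ u j

/-- All colors are less than `m`. -/
def ColorsLT (m : ℕ) (u : ℤ → Option ℕ) : Prop := ∀ i, ∀ c ∈ u i, c < m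

theorem loc_recolor (K : ℕ) : Loc K (recolor K) := by
  rintro u i u' i' ⟨ε, hε, h⟩
  have h0 : u i = u' i' := by simpa using h 0 (by simp)
  have hprod : ∀ c, colorProd K u i c = colorProd K u' i' c := by
    intro c
    have h1 : colorProd K u i c = ∏ j ∈ Finset.Icc (-K : ℤ) K, colorDiff c (u' (i' + ε * j)) := by
      refine Finset.prod_congr rfl fun j hj => ?_
      rw [h j (by rw [abs_le]; simpa using hj)]
    rw [h1]
    rcases hε with rfl | rfl
    · simp [colorProd]
    · refine Finset.prod_nbij' (fun j => -j) (fun j => -j) ?_ ?_ ?_ ?_ ?_ <;>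
        simp only [Finset.mem_Icc, neg_neg, implies_true, neg_mul, one_mul]
      · intro j hj; omega
      · intro j hj; omega
  simp only [recolor, h0, hprod]

theorem recolor_eq_none {K : ℕ} {u : ℤ → Option ℕ} {i : ℤ} : recolor K u i = none ↔ u i = none := by
  simp [recolor]

/-- If two nearby positions got the same new color, they would share the modulus and the residue, so
the modulus would divide the difference of the old colors. That difference is a factor of the
product which the modulus does not divide. -/
theorem ProperColoring.recolor {K : ℕ} {u : ℤ → Option ℕ} (h : ProperColoring K u) :
    ProperColoring K (recolor K u) := by
  intro i j hne hij hi heq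
  obtain ⟨c, hc⟩ := Option.ne_none_iff_exists'.1 (mt recolor_eq_none.2 hi)
  rw [Ne, heq, recolor_eq_none] at hi
  obtain ⟨c', hc'⟩ := Option.ne_none_iff_exists'.1 hi
  have hcc : c' ≠ c := by
    rintro rfl
    exact h i j hne hij (by rw [hc]; simp) (hc.trans hc'.symm)
  simp only [OnlineLocal.recolor, hc, hc', Option.map_some, Option.some.injEq, Nat.pair_eq_pair]
    at heq
  obtain ⟨h1, h2⟩ := heq
  rw [← h1] at h2
  obtain ⟨-, hnd⟩ := leastNonDvd_spec (colorProd_ne_zero K u i c)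
  refine hnd (dvd_trans ?_ (Finset.dvd_prod_of_mem _ (a := j - i) ?_))
  · rw [show i + (j - i) = j by ring, hc', colorDiff, Option.elim_some, if_neg hcc]
    rcases le_total c c' with hle | hle
    · rw [Nat.sub_eq_zero_of_le hle, zero_add]
      exact (Nat.modEq_iff_dvd' hle).1 h2
    · rw [Nat.sub_eq_zero_of_le hle, add_zero]
      exact (Nat.modEq_iff_dvd' hle).1 h2.symm
  · rw [Finset.mem_Icc, ← abs_le]; exact hij

theorem ColorsLT.mono {m m' : ℕ} {u : ℤ → Option ℕ} (h : ColorsLT m u) (hm : m ≤ m') :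
    ColorsLT m' u := fun i c hc => (h i c hc).trans_le hm

/-- The product has `2 * K + 1` factors of size at most `2 ^ b`, so its least non-divisor is linear
in `b`. A modulus and a residue then code to a number quadratic in `b`. -/
theorem ColorsLT.recolor {K b : ℕ} {u : ℤ → Option ℕ} (h : ColorsLT (2 ^ b) u) :
    ColorsLT ((2 * (b * (2 * K + 1) + 1) + 1) ^ 2) (recolor K u) := by
  intro i c' hc'
  simp only [OnlineLocal.recolor, Option.mem_def, Option.map_eq_some_iff] at hc'
  obtain ⟨c, hc, rfl⟩ := hc'
  have hdiff : ∀ o : Option ℕ, (∀ c' ∈ o, c' < 2 ^ b) → colorDiff c o ≤ 2 ^ b := by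
    intro o ho
    have := h i c hc
    cases o with
    | none => simpa [colorDiff] using Nat.one_le_two_pow
    | some c' =>
      have := ho c' rfl
      simp only [colorDiff, Option.elim_some]
      split_ifs <;> omega
  have hX : colorProd K u i c < 2 ^ (b * (2 * K + 1) + 1) := by
    have h1 : colorProd K u i c ≤ (2 ^ b) ^ (2 * K + 1) := by
      refine (Finset.prod_le_pow_card _ _ _ fun j _ => hdiff _ (h (i + j))).trans (le_of_eq ?_)
      congr 1
      rw [Int.card_Icc]; omega
    refine h1.trans_lt ?_
    rw [← pow_mul]
    exact Nat.pow_lt_pow_right (by norm_num) (by omega)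
  have hd := leastNonDvd_le (colorProd_ne_zero K u i c) hX
  have hpos := (leastNonDvd_spec (colorProd_ne_zero K u i c)).1
  refine (Nat.pair_lt_max_add_one_sq _ _).trans_le ?_
  rw [max_eq_left (Nat.mod_lt _ hpos).le]
  gcongr

/-- Iterated exponentials that start at `a`. -/
def tower (a : ℕ) : ℕ → ℕ
  | 0 => a
  | k + 1 => 2 ^ tower a k

theorem le_tower (a k : ℕ) : a ≤ tower a k := by
  induction k with
  | zero => exact le_rfl
  | succ k ih => exact ih.trans Nat.lt_two_pow_self.le

theorem sixteen_mul_pow_four_le {a : ℕ} (ha : 24 ≤ a) : 16 * a ^ 4 ≤ 2 ^ a := by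
  induction a, ha using Nat.le_induction with
  | base => norm_num
  | succ a ha ih =>
    rw [pow_succ 2]
    obtain ⟨k, rfl⟩ := Nat.exists_eq_add_of_le ha
    nlinarith [Nat.zero_le (k ^ 4), Nat.zero_le (k ^ 3), Nat.zero_le (k ^ 2), Nat.zero_le k]

/-- One round leads from `2 ^ 2 ^ a` to `2 ^ (4 * a)`, and a second one to a polynomial in `a`,
which is at most `2 ^ a`. Two rounds thus remove exactly one level of the tower. -/
theorem ColorsLT.recolor_recolor {K a : ℕ} (h24 : 24 ≤ a) (hK : 4 * K + 5 ≤ a)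
    {u : ℤ → Option ℕ} (h : ColorsLT (2 ^ 2 ^ a) u) :
    ColorsLT (2 ^ a) (OnlineLocal.recolor K (OnlineLocal.recolor K u)) := by
  have key : ∀ b, 1 ≤ b → (2 * (b * (2 * K + 1) + 1) + 1) ^ 2 ≤ ((4 * K + 5) * b) ^ 2 :=
    fun b hb => Nat.pow_le_pow_left (by nlinarith) 2
  have h1 : ColorsLT (2 ^ (4 * a)) (OnlineLocal.recolor K u) := by
    refine h.recolor.mono ((key _ Nat.one_le_two_pow).trans ?_)
    calc ((4 * K + 5) * 2 ^ a) ^ 2 ≤ (2 ^ a * 2 ^ a) ^ 2 :=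
          Nat.pow_le_pow_left (Nat.mul_le_mul_right _ (hK.trans Nat.lt_two_pow_self.le)) 2
      _ = 2 ^ (4 * a) := by rw [← pow_add, ← pow_mul]; congr 1; omega
  refine h1.recolor.mono ((key _ (by omega)).trans ?_)
  calc ((4 * K + 5) * (4 * a)) ^ 2 ≤ (a * (4 * a)) ^ 2 :=
        Nat.pow_le_pow_left (Nat.mul_le_mul_right _ hK) 2
    _ = 16 * a ^ 4 := by ring
    _ ≤ 2 ^ a := sixteen_mul_pow_four_le h24

theorem ColorsLT.iterate_recolor {K a : ℕ} (h24 : 24 ≤ a) (hK : 4 * K + 5 ≤ a) (k : ℕ)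
    {u : ℤ → Option ℕ} (h : ColorsLT (tower a (k + 2)) u) :
    ColorsLT (tower a 2) ((OnlineLocal.recolor K)^[2 * k] u) := by
  induction k generalizing u with
  | zero => exact h
  | succ k ih =>
    rw [show 2 * (k + 1) = 2 * k + 1 + 1 by ring, Function.iterate_succ_apply,
      Function.iterate_succ_apply]
    have := le_tower a (k + 1)
    exact ih (ColorsLT.recolor_recolor (h24.trans this) (hK.trans this) h)

theorem ProperColoring.iterate_recolor {K : ℕ} (k : ℕ) {u : ℤ → Option ℕ}
    (h : ProperColoring K u) : ProperColoring K ((OnlineLocal.recolor K)^[k] u) := by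
  induction k generalizing u with
  | zero => exact h
  | succ k ih => exact ih h.recolor

theorem iterate_recolor_eq_none {K : ℕ} (k : ℕ) {u : ℤ → Option ℕ} {i : ℤ} :
    (recolor K)^[k] u i = none ↔ u i = none := by
  induction k generalizing u with
  | zero => rfl
  | succ k ih => rw [Function.iterate_succ_apply, ih, recolor_eq_none]

theorem loc_iterate_recolor (K k : ℕ) : Loc (k * K) (recolor K)^[k] := by
  induction k with
  | zero => exact loc_id
  | succ k ih =>
    rw [add_mul, one_mul, add_comm]
    exact (loc_recolor K).comp ih

theorem exists_iterate_logb_le_one (m : ℕ) :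
    ∀ x : ℝ, x ≤ m + 1 → ∃ k, (Real.logb 2)^[k] x ≤ 1 := by
  induction m with
  | zero => exact fun x hx => ⟨0, by simpa using hx⟩
  | succ m ih =>
    intro x hx
    rcases le_or_gt x 1 with h1 | h1
    · exact ⟨0, h1⟩
    · obtain ⟨k, hk⟩ := ih (Real.logb 2 x) (by
        rw [Real.logb_le_iff_le_rpow (by norm_num) (by linarith)]
        refine hx.trans ?_
        have : m + 1 + 1 ≤ 2 ^ (m + 1) := Nat.lt_two_pow_self
        exact_mod_cast this)
      exact ⟨k + 1, hk⟩

theorem iterate_logb_logStar_le_one (n : ℕ) : (Real.logb 2)^[logStar n] (n : ℝ) ≤ 1 := by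
  obtain ⟨k, hk⟩ := exists_iterate_logb_le_one n n (by simp)
  exact Nat.sInf_mem (s := {k : ℕ | (Real.logb 2)^[k] (n : ℝ) ≤ 1}) ⟨k, hk⟩

theorem one_le_logStar {n : ℕ} (hn : 2 ≤ n) : 1 ≤ logStar n := by
  by_contra h
  have h1 := iterate_logb_logStar_le_one n
  rw [show logStar n = 0 by omega, Function.iterate_zero_apply] at h1
  have : n ≤ 1 := by exact_mod_cast h1
  omega

theorem le_tower_logStar {a : ℕ} (ha : 1 ≤ a) (n : ℕ) : n ≤ tower a (logStar n) := by
  have key : ∀ k (x : ℝ), (Real.logb 2)^[k] x ≤ 1 → x ≤ tower a k := by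
    intro k
    induction k with
    | zero => exact fun x hx => hx.trans (by exact_mod_cast ha)
    | succ k ih =>
      intro x hx
      have := ih _ hx
      -- For `x ≤ 0` the value of `Real.logb` says nothing about `x`, but the bound is trivial.
      rcases le_or_gt x 0 with h0 | h0
      · exact h0.trans (by positivity)
      · rw [Real.logb_le_iff_le_rpow (by norm_num) h0] at this
        refine this.trans (le_of_eq ?_)
        rw [Real.rpow_natCast, tower]
        push_cast
        rfl
  exact_mod_cast key _ _ (iterate_logb_logStar_le_one n)

/-- Two levels above a tower that dominates `n`, there is room for every fixed power of `n`; hence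
the identifiers are an initial coloring of the required size. -/
theorem pow_lt_tower {a c n : ℕ} (h24 : 24 ≤ a) (hc : c ≤ a) :
    n ^ c < tower a (logStar n + 2) := by
  obtain ⟨b, hb⟩ : ∃ b, b = tower a (logStar n) := ⟨_, rfl⟩
  have hab : a ≤ b := hb ▸ le_tower a _
  have hnb : n ≤ b := hb ▸ le_tower_logStar (by omega) n
  change n ^ c < 2 ^ 2 ^ tower a (logStar n)
  rw [← hb]
  calc n ^ c ≤ (2 ^ b) ^ c := Nat.pow_le_pow_left (hnb.trans Nat.lt_two_pow_self.le) c
    _ = 2 ^ (b * c) := by rw [← pow_mul]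
    _ < 2 ^ 2 ^ b := by
      refine Nat.pow_lt_pow_right (by norm_num) ?_
      have h1 := sixteen_mul_pow_four_le (h24.trans hab)
      have h2 : b * c ≤ b * b := Nat.mul_le_mul_left _ (hc.trans hab)
      have h3 : b * b < 16 * b ^ 4 := by
        have : 1 ≤ b * b := Nat.mul_pos (by omega) (by omega)
        nlinarith
      omega

/-! ### Greedy selection of the cuts. -/

/-- The set of positions that a greedy algorithm selects, color by color, such that they are at
distance more than `K` from each other. -/
def greedy (K : ℕ) (u : ℤ → Option ℕ) : ℕ → ℤ → Prop
  | 0, _ => False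
  | k + 1, i => greedy K u k i ∨ u i = some k ∧ ∀ j : ℤ, |j| ≤ K → ¬ greedy K u k (i + j)

theorem loc_greedy (K k : ℕ) : Loc (k * K) fun u => greedy K u k := by
  induction k with
  | zero => exact fun _ _ _ _ _ => rfl
  | succ k ih =>
    intro u i u' i' h
    rw [add_mul, one_mul] at h
    have h0 := agree_zero h
    obtain ⟨ε, hε, h1⟩ := h.map_loc ih
    have h2 : greedy K u k i = greedy K u' k i' := by simpa using h1 0 (by simp)
    simp only [greedy, h0, h2, eq_iff_iff]
    refine or_congr_right (and_congr_right' ⟨fun hj j hjK => ?_, fun hj j hjK => ?_⟩)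
    · have := hj (ε * j) (by rcases hε with rfl | rfl <;> simpa using hjK)
      rw [h1 _ (by rcases hε with rfl | rfl <;> simpa using hjK)] at this
      rcases hε with rfl | rfl <;> simpa using this
    · rw [h1 j hjK]
      exact hj _ (by rcases hε with rfl | rfl <;> simpa using hjK)

theorem ne_none_of_greedy {K k : ℕ} {u : ℤ → Option ℕ} {i : ℤ} (h : greedy K u k i) :
    u i ≠ none := by
  induction k with
  | zero => exact h.elim
  | succ k ih =>
    rcases h with h | h
    · exact ih h
    · rw [h.1]; simp

/-- Positions selected in the same round have the same color and are far apart by properness. Those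
of different rounds are far apart by the greedy rule. -/
theorem lt_abs_sub_of_greedy {K k : ℕ} {u : ℤ → Option ℕ} (hu : ProperColoring K u) {i j : ℤ}
    (hi : greedy K u k i) (hj : greedy K u k j) (hne : i ≠ j) : (K : ℤ) < |j - i| := by
  induction k with
  | zero => exact hi.elim
  | succ k ih =>
    by_contra hle
    rw [not_lt] at hle
    rcases hi with hi | ⟨hi, hi'⟩ <;> rcases hj with hj | ⟨hj, hj'⟩
    · exact absurd (ih hi hj) (by omega)
    · exact hj' (i - j) (by rwa [abs_sub_comm]) (by simpa using hi)
    · exact hi' (j - i) hle (by simpa using hj)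
    · exact hu i j hne hle (by rw [hi]; simp) (hi.trans hj.symm)

theorem exists_greedy_near {K k : ℕ} {u : ℤ → Option ℕ} (hu : ColorsLT k u) {i : ℤ}
    (hi : u i ≠ none) : ∃ j : ℤ, |j| ≤ K ∧ greedy K u k (i + j) := by
  obtain ⟨c, hc⟩ := Option.ne_none_iff_exists'.1 hi
  have hck := hu i c hc
  clear hu hi
  induction k with
  | zero => omega
  | succ k ih =>
    by_cases h : ∃ j : ℤ, |j| ≤ K ∧ greedy K u k (i + j)
    · obtain ⟨j, hj, h⟩ := h
      exact ⟨j, hj, Or.inl h⟩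
    · rcases Nat.lt_succ_iff_lt_or_eq.1 hck with hlt | rfl
      · exact absurd (ih hlt) h
      · push Not at h
        exact ⟨0, by simp, Or.inr ⟨by simpa using hc, by simpa using h⟩⟩

theorem Agree.symm {γ : Type*} {t : ℕ} {x x' : ℤ → γ} {i i' : ℤ} (h : Agree t x i x' i') :
    Agree t x' i' x i := by
  obtain ⟨ε, hε, h⟩ := h
  refine ⟨ε, hε, fun j hj => ?_⟩
  rw [h (ε * j) (by rcases hε with rfl | rfl <;> simpa using hj)]
  rcases hε with rfl | rfl <;> simp

/-- The sequences of inputs and identifiers that arise from graphs with `n` nodes: either they have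
a letter at each position or, if `ends` holds, exactly `n` letters. -/
structure Admissible {In : Type*} (n c : ℕ) (ends : Prop) (x : ℤ → Option (In × ℕ)) : Prop where
  shape : supp x = Set.univ ∨ ends ∧ supp x = Set.Ico 0 (n : ℤ)
  inj : ∀ (i j : ℤ) (p q : In × ℕ), x i = some p → x j = some q → |j - i| < n → p.2 = q.2 → i = j
  bound : ∀ (i : ℤ) (p : In × ℕ), x i = some p → p.2 ≤ n ^ c

theorem Admissible.ordConnected {In : Type*} {n c : ℕ} {ends : Prop} {x : ℤ → Option (In × ℕ)}
    (hx : Admissible n c ends x) : (supp x).OrdConnected := by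
  rcases hx.shape with h | ⟨-, h⟩ <;> rw [h]
  · exact Set.ordConnected_univ
  · exact Set.ordConnected_Ico

/-- All positions within distance `H` have letters. -/
def Eligible {β : Type*} (H : ℕ) (x : ℤ → Option β) (i : ℤ) : Prop :=
  ∀ j : ℤ, |j| ≤ H → x (i + j) ≠ none

theorem loc_eligible {β : Type*} (H : ℕ) : Loc H (Eligible (β := β) H) := by
  have key : ∀ (x : ℤ → Option β) i x' i', Agree H x i x' i' → Eligible H x i →
      Eligible H x' i' := by
    intro x i x' i' h hi j hj
    obtain ⟨ε, hε, h⟩ := h.symm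
    rw [h j hj]
    exact hi _ (by rcases hε with rfl | rfl <;> simpa using hj)
  exact fun x i x' i' h => propext ⟨key _ _ _ _ h, key _ _ _ _ h.symm⟩

/-- A local rule that selects eligible positions that are far apart but not too far apart. -/
theorem exists_cuts {In : Type*} (K H c : ℕ) : ∃ C : ℕ, ∀ n, K < n →
    ∃ Q : (ℤ → Option (In × ℕ)) → ℤ → Prop, Loc (C * (logStar n + 1)) Q ∧
      ∀ ends x, Admissible n c ends x → (∀ i, Q x i → Eligible H x i) ∧
        (∀ i j, Q x i → Q x j → i ≠ j → (K : ℤ) < |j - i|) ∧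
        ∀ i, Eligible H x i → ∃ j : ℤ, |j| ≤ K ∧ Q x (i + j) := by
  classical
  obtain ⟨a, h24, hK, hc⟩ : ∃ a, 24 ≤ a ∧ 4 * K + 5 ≤ a ∧ c ≤ a :=
    ⟨24 + (4 * K + 5) + c, by omega, by omega, by omega⟩
  obtain ⟨M, hM⟩ : ∃ M, M = tower a 2 := ⟨_, rfl⟩
  -- There are `2 * logStar n` rounds of recoloring at cost `K` each; the eligibility test costs
  -- `H`, and the greedy selection runs through a constant number `M` of colors.
  refine ⟨2 * K + H + M * K, fun n hn => ?_⟩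
  obtain ⟨s, hs⟩ : ∃ s, s = logStar n := ⟨_, rfl⟩
  let col : (ℤ → Option (In × ℕ)) → ℤ → Option ℕ :=
    fun x => (recolor K)^[2 * s] (fun i => (x i).map Prod.snd)
  -- Erasing the colors of ineligible positions makes the greedy algorithm ignore them.
  let masked : (ℤ → Option (In × ℕ)) → ℤ → Option ℕ :=
    fun x i => if Eligible H x i then col x i else none
  have hcol : Loc (2 * s * K) col := by
    have h0 : Loc 0 fun (x : ℤ → Option (In × ℕ)) i => (x i).map Prod.snd := loc_id.map _
    have := h0.comp (loc_iterate_recolor K (2 * s))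
    rwa [zero_add] at this
  have hmasked : Loc (2 * s * K + H) masked :=
    ((loc_eligible H).mono (by omega)).map₂ (hcol.mono (by omega)) fun e o => if e then o else none
  refine ⟨fun x => greedy K (masked x) M, ?_, ?_⟩
  · refine (hmasked.comp (loc_greedy K M)).mono ?_
    rw [← hs]
    nlinarith [Nat.zero_le (H * s), Nat.zero_le (M * K * s), Nat.zero_le K]
  · intro ends x hx
    have hproper : ProperColoring K (fun i => (x i).map Prod.snd) := by
      intro i j hne hij hi heq
      obtain ⟨p, hp⟩ := Option.ne_none_iff_exists'.1 (fun h => hi (by simp [h]) : x i ≠ none)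
      simp only [hp, Option.map_some] at heq
      obtain ⟨q, hq, hpq⟩ := Option.map_eq_some_iff.1 heq.symm
      exact hne (hx.inj i j p q hp hq (by omega) hpq.symm)
    have hlt : ColorsLT (tower a (s + 2)) (fun i => (x i).map Prod.snd) := by
      intro i k hk
      obtain ⟨p, hp, rfl⟩ := Option.map_eq_some_iff.1 hk
      exact (hx.bound i p hp).trans_lt (hs ▸ pow_lt_tower h24 hc)
    have hproper' : ProperColoring K (masked x) := by
      intro i j hne hij hi heq
      simp only [masked] at hi heq
      split_ifs at hi heq
      · exact hproper.iterate_recolor (2 * s) i j hne hij hi heq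
      · exact hi heq
      · exact hi rfl
      · exact hi rfl
    have hlt' : ColorsLT M (masked x) := by
      intro i k hk
      simp only [masked] at hk
      split_ifs at hk
      · exact hM ▸ hlt.iterate_recolor h24 hK s i k hk
      · simp at hk
    refine ⟨fun i hi => ?_, fun i j hi hj hne => lt_abs_sub_of_greedy hproper' hi hj hne, ?_⟩
    · by_contra hel
      exact ne_none_of_greedy hi (if_neg hel)
    · intro i hi
      refine exists_greedy_near hlt' ?_
      simp only [masked, if_pos hi]
      rw [Ne, iterate_recolor_eq_none]
      have := hi 0 (by simp)
      rw [add_zero] at this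
      simpa using this

/-! ### Labeling the windows around the cuts. -/

section Labeling

variable {In Out : Type*} [Inhabited In] {r h : ℕ}

/-- The input at a position (with a default value where the sequence has no letter). -/
def inputAt (x : ℤ → Option (In × ℕ)) (i : ℤ) : In := ((x i).getD default).1

/-- The identifier at a position (with a default value where the sequence has no letter). -/
def idAt (x : ℤ → Option (In × ℕ)) (i : ℤ) : ℕ := ((x i).getD default).2

theorem eq_some_of_ne_none {x : ℤ → Option (In × ℕ)} {i : ℤ} (h : x i ≠ none) :
    x i = some (inputAt x i, idAt x i) := by
  obtain ⟨p, hp⟩ := Option.ne_none_iff_exists'.1 h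
  simp [inputAt, idAt, hp]

/-- A labeling of identifiers follows the rule `D` at the position `i`. -/
def CutLabeled (r h : ℕ) (D : Set (List In × List (In × Out) × List In))
    (x : ℤ → Option (In × ℕ)) (i : ℤ) (l : ℕ → Out) : Prop :=
  (seg (inputAt x) (i - (h + r : ℕ)) h,
    seg (fun k => (inputAt x k, l (idAt x k))) (i - r) (2 * r + 1),
    seg (inputAt x) (i + r + 1) h) ∈ D

theorem seg_agree_one {γ : Type*} {y y' : ℤ → γ} {i i' a b : ℤ} {n t : ℕ}
    (h : ∀ j : ℤ, |j| ≤ t → y (i + j) = y' (i' + 1 * j)) (ha : -t ≤ a) (hb : a + n ≤ t + 1)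
    (hab : b = i' + a) : seg y (i + a) n = seg y' b n := by
  refine List.ext_getElem (by simp) fun k hk _ => ?_
  rw [length_seg] at hk
  rw [getElem_seg, getElem_seg, add_assoc, h _ (by rw [abs_le]; omega), hab]
  congr 1; ring

theorem seg_agree_neg_one {γ : Type*} {y y' : ℤ → γ} {i i' a b : ℤ} {n t : ℕ}
    (h : ∀ j : ℤ, |j| ≤ t → y (i + j) = y' (i' + -1 * j)) (ha : -t ≤ a) (hb : a + n ≤ t + 1)
    (hab : b = i' - a - n + 1) : (seg y (i + a) n).reverse = seg y' b n := by
  refine List.ext_getElem (by simp) fun k hk _ => ?_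
  rw [List.length_reverse, length_seg] at hk
  rw [List.getElem_reverse, getElem_seg, getElem_seg, length_seg, add_assoc,
    h _ (by rw [abs_le]; omega), hab]
  congr 1; omega

/-- A labeling is a function of identifiers, not of positions, so it has no orientation; the closure
of `D` under mirror images takes care of the inputs and the window. The whole set of valid labelings
is therefore visible in the view, and a choice from it is local. -/
theorem loc_cutLabeled {D : Set (List In × List (In × Out) × List In)}
    (hD : ∀ d ∈ D, (d.2.2.reverse, d.2.1.reverse, d.1.reverse) ∈ D) :
    Loc (h + r) (CutLabeled r h D) := by
  have key : ∀ (x : ℤ → Option (In × ℕ)) i x' i', Agree (h + r) x i x' i' → ∀ l : ℕ → Out,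
      CutLabeled r h D x i l → CutLabeled r h D x' i' l := by
    rintro x i x' i' ⟨ε, hε, hx⟩ l hl
    have hin : ∀ j : ℤ, |j| ≤ (h + r : ℕ) → inputAt x (i + j) = inputAt x' (i' + ε * j) :=
      fun j hj => by rw [inputAt, hx j hj, inputAt]
    have hlab : ∀ j : ℤ, |j| ≤ (h + r : ℕ) →
        (fun k => (inputAt x k, l (idAt x k))) (i + j) =
          (fun k => (inputAt x' k, l (idAt x' k))) (i' + ε * j) :=
      fun j hj => by simp only [hin j hj, idAt, hx j hj]
    simp only [CutLabeled, sub_eq_add_neg, add_assoc] at hl ⊢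
    rcases hε with rfl | rfl
    · rwa [seg_agree_one hin (a := -(h + r : ℕ)) (n := h) (by omega) (by push_cast; omega) rfl,
        seg_agree_one (y := fun k => (inputAt x k, l (idAt x k)))
          (y' := fun k => (inputAt x' k, l (idAt x' k))) hlab (t := h + r) (a := -r)
          (n := 2 * r + 1) (by omega) (by omega) rfl,
        seg_agree_one hin (a := r + 1) (n := h) (by omega) (by push_cast; omega) rfl] at hl
    · have := hD _ hl
      simp only at this
      rwa [seg_agree_neg_one hin (a := r + 1) (n := h) (b := i' + -(h + r : ℕ)) (by omega)
          (by push_cast; omega) (by push_cast; ring),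
        seg_agree_neg_one (y := fun k => (inputAt x k, l (idAt x k)))
          (y' := fun k => (inputAt x' k, l (idAt x' k))) hlab (t := h + r) (a := -r)
          (n := 2 * r + 1) (b := i' + -r) (by omega) (by omega) (by push_cast; ring),
        seg_agree_neg_one hin (a := -(h + r : ℕ)) (n := h) (b := i' + (r + 1)) (by omega) (by omega)
          (by push_cast; ring)] at this
  exact fun x i x' i' hx => funext fun l => propext ⟨key _ _ _ _ hx l, key _ _ _ _ hx.symm l⟩

/-- Position `i` receives the label `o` from a labeling that is stored within distance `r`. -/
def Receives (r : ℕ) (w : ℤ → Option (In × ℕ) × Option (ℕ → Out)) (i : ℤ) (o : Out) : Prop :=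
  ∃ j : ℤ, |j| ≤ r ∧ ∃ l, (w (i + j)).2 = some l ∧ l ((w i).1.getD default).2 = o

theorem loc_receives : Loc r (Receives (In := In) (Out := Out) r) := by
  have key : ∀ (w : ℤ → Option (In × ℕ) × Option (ℕ → Out)) i w' i', Agree r w i w' i' → ∀ o,
      Receives r w i o → Receives r w' i' o := by
    rintro w i w' i' h o ⟨j, hj, l, hl, ho⟩
    rw [agree_zero h] at ho
    obtain ⟨ε, hε, h⟩ := h
    refine ⟨ε * j, by rcases hε with rfl | rfl <;> simpa using hj, l, ?_, ho⟩
    rw [← h j hj, hl]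
  exact fun w i w' i' h => funext fun o => propext ⟨key _ _ _ _ h o, key _ _ _ _ h.symm o⟩

open Classical in
/-- The labels that the positions within distance `r` receive from the labelings that are stored at
some positions. -/
noncomputable def collect [Nonempty Out] (r : ℕ)
    (w : ℤ → Option (In × ℕ) × Option (ℕ → Out)) (i : ℤ) : Option Out :=
  if ∃ o, Receives r w i o then some (Classical.epsilon (Receives r w i)) else none

theorem loc_collect [Nonempty Out] : Loc r (collect (In := In) (Out := Out) r) := by
  intro w i w' i' h
  simp only [collect]
  rw [loc_receives w i w' i' h]

end Labeling

/-! ### Filling the gaps. -/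

section Gaps

variable {In Out : Type*} {r : ℕ}

/-- Positions that have a letter but no label yet. -/
def Free (v : ℤ → Option (In × ℕ) × Option Out) (i : ℤ) : Prop := (v i).1 ≠ none ∧ (v i).2 = none

/-- All positions between `i` and `j` are free. -/
def FreeBetween (v : ℤ → Option (In × ℕ) × Option Out) (i j : ℤ) : Prop :=
  ∀ k, (i ≤ k ∧ k ≤ j ∨ j ≤ k ∧ k ≤ i) → Free v k

/-- The labeled sequence in which free positions get their labels from a labeling of identifiers. -/
def filled (v : ℤ → Option (In × ℕ) × Option Out) (l : ℕ → Out) (i : ℤ) : Option (In × Out) :=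
  (v i).1.map fun p => (p.1, (v i).2.getD (l p.2))

/-- All windows that touch the gap around position `i` pass the check, if the gap is filled
according to a labeling of identifiers. -/
def GapLabeled (r B : ℕ) (W : List (Option (In × Out)) → Prop)
    (v : ℤ → Option (In × ℕ) × Option Out) (i : ℤ) (l : ℕ → Out) : Prop :=
  ∀ j k : ℤ, |j| ≤ B → |k| ≤ r → FreeBetween v i (i + j) →
    W (seg (filled v l) (i + j + k - r) (2 * r + 1))

/-- A relevant window has its center within `r` of a position of the gap, hence within `B + r`, and
extends `r` further. -/
theorem loc_gapLabeled {B : ℕ} {W : List (Option (In × Out)) → Prop}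
    (hW : ∀ w, w.length = 2 * r + 1 → W w → W w.reverse) :
    Loc (B + 2 * r) (GapLabeled r B W) := by
  have key : ∀ (v : ℤ → Option (In × ℕ) × Option Out) i v' i', Agree (B + 2 * r) v i v' i' →
      ∀ l : ℕ → Out, GapLabeled r B W v i l → GapLabeled r B W v' i' l := by
    intro v i v' i' hv l hl j k hj hk hfree
    obtain ⟨ε, hε, h⟩ := hv.symm
    have hfill : ∀ j : ℤ, |j| ≤ (B + 2 * r : ℕ) →
        filled v' l (i' + j) = filled v l (i + ε * j) := fun j hj => by
      simp only [filled, h j hj]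
    have h1 := hl (ε * j) (ε * k) (by rcases hε with rfl | rfl <;> simpa using hj)
      (by rcases hε with rfl | rfl <;> simpa using hk) (by
        intro m hm
        have hm' : Free v' (i' + ε * (m - i)) :=
          hfree _ (by rcases hε with rfl | rfl <;> omega)
        rw [Free, h _ (by
          rw [abs_le] at hj ⊢
          rcases hε with rfl | rfl <;> push_cast <;> omega)] at hm'
        rw [show i + ε * (ε * (m - i)) = m by rcases hε with rfl | rfl <;> ring] at hm'
        exact hm')
    rw [abs_le] at hj hk
    rcases hε with rfl | rfl
    · rwa [show i' + j + k - (r : ℤ) = i' + (j + k - r) by ring,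
        seg_agree_one hfill (b := i + 1 * j + 1 * k - r) (by push_cast; omega)
          (by push_cast; omega) (by ring)]
    · rw [show i' + j + k - (r : ℤ) = i' + (j + k - r) by ring,
        ← List.reverse_reverse (seg _ _ _),
        seg_agree_neg_one hfill (b := i + -1 * j + -1 * k - r) (by push_cast; omega)
          (by push_cast; omega) (by push_cast; ring)]
      exact hW _ length_seg h1
  exact fun v i v' i' hv => funext fun l => propext ⟨key _ _ _ _ hv l, key _ _ _ _ hv.symm l⟩

/-- The final labels: free positions are labeled gap by gap. -/
noncomputable def finish [Inhabited In] [Nonempty Out] (r B : ℕ) (W : List (Option (In × Out)) → Prop)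
    (v : ℤ → Option (In × ℕ) × Option Out) (i : ℤ) : Out :=
  (v i).2.getD (Classical.epsilon (GapLabeled r B W v i) ((v i).1.getD default).2)

theorem loc_finish [Inhabited In] [Nonempty Out] {B : ℕ} {W : List (Option (In × Out)) → Prop}
    (hW : ∀ w, w.length = 2 * r + 1 → W w → W w.reverse) :
    Loc (B + 2 * r) (finish r B W) := by
  intro v i v' i' h
  simp only [finish, loc_gapLabeled hW v i v' i' h, agree_zero h]

end Gaps

/-- Where identifiers are distinct, passing from positions to identifiers loses no labelings. -/
theorem exists_identifier_labeling {Out : Type*} [Nonempty Out] {id : ℤ → ℕ} {s : Set ℤ}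
    (hid : Set.InjOn id s) (f : ℤ → Out) : ∃ l : ℕ → Out, ∀ k ∈ s, l (id k) = f k := by
  refine ⟨fun m => f (Function.invFunOn id s m), fun k hk => ?_⟩
  beta_reduce
  rw [hid.leftInvOn_invFunOn hk]

theorem exists_identifier_labeling_list {In Out : Type*} [Nonempty Out] {id : ℤ → ℕ} {u : ℤ → In}
    {a : ℤ} {n : ℕ} (hid : Set.InjOn id (Set.Ico a (a + n))) {s : List (In × Out)}
    (hs : s.map Prod.fst = seg u a n) : ∃ l : ℕ → Out, s = seg (fun k => (u k, l (id k))) a n := by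
  obtain ⟨l, hl⟩ := exists_identifier_labeling hid
    fun k => ((s[(k - a).toNat]?).map Prod.snd).getD (Classical.arbitrary Out)
  have hlen : s.length = n := by simpa using congrArg List.length hs
  refine ⟨l, List.ext_getElem (by simpa using hlen) fun k hk _ => ?_⟩
  rw [getElem_seg, hl _ ⟨by omega, by omega⟩]
  have h1 : (s.map Prod.fst)[k]'(by simpa using hk) = u (a + k) := by simp only [hs, getElem_seg]
  rw [List.getElem_map] at h1
  rw [← h1, show (a + k - a).toNat = k by omega, List.getElem?_eq_getElem hk]
  rfl

/-! ### Correctness of the filled layout. -/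

section Layout

variable {In Out : Type*} [Inhabited In]

/-- Labeled windows around the positions in `Q`, which are far apart but not too far apart. -/
structure IsLayout (r h K : ℕ) (D : Set (List In × List (In × Out) × List In))
    (x : ℤ → Option (In × ℕ)) (Q : ℤ → Prop) (l : ℤ → ℕ → Out)
    (v : ℤ → Option (In × ℕ) × Option Out) : Prop where
  eligible : ∀ c, Q c → Eligible (h + r) x c
  far : ∀ i j, Q i → Q j → i ≠ j → (K : ℤ) < |j - i|
  near : ∀ i, Eligible (h + r) x i → ∃ j : ℤ, |j| ≤ K ∧ Q (i + j)
  cut : ∀ c, Q c → CutLabeled r h D x c (l c)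
  fst : ∀ i, (v i).1 = x i
  snd : ∀ c i : ℤ, Q c → |i - c| ≤ r → (v i).2 = some (l c (idAt x i))
  exists_cut : ∀ i, (v i).2 ≠ none → ∃ c, Q c ∧ |i - c| ≤ r

variable {r h K : ℕ} {D : Set (List In × List (In × Out) × List In)}
  {x : ℤ → Option (In × ℕ)} {Q : ℤ → Prop} {l : ℤ → ℕ → Out}
  {v : ℤ → Option (In × ℕ) × Option Out}

theorem IsLayout.not_free (hv : IsLayout r h K D x Q l v) {c i : ℤ} (hc : Q c) (hi : |i - c| ≤ r) :
    ¬ Free v i := fun hf => by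
  have := hf.2
  rw [hv.snd c i hc hi] at this
  simp at this

theorem IsLayout.ne_none (hv : IsLayout r h K D x Q l v) {c i : ℤ} (hc : Q c)
    (hi : |i - c| ≤ (h + r : ℕ)) : x i ≠ none := by
  have := hv.eligible c hc (i - c) hi
  rwa [show c + (i - c) = i by ring] at this

/-- The gap around a free position is bounded on either side by a labeled window or by the end of
the sequence. -/
theorem IsLayout.exists_anchor (hv : IsLayout r h K D x Q l v) (hx : (supp x).OrdConnected)
    (hK : h + r ≤ K) {j δ : ℤ} (hδ : δ = 1 ∨ δ = -1) (hj : Free v j) :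
    ∃ m : ℕ, 1 ≤ m ∧ m ≤ 2 * K + 1 ∧ (∀ k : ℕ, k < m → Free v (j + δ * k)) ∧
      ¬ Free v (j + δ * m) ∧
      (Q (j + δ * (m + r)) ∨ ∀ k : ℕ, m ≤ k → x (j + δ * k) = none) := by
  classical
  -- Look at the position at distance `K + 1`. If it is eligible, a cut lies within `K` of it;
  -- otherwise a letter is missing within `h + r ≤ K` of it.
  have hex : ∃ m : ℕ, m ≤ 2 * K + 1 ∧ ¬ Free v (j + δ * m) := by
    by_cases hel : Eligible (h + r) x (j + δ * (K + 1))
    · obtain ⟨q, hq, hQ⟩ := hv.near _ hel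
      rw [abs_le] at hq
      refine ⟨(K + 1 + δ * q).toNat, by rcases hδ with rfl | rfl <;> omega,
        hv.not_free hQ (le_of_eq_of_le ?_ (Int.natCast_nonneg r))⟩
      rw [abs_eq_zero]
      rcases hδ with rfl | rfl <;> omega
    · simp only [Eligible, not_forall, not_not] at hel
      obtain ⟨q, hq, hxq⟩ := hel
      rw [abs_le] at hq
      refine ⟨(K + 1 + δ * q).toNat, by rcases hδ with rfl | rfl <;> push_cast at * <;> omega,
        fun hf => hf.1 ?_⟩
      rw [hv.fst, ← hxq]
      congr 1
      rcases hδ with rfl | rfl <;> push_cast at * <;> omega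
  obtain ⟨m, ⟨hm1, hm2⟩, hmin⟩ : ∃ m : ℕ, (m ≤ 2 * K + 1 ∧ ¬ Free v (j + δ * m)) ∧
      ∀ k : ℕ, k < m → ¬ (k ≤ 2 * K + 1 ∧ ¬ Free v (j + δ * k)) :=
    ⟨Nat.find hex, Nat.find_spec hex, fun k hk => Nat.find_min hex hk⟩
  have hm0 : 1 ≤ m := by
    by_contra h0
    obtain rfl : m = 0 := by omega
    exact hm2 (by simpa using hj)
  have hfree : ∀ k : ℕ, k < m → Free v (j + δ * k) := fun k hk => by
    by_contra hf
    exact hmin k hk ⟨by omega, hf⟩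
  refine ⟨m, hm0, hm1, hfree, hm2, ?_⟩
  by_cases hxm : x (j + δ * m) = none
  · right
    intro k hk
    by_contra hne
    have hxj : x j ≠ none := by rw [← hv.fst]; exact hj.1
    refine absurd hxm ?_
    rcases hδ with rfl | rfl
    · exact hx.out hxj hne ⟨by omega, by omega⟩
    · exact hx.out hne hxj ⟨by omega, by omega⟩
  · left
    obtain ⟨c, hc, hmc⟩ := hv.exists_cut (j + δ * m) fun h => hm2 ⟨by rwa [hv.fst], h⟩
    have h1 : ¬ |j - c| ≤ r := fun h => hv.not_free hc h hj
    obtain ⟨q, rfl⟩ : ∃ q, c = j + δ * q := ⟨δ * (c - j), by rcases hδ with rfl | rfl <;> ring⟩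
    rw [abs_le] at hmc h1
    have hq : (r : ℤ) < q := by rcases hδ with rfl | rfl <;> omega
    have hmq : (m : ℤ) ≤ q - r := by
      by_contra hlt
      -- By minimality of `m`, the first position of the window met from `j` is `m` itself.
      refine hv.not_free hc (i := j + δ * (q - r).toNat) ?_ (hfree (q - r).toNat (by omega))
      rw [abs_le]
      rcases hδ with rfl | rfl <;> omega
    rwa [show (m : ℤ) + r = q by rcases hδ with rfl | rfl <;> omega]

theorem IsLayout.map_window (hv : IsLayout r h K D x Q l v) {c : ℤ} (hc : Q c) (l₀ : ℕ → Out) :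
    (seg (fun k => (inputAt x k, l c (idAt x k))) (c - r) (2 * r + 1)).map some =
      seg (filled v l₀) (c - r) (2 * r + 1) := by
  rw [map_seg]
  refine seg_congr fun i h1 h2 => ?_
  have hi : |i - c| ≤ r := by rw [abs_le]; omega
  rw [filled, hv.fst, hv.snd c i hc hi,
    eq_some_of_ne_none (hv.ne_none hc (hi.trans (by omega)))]
  rfl

theorem IsLayout.replicate_none (hv : IsLayout r h K D x Q l v) {a : ℤ} {n : ℕ}
    (ha : ∀ i, a ≤ i → i < a + n → x i = none) (l₀ : ℕ → Out) :
    List.replicate n none = seg (filled v l₀) a n := by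
  refine List.ext_getElem (by simp) fun k hk _ => ?_
  rw [List.length_replicate] at hk
  rw [getElem_seg, filled, hv.fst, ha _ (by omega) (by omega)]
  simp

variable {W : List (Option (In × Out)) → Prop} {n e : ℕ} {ends : Prop}

/-- Each side of the gap is bounded by a window or by the end of a path. The cut rule covers all
combinations except two ends, which would make the whole path shorter than `n`. -/
theorem IsLayout.exists_gap (hv : IsLayout r h K D x Q l v) (hx : Admissible n e ends x)
    (hK : K = 2 * (h + r)) (hn : 4 * K + 2 < n) (hW : ∀ w, w.length = 2 * r + 1 → W w → W w.reverse)
    (hD : IsCutRule r W h (4 * K + 2) ends D) {j : ℤ} (hj : Free v j) :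
    ∃ (lo : ℤ) (g : ℕ), lo < j ∧ j < lo + 1 + g ∧ g ≤ 4 * K + 1 ∧
      (∀ k, lo < k → k < lo + 1 + g → Free v k) ∧ ¬ Free v lo ∧ ¬ Free v (lo + 1 + g) ∧
      ∀ l₀, Fillable r W (seg (filled v l₀) (lo + 1 - (2 * r : ℕ)) (2 * r))
        (seg (inputAt x) (lo + 1) g) (seg (filled v l₀) (lo + 1 + g) (2 * r)) := by
  obtain ⟨m₁, h₁0, h₁K, h₁f, h₁n, h₁⟩ := hv.exists_anchor hx.ordConnected (by omega) (Or.inl rfl) hj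
  obtain ⟨m₂, h₂0, h₂K, h₂f, h₂n, h₂⟩ := hv.exists_anchor hx.ordConnected (by omega) (Or.inr rfl) hj
  simp only [one_mul, neg_mul] at h₁f h₁n h₁ h₂f h₂n h₂
  obtain ⟨lo, hlo⟩ : ∃ lo : ℤ, lo = j - m₂ := ⟨_, rfl⟩
  obtain ⟨g, hg⟩ : ∃ g : ℕ, g + 1 = m₁ + m₂ := ⟨m₁ + m₂ - 1, by omega⟩
  have hfree : ∀ k, lo < k → k < lo + 1 + g → Free v k := by
    intro k hk1 hk2
    rcases le_total j k with hjk | hjk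
    · have := h₁f (k - j).toNat (by omega)
      rwa [show j + ((k - j).toNat : ℤ) = k by omega] at this
    · have := h₂f (j - k).toNat (by omega)
      rwa [show j + -((j - k).toNat : ℤ) = k by omega] at this
  rw [show j + (m₁ : ℤ) = lo + 1 + g by omega] at h₁n
  rw [show j + -(m₂ : ℤ) = lo by omega] at h₂n
  refine ⟨lo, g, by omega, by omega, by omega, hfree, h₂n, h₁n, fun l₀ => ?_⟩
  have hfreex : ∀ k, lo < k → k < lo + 1 + g → x k ≠ none := fun k h1 h2 => by
    rw [← hv.fst]; exact (hfree k h1 h2).1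
  -- the windows at the two ends of the gap
  have hright : ∀ c, c = lo + 1 + g + r → (seg (filled v l₀) (c - r) (2 * r + 1)).take (2 * r) =
      seg (filled v l₀) (lo + 1 + g) (2 * r) := by
    rintro c rfl
    rw [seg_add, List.take_left' length_seg]
    congr 1; ring
  have hleft : ∀ c, c = lo - r → (seg (filled v l₀) (c - r) (2 * r + 1)).drop
      ((seg (filled v l₀) (c - r) (2 * r + 1)).length - 2 * r) =
      seg (filled v l₀) (lo + 1 - (2 * r : ℕ)) (2 * r) := by
    rintro c rfl
    rw [length_seg, show 2 * r + 1 - 2 * r = 1 by omega, show 2 * r + 1 = 1 + 2 * r by ring,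
      seg_add, List.drop_left' length_seg]
    congr 1; push_cast; ring
  rcases h₂ with h₂ | h₂ <;> rcases h₁ with h₁ | h₁
  · -- two cuts
    obtain ⟨c₁, hc₁⟩ : ∃ c, c = j + -((m₂ : ℤ) + r) := ⟨_, rfl⟩
    obtain ⟨c₂, hc₂⟩ : ∃ c, c = j + ((m₁ : ℤ) + r) := ⟨_, rfl⟩
    rw [← hc₁] at h₂
    rw [← hc₂] at h₁
    have hfar := hv.far c₁ c₂ h₂ h₁ (by omega)
    rw [abs_of_pos (by omega)] at hfar
    -- The cuts are more than `K = 2 * (h + r)` apart, so the `h` inputs beside one window and those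
    -- beside the other are disjoint and lie in the gap.
    obtain ⟨g', rfl⟩ : ∃ g', g = h + g' + h := ⟨g - 2 * h, by omega⟩
    have := hD.fill _ (hv.cut c₁ h₂) _ (hv.cut c₂ h₁) (seg (inputAt x) (lo + 1 + h) g')
      (by rw [length_seg]; omega)
    simp only [hv.map_window h₁ l₀, hv.map_window h₂ l₀] at this
    have := (fillable_iff_restrict.1 this).2.2
    rw [hright c₂ (by omega), hleft c₁ (by omega)] at this
    rw [seg_add, seg_add]
    convert this using 3
    · congr 2; omega
    · push_cast; omega
  · -- a cut and the end of the path
    obtain ⟨c₁, hc₁⟩ : ∃ c, c = j + -((m₂ : ℤ) + r) := ⟨_, rfl⟩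
    rw [← hc₁] at h₂
    have hends : ends := by
      rcases hx.shape with hu | ⟨he, -⟩
      · have : j + (m₁ : ℤ) ∈ supp x := hu ▸ trivial
        exact absurd (h₁ m₁ le_rfl) this
      · exact he
    -- A cut is eligible, so the end of the path is beyond the `h` inputs next to its window.
    obtain ⟨g', rfl⟩ : ∃ g', g = h + g' := by
      refine ⟨g - h, ?_⟩
      by_contra hlt
      refine hv.ne_none (i := lo + 1 + g) h₂ ?_ ?_
      · rw [abs_le]; push_cast; omega
      · have := h₁ m₁ le_rfl
        rwa [show j + (m₁ : ℤ) = lo + 1 + g by omega] at this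
    have := hD.fill_end hends _ (hv.cut c₁ h₂) (seg (inputAt x) (lo + 1 + h) g')
      (by rw [length_seg]; omega)
    simp only [hv.map_window h₂ l₀] at this
    have := (fillable_iff_restrict.1 this).2.2
    rw [hleft c₁ (by omega), List.take_of_length_le (by simp),
      hv.replicate_none (a := lo + 1 + (h + g' : ℕ)) (l₀ := l₀) (by
        intro i h1 h2
        have := h₁ (i - j).toNat (by omega)
        rwa [show j + ((i - j).toNat : ℤ) = i by omega] at this)] at this
    rw [seg_add]
    convert this using 3
    congr 1; omega
  · -- the end of the path and a cut
    obtain ⟨c₂, hc₂⟩ : ∃ c, c = j + ((m₁ : ℤ) + r) := ⟨_, rfl⟩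
    rw [← hc₂] at h₁
    have hlox : x lo = none := by
      have := h₂ m₂ le_rfl
      rwa [show j + -(m₂ : ℤ) = lo by omega] at this
    have hends : ends := by
      rcases hx.shape with hu | ⟨he, -⟩
      · have : lo ∈ supp x := hu ▸ trivial
        exact absurd hlox this
      · exact he
    obtain ⟨g', rfl⟩ : ∃ g', g = g' + h := by
      refine ⟨g - h, ?_⟩
      by_contra hlt
      refine hv.ne_none (i := lo) h₁ ?_ hlox
      rw [abs_le]; push_cast; omega
    have := (hD.fill_end hends _ (hD.mirror _ (hv.cut c₂ h₁)) (seg (inputAt x) (lo + 1) g').reverse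
      (by rw [List.length_reverse, length_seg]; omega)).reverse hW
    simp only [List.reverse_append, List.reverse_reverse, List.map_reverse, List.reverse_replicate,
      hv.map_window h₁ l₀] at this
    have := (fillable_iff_restrict.1 this).2.2
    rw [hright c₂ (by omega), List.length_replicate, Nat.sub_self, List.drop_zero,
      hv.replicate_none (a := lo + 1 - (2 * r : ℕ)) (l₀ := l₀) (by
        intro i h1 h2
        have := h₂ (j - i).toNat (by omega)
        rwa [show j + -((j - i).toNat : ℤ) = i by omega] at this)] at this
    rw [seg_add]
    convert this using 3
    push_cast; omega
  · -- two ends: the path is too short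
    exfalso
    have h3 := h₁ m₁ le_rfl
    have h4 := h₂ m₂ le_rfl
    have hj' : j ∈ supp x := by rw [mem_supp, ← hv.fst]; exact hj.1
    rcases hx.shape with hu | ⟨-, hu⟩
    · have : j + (m₁ : ℤ) ∈ supp x := hu ▸ trivial
      exact this h3
    · have h3' : j + (m₁ : ℤ) ∉ supp x := fun h => h h3
      have h4' : j + -(m₂ : ℤ) ∉ supp x := fun h => h h4
      rw [hu, Set.mem_Ico] at h3' h4' hj'
      omega

/-- After filling the gaps, all windows pass the check. -/
theorem IsLayout.check_finish [Nonempty Out] (hv : IsLayout r h K D x Q l v)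
    (hx : Admissible n e ends x) (hh : 1 ≤ h) (hK : K = 2 * (h + r)) (hn : 4 * K + 2 < n)
    (hW : ∀ w, w.length = 2 * r + 1 → W w → W w.reverse)
    (hD : IsCutRule r W h (4 * K + 2) ends D) {i : ℤ} (hi : x i ≠ none) :
    W (seg (fun k => (x k).map fun p => (p.1, finish r (4 * K + 2) W v k)) (i - r) (2 * r + 1)) := by
  have hinj : ∀ a b : ℤ, x a ≠ none → x b ≠ none → |b - a| < n → idAt x a = idAt x b → a = b :=
    fun a b ha hb hab h => hx.inj a b _ _ (eq_some_of_ne_none ha) (eq_some_of_ne_none hb) hab h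
  have hout : ∀ l₀ l₁ : ℕ → Out, ∀ k, ¬ Free v k → filled v l₀ k = filled v l₁ k := by
    intro l₀ l₁ k hk
    simp only [Free, not_and_or, not_not] at hk
    rcases hk with hk | hk
    · simp [filled, hk]
    · obtain ⟨o, ho⟩ := Option.ne_none_iff_exists'.1 hk
      simp [filled, ho]
  -- Different gaps are separated by a full window of `2 * r + 1` positions, so two free positions
  -- at distance at most `2 * r` belong to one gap.
  have hsep : ∀ a b : ℤ, Free v a → Free v b → a < b → b ≤ a + 2 * r →
      ∀ m, a ≤ m → m ≤ b → Free v m := by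
    intro a b ha hb hab hba m hm1 hm2
    by_contra hm
    have hxa : x a ≠ none := by rw [← hv.fst]; exact ha.1
    have hxb : x b ≠ none := by rw [← hv.fst]; exact hb.1
    have hxm : x m ≠ none := hx.ordConnected.out hxa hxb ⟨hm1, hm2⟩
    obtain ⟨c, hc, hmc⟩ := hv.exists_cut m fun h => hm ⟨by rwa [hv.fst], h⟩
    have h1 : ¬ |a - c| ≤ r := fun h => hv.not_free hc h ha
    have h2 : ¬ |b - c| ≤ r := fun h => hv.not_free hc h hb
    rw [abs_le] at hmc h1 h2
    omega
  have hgap : ∀ j, Free v j → GapLabeled r (4 * K + 2) W v j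
      (Classical.epsilon (GapLabeled r (4 * K + 2) W v j)) := by
    intro j hj
    apply Classical.epsilon_spec (p := GapLabeled r (4 * K + 2) W v j)
    obtain ⟨lo, g, h1, h2, h3, hfree, hlo, hhi, hfill⟩ := hv.exists_gap hx hK hn hW hD hj
    have hne : ∀ k, lo < k → k < lo + 1 + g → x k ≠ none := fun k h1 h2 => by
      rw [← hv.fst]; exact (hfree k h1 h2).1
    have hid : Set.InjOn (idAt x) (Set.Ico (lo + 1) (lo + 1 + g)) := by
      intro a ha b hb hab
      rw [Set.mem_Ico] at ha hb
      exact hinj a b (hne _ (by omega) (by omega)) (hne _ (by omega) (by omega))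
        (by rw [abs_lt]; omega) hab
    obtain ⟨s, hs, hwin⟩ := hfill fun _ => Classical.arbitrary Out
    obtain ⟨l', rfl⟩ := exists_identifier_labeling_list hid hs
    have hmid : (seg (fun k => (inputAt x k, l' (idAt x k))) (lo + 1) g).map some =
        seg (filled v l') (lo + 1) g := by
      rw [map_seg]
      refine seg_congr fun k hk1 hk2 => ?_
      have hf := hfree k (by omega) (by omega)
      rw [filled, hf.2, hv.fst, eq_some_of_ne_none (hne k (by omega) (by omega))]
      rfl
    -- The windows that touch this gap touch no other one. Everything outside it that they see is
    -- labeled already and does not depend on `l'`.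
    have hfar : ∀ k, lo + 1 - (2 * r : ℕ) ≤ k → k < lo + 1 + g + (2 * r : ℕ) →
        ¬ (lo + 1 ≤ k ∧ k < lo + 1 + g) → ¬ Free v k := by
      intro k hk1 hk2 hk3 hfk
      rcases lt_or_ge k (lo + 1) with hlt | hge
      · refine hlo (hsep k (lo + 1) hfk (hfree _ (by omega) (by omega)) hlt (by push_cast at *; omega)
          lo (by omega) (by omega))
      · refine hhi (hsep (lo + g) k (hfree _ (by omega) (by omega)) hfk (by omega)
          (by push_cast at *; omega) _ (by omega) (by omega))
    have hwin' : AllWindows r W (seg (filled v l') (lo + 1 - (2 * r : ℕ)) (2 * r + g + 2 * r)) := by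
      have e1 : seg (filled v l') (lo + 1 - (2 * r : ℕ)) (2 * r) =
          seg (filled v fun _ => Classical.arbitrary Out) (lo + 1 - (2 * r : ℕ)) (2 * r) :=
        seg_congr fun k hk1 hk2 => hout _ _ k (hfar k hk1 (by omega) (by omega))
      have e2 : lo + 1 - (2 * r : ℕ) + (2 * r : ℕ) = lo + 1 := by ring
      have e3 : lo + 1 - (2 * r : ℕ) + (2 * r + g : ℕ) = lo + 1 + g := by push_cast; ring
      have e4 : seg (filled v l') (lo + 1 + g) (2 * r) =
          seg (filled v fun _ => Classical.arbitrary Out) (lo + 1 + g) (2 * r) :=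
        seg_congr fun k hk1 hk2 => hout _ _ k (hfar k (by omega) (by omega) (by omega))
      rw [seg_add, seg_add, e1, e2, e3, e4, ← hmid]
      exact hwin
    refine ⟨l', fun j' k hj' hk hb => ?_⟩
    have hlt1 : lo < j + j' := by
      by_contra hle
      exact hlo (hb lo (Or.inr ⟨by omega, by omega⟩))
    have hlt2 : j + j' < lo + 1 + g := by
      by_contra hle
      exact hhi (hb _ (Or.inl ⟨by omega, by omega⟩))
    rw [abs_le] at hk
    exact allWindows_seg.1 hwin' (j + j' + k) (by push_cast; omega) (by push_cast; omega)
  have hfinish : ∀ l₀ : ℕ → Out, ∀ k, ¬ Free v k →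
      (x k).map (fun p => (p.1, finish r (4 * K + 2) W v k)) = filled v l₀ k := by
    intro l₀ k hk
    simp only [Free, not_and_or, not_not, hv.fst] at hk
    rcases hk with hk | hk
    · simp [filled, hv.fst, hk]
    · obtain ⟨o, ho⟩ := Option.ne_none_iff_exists'.1 hk
      simp [filled, hv.fst, finish, ho]
  have hbound : ∀ j, Free v j → ∀ m, FreeBetween v j m → |m - j| ≤ (4 * K + 2 : ℕ) := by
    intro j hj m hm
    obtain ⟨lo, g, h1, h2, h3, -, hlo, hhi, -⟩ := hv.exists_gap hx hK hn hW hD hj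
    have hlt1 : lo < m := by
      by_contra hle
      exact hlo (hm lo (Or.inr ⟨by omega, by omega⟩))
    have hlt2 : m < lo + 1 + g := by
      by_contra hle
      exact hhi (hm _ (Or.inl ⟨by omega, by omega⟩))
    rw [abs_le]; push_cast; omega
  -- The condition depends only on the gap. All of its positions thus have the same predicate and
  -- choose the same labeling by `Classical.epsilon`, without communication.
  have hsame : ∀ j k, Free v j → FreeBetween v j k → ∀ l' : ℕ → Out,
      GapLabeled r (4 * K + 2) W v j l' → GapLabeled r (4 * K + 2) W v k l' := by
    intro j k hj hjk l' hl' m q hm hq hkm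
    have hjm : FreeBetween v j (j + (k + m - j)) := by
      intro a ha
      by_cases h1 : j ≤ a ∧ a ≤ k ∨ k ≤ a ∧ a ≤ j
      · exact hjk a h1
      · exact hkm a (by omega)
    have := hl' (k + m - j) q (by simpa using hbound j hj _ hjm) hq hjm
    rwa [show j + (k + m - j) + q - (r : ℤ) = k + m + q - r by ring] at this
  by_cases hnear : ∃ j, |j - i| ≤ r ∧ Free v j
  · obtain ⟨j, hji, hj⟩ := hnear
    have hbase := hgap j hj 0 (i - j) (by simp; omega) (by rwa [abs_sub_comm]) (by
      intro k hk
      obtain rfl : k = j := by omega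
      exact hj)
    rw [show j + 0 + (i - j) - (r : ℤ) = i - r by ring] at hbase
    convert hbase using 1
    refine seg_congr fun k hk1 hk2 => ?_
    by_cases hk : Free v k
    · rw [abs_le] at hji
      have hjk : FreeBetween v j k := by
        intro a ha
        rcases lt_trichotomy j k with hlt | rfl | hlt
        · exact hsep j k hj hk hlt (by omega) a (by omega) (by omega)
        · obtain rfl : a = j := by omega
          exact hj
        · exact hsep k j hk hj hlt (by omega) a (by omega) (by omega)
      have heq : GapLabeled r (4 * K + 2) W v k = GapLabeled r (4 * K + 2) W v j :=
        funext fun l' => propext ⟨hsame k j hk (fun a ha => hjk a ha.symm) l', hsame j k hj hjk l'⟩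
      have hxk : x k ≠ none := by rw [← hv.fst]; exact hk.1
      obtain ⟨p, hp⟩ := Option.ne_none_iff_exists'.1 hxk
      simp [filled, finish, hk.2, heq, hv.fst, hp]
    · exact hfinish _ k hk
  · push Not at hnear
    have hif : ¬ Free v i := hnear i (by simp)
    obtain ⟨c, hc, hic⟩ := hv.exists_cut i fun h => hif ⟨by rwa [hv.fst], h⟩
    -- If no free position is within `r` of `i`, then `i` is a cut: otherwise the position just
    -- outside the window of `c` on the side of `i` is within `r` of `i`. It has a letter since `h ≥
    -- 1`, and no other cut is near enough to label it.
    obtain rfl : i = c := by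
      by_contra hne
      obtain ⟨δ, hδ, hδi⟩ : ∃ δ : ℤ, (δ = 1 ∨ δ = -1) ∧ |c + δ * (r + 1) - i| ≤ r := by
        rw [abs_le] at hic
        rcases lt_or_gt_of_ne hne with h1 | h1
        · exact ⟨-1, by simp, by rw [abs_le]; omega⟩
        · exact ⟨1, by simp, by rw [abs_le]; omega⟩
      refine hnear _ hδi ⟨?_, ?_⟩
      · rw [hv.fst]
        refine hv.ne_none hc ?_
        rw [abs_le]
        rcases hδ with rfl | rfl <;> push_cast <;> omega
      · by_contra hsome
        obtain ⟨c', hc', hcc⟩ := hv.exists_cut _ hsome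
        rw [abs_le] at hcc
        have hne' : c ≠ c' := by
          rintro rfl
          rcases hδ with rfl | rfl <;> omega
        have := hv.far c c' hc hc' hne'
        rw [lt_abs] at this
        rcases hδ with rfl | rfl <;> omega
    have hcut := hv.cut i hc
    -- Joining the window to itself by any filling shows that the window alone passes the check.
    obtain ⟨s, -, hwin⟩ := hD.fill _ hcut _ hcut [] (by simp)
    have hwin' := hwin (seg (filled v fun _ => Classical.arbitrary Out) (i - r) (2 * r + 1))
      length_seg (by
        rw [← hv.map_window hc, List.append_assoc]
        exact (List.prefix_append _ _).isInfix)
    convert hwin' using 1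
    exact seg_congr fun k hk1 hk2 => hfinish _ k (hnear k (by rw [abs_le]; omega))

end Layout

/-! ### Assembling the LOCAL algorithm. -/

section Pipeline

variable {In Out : Type*} [Inhabited In] [Nonempty Out]

open Classical in
/-- The selected positions choose labelings that follow the rule `D`. -/
noncomputable def chooseCuts (r h : ℕ) (D : Set (List In × List (In × Out) × List In))
    (Q : (ℤ → Option (In × ℕ)) → ℤ → Prop) (x : ℤ → Option (In × ℕ)) (i : ℤ) :
    Option (In × ℕ) × Option (ℕ → Out) :=
  (x i, if Q x i then some (Classical.epsilon (CutLabeled r h D x i)) else none)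

theorem Loc.chooseCuts {r h t : ℕ} {D : Set (List In × List (In × Out) × List In)}
    (hD : ∀ d ∈ D, (d.2.2.reverse, d.2.1.reverse, d.1.reverse) ∈ D)
    {Q : (ℤ → Option (In × ℕ)) → ℤ → Prop} (hQ : Loc t Q) :
    Loc (t + (h + r)) (chooseCuts r h D Q) := by
  classical
  intro x i x' i' hx
  simp only [OnlineLocal.chooseCuts]
  rw [hQ x i x' i' (hx.mono (by omega)), loc_cutLabeled hD x i x' i' (hx.mono (by omega)),
    agree_zero hx]

/-- Cuts are more than `2 * r` apart, so their windows are disjoint. Each position receives at most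
one label, and the choice in `collect` is forced. -/
theorem isLayout_chooseCuts {r h K B n c : ℕ} {ends : Prop} {W : List (Option (In × Out)) → Prop}
    {D : Set (List In × List (In × Out) × List In)} (hD : IsCutRule r W h B ends D)
    {x : ℤ → Option (In × ℕ)} (hx : Admissible n c ends x) (hK : 2 * r ≤ K) (hn : 2 * r < n)
    {Q : (ℤ → Option (In × ℕ)) → ℤ → Prop} (eligible : ∀ i, Q x i → Eligible (h + r) x i)
    (far : ∀ i j, Q x i → Q x j → i ≠ j → (K : ℤ) < |j - i|)
    (near : ∀ i, Eligible (h + r) x i → ∃ j : ℤ, |j| ≤ K ∧ Q x (i + j)) :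
    IsLayout r h K D x (Q x) (fun i => Classical.epsilon (CutLabeled r h D x i))
      fun i => (x i, collect r (chooseCuts r h D Q x) i) := by
  classical
  have hrec : ∀ i o, Receives r (chooseCuts r h D Q x) i o ↔ ∃ a, Q x a ∧ |i - a| ≤ r ∧
      Classical.epsilon (CutLabeled r h D x a) (idAt x i) = o := by
    intro i o
    constructor
    · rintro ⟨j, hj, l, hl, ho⟩
      simp only [chooseCuts, Option.ite_none_right_eq_some, Option.some.injEq] at hl
      obtain ⟨hQ, rfl⟩ := hl
      exact ⟨i + j, hQ, by simpa using hj, ho⟩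
    · rintro ⟨a, hQ, ha, ho⟩
      refine ⟨a - i, by rwa [abs_sub_comm], _, ?_, ho⟩
      rw [show i + (a - i) = a by ring]
      simp only [chooseCuts, if_pos hQ]
  refine ⟨eligible, far, near, fun a ha => ?_, fun _ => rfl, fun a i ha hi => ?_, fun i hi => ?_⟩
  · obtain ⟨z, hz, hzD⟩ := hD.total (seg (inputAt x) (a - (h + r : ℕ)) h)
      (seg (inputAt x) (a - r) (2 * r + 1)) (seg (inputAt x) (a + r + 1) h) (by simp) (by simp)
      (by simp)
    have hinj : Set.InjOn (idAt x) (Set.Ico (a - r) (a - r + (2 * r + 1 : ℕ))) := by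
      intro i hi j hj hij
      have key : ∀ k ∈ Set.Ico (a - r : ℤ) (a - r + (2 * r + 1 : ℕ)), x k ≠ none := fun k hk => by
        have := eligible a ha (k - a) (by
          have := hk.1; have := hk.2; rw [abs_le]; push_cast at *; omega)
        rwa [show a + (k - a) = k by ring] at this
      refine hx.inj i j _ _ (eq_some_of_ne_none (key i hi)) (eq_some_of_ne_none (key j hj)) ?_ hij
      have := hi.1; have := hi.2; have := hj.1; have := hj.2
      rw [abs_lt]; push_cast at *; omega
    obtain ⟨l, rfl⟩ := exists_identifier_labeling_list hinj hz
    exact Classical.epsilon_spec (p := CutLabeled r h D x a) ⟨l, hzD⟩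
  · have hex : ∃ o, Receives r (chooseCuts r h D Q x) i o := ⟨_, (hrec _ _).2 ⟨a, ha, hi, rfl⟩⟩
    simp only [collect, if_pos hex]
    obtain ⟨b, hb, hib, hb'⟩ := (hrec _ _).1 (Classical.epsilon_spec hex)
    rw [← hb']
    have hab : a = b := by
      by_contra hne
      have := far a b ha hb hne
      rw [lt_abs] at this
      rw [abs_le] at hi hib
      omega
    rw [hab]
  · simp only [collect] at hi
    split_ifs at hi with hex
    · obtain ⟨o, ho⟩ := hex
      obtain ⟨a, ha, hia, -⟩ := (hrec _ _).1 ho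
      exact ⟨a, ha, hia⟩
    · exact absurd rfl hi

/-- Three local maps are composed: selecting cuts, labeling their windows, and filling the gaps.
Only the first has a radius that depends on `n`. -/
theorem exists_local_labeling (P : Problem In Out) (c h : ℕ) (hh : 1 ≤ h) :
    ∃ C B : ℕ, B ≤ C ∧ 2 * P.radius ≤ B ∧ ∀ n, B < n → ∀ ends D,
      IsCutRule P.radius P.check h B ends D →
        ∃ F : (ℤ → Option (In × ℕ)) → ℤ → Out, Loc (C * (logStar n + 1)) F ∧
          ∀ x, Admissible n c ends x → ∀ i, x i ≠ none →
            P.check (seg (fun k => (x k).map fun p => (p.1, F x k)) (i - P.radius)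
              (2 * P.radius + 1)) := by
  obtain ⟨r, hr⟩ : ∃ r, r = P.radius := ⟨_, rfl⟩
  have hrev : ∀ w : List (Option (In × Out)), w.length = 2 * r + 1 → P.check w →
      P.check w.reverse := fun w hw => Problem.check_reverse (hr ▸ hw)
  rw [← hr]
  obtain ⟨K, hK⟩ : ∃ K, K = 2 * (h + r) := ⟨_, rfl⟩
  obtain ⟨C, hC⟩ := exists_cuts (In := In) K (h + r) c
  -- Each side of a gap stops within `2 * K + 1` steps, which bounds its length by `4 * K + 1`.
  obtain ⟨B, hB⟩ : ∃ B, B = 4 * K + 2 := ⟨_, rfl⟩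
  refine ⟨C + ((h + r) + r + (B + 2 * r)), B, by omega, by omega, fun n hn ends D hD => ?_⟩
  obtain ⟨Q, hQ, hQx⟩ := hC n (by omega)
  have hcuts := hQ.chooseCuts (r := r) (h := h) hD.mirror
  have hlabels : Loc (C * (logStar n + 1) + (h + r) + r)
      fun x i => (x i, collect r (chooseCuts r h D Q x) i) :=
    loc_id.map₂ (hcuts.comp loc_collect) Prod.mk
  refine ⟨_, (hlabels.comp (loc_finish (B := B) hrev)).mono ?_, fun x hx i hi => ?_⟩
  · nlinarith [Nat.zero_le (((h + r) + r + (B + 2 * r)) * logStar n)]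
  · obtain ⟨h1, h2, h3⟩ := hQx ends x hx
    subst hB
    exact (isLayout_chooseCuts hD hx (by omega) (by omega) h1 h2 h3).check_finish hx hh hK hn hrev
      hD hi

end Pipeline

/-- A local labeling of the sequences gives a LOCAL algorithm. -/
theorem localSolvable_of_loc {In Out : Type*} [Inhabited In] [Nonempty Out] {P : Problem In Out}
    {c n t : ℕ} {ends : Prop} (ht : 2 * t + 2 ≤ n) (hn : 2 * P.radius + 2 ≤ n)
    {F : (ℤ → Option (In × ℕ)) → ℤ → Out} (hF : Loc t F)
    (hcheck : ∀ x, Admissible n c ends x → ∀ i, x i ≠ none →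
      P.check (seg (fun k => (x k).map fun p => (p.1, F x k)) (i - P.radius) (2 * P.radius + 1)))
    (hunroll : ∀ (V : Type) [Finite V] (G : SimpleGraph V), P.family V G → Nat.card V = n →
      ∃ ψ S, Unrolling G n ψ S ∧ (S = Set.univ ∨ ends ∧ S = Set.Ico 0 (n : ℤ))) :
    LocalSolvable c P n t := by
  -- The output is prescribed on views of sequences. This is consistent because isomorphic views
  -- agree up to reflection, and `F` is insensitive to that.
  let ι := {p : (ℤ → Option (In × ℕ)) × ℤ // (supp p.1).OrdConnected ∧ p.1 p.2 ≠ none}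
  obtain ⟨out, hiso, hout⟩ := exists_view_function (ι := ι)
    (fun p => lineView p.1.1 t p.1.2) (fun p => F p.1.1 p.1.2) fun p q h =>
      hF _ _ _ _ (agree_of_isomorphic p.2.1 q.2.1 p.2.2 q.2.2 h)
  refine ⟨out, hiso, fun V _ G hG hV I ident hident hbound => ?_⟩
  obtain ⟨ψ, S, hψ, hS⟩ := hunroll V G hG hV
  obtain ⟨x, hx⟩ : ∃ x, x = unrolled ψ S fun u => (I u, ident u) := ⟨_, rfl⟩
  have hsupp : supp x = S := hx ▸ supp_unrolled ψ S _
  have hval : ∀ i ∈ S, out (ballView G (fun u => (I u, ident u)) t [ψ i]) = F x i := by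
    intro i hi
    rw [← hiso _ _ (hψ.isomorphic (fun u => (I u, ident u)) ht hi), ← hx]
    exact hout ⟨(x, i), hsupp ▸ hψ.conn, mem_supp.1 (hsupp ▸ hi)⟩
  have hsome : ∀ i p, x i = some p → i ∈ S ∧ p = (I (ψ i), ident (ψ i)) := by
    intro i p hp
    have hi : i ∈ S := hsupp ▸ mem_supp.2 (by simp [hp])
    rw [hx, unrolled_of_mem hi, Option.some_inj] at hp
    exact ⟨hi, hp.symm⟩
  have hadm : Admissible n c ends x := by
    refine ⟨hsupp ▸ hS, fun i j p q hp hq hij hpq => ?_, fun i p hp => ?_⟩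
    · obtain ⟨hi, rfl⟩ := hsome i p hp
      obtain ⟨hj, rfl⟩ := hsome j q hq
      exact hψ.inj i hi j hj (by rwa [abs_sub_comm]) (hident hpq)
    · obtain ⟨-, rfl⟩ := hsome i p hp
      exact hV ▸ (hbound _).2
  have hseq : (unrolled ψ S fun u => (I u, out (ballView G (fun u => (I u, ident u)) t [u]))) =
      fun k => (x k).map fun p => (p.1, F x k) := by
    funext k
    by_cases hk : k ∈ S
    · rw [hx, unrolled_of_mem hk, unrolled_of_mem hk, hval k hk, ← hx]; rfl
    · simp [unrolled, hx, hk]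
  rw [hψ.feasible_iff hn, hseq]
  intro i
  by_cases hi : x i = none
  · exact Problem.check_seg.2 (Or.inl (by simp [hi]))
  · exact hcheck x hadm i hi

/-! ### The three graph families and the dichotomy. -/

section Families

variable {In Out : Type*} {P : Problem In Out}

theorem preconnected_of_family (hfam : P.family = paths ∨ P.family = cycles ∨
    P.family = pathsAndCycles) (V : Type) [Finite V] (G : SimpleGraph V) (hG : P.family V G) :
    G.Preconnected := by
  have hpath : paths V G → G.Preconnected := fun ⟨e⟩ =>
    e.preconnected_iff.2 (SimpleGraph.pathGraph_preconnected _)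
  have hcycle : cycles V G → G.Preconnected := fun ⟨_, ⟨e⟩⟩ =>
    e.preconnected_iff.2 SimpleGraph.cycleGraph_preconnected
  rcases hfam with h | h | h <;> rw [h] at hG
  exacts [hpath hG, hcycle hG, hG.elim hpath hcycle]

/-- A graph of the family on `N` nodes that has ends if any graph of the family has. -/
theorem exists_representative (hfam : P.family = paths ∨ P.family = cycles ∨
    P.family = pathsAndCycles) {N : ℕ} (hN : 3 ≤ N) :
    ∃ (G : SimpleGraph (Fin N)) (ψ : ℤ → Fin N) (S : Set ℤ), P.family (Fin N) G ∧
      Unrolling G N ψ S ∧ Set.Ico 0 (N : ℤ) ⊆ S ∧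
      ∀ (V : Type) [Finite V] (H : SimpleGraph V), P.family V H → 0 < Nat.card V →
        ∃ ψ' S', Unrolling H (Nat.card V) ψ' S' ∧
          (S' = Set.univ ∨ S = Set.Ico 0 (N : ℤ) ∧ S' = Set.Ico 0 (Nat.card V : ℤ)) := by
  have hp : paths (Fin N) (SimpleGraph.pathGraph N) := by
    rw [paths, Nat.card_fin]; exact ⟨SimpleGraph.Iso.refl⟩
  have hc : cycles (Fin N) (SimpleGraph.cycleGraph N) := by
    rw [cycles, Nat.card_fin]; exact ⟨hN, ⟨SimpleGraph.Iso.refl⟩⟩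
  obtain ⟨ψp, hψp⟩ := exists_unrolling_path (n := N) (by omega) ⟨SimpleGraph.Iso.refl⟩
  obtain ⟨ψc, hψc⟩ := exists_unrolling_cycle hN ⟨SimpleGraph.Iso.refl⟩
  have hpV : ∀ (V : Type) [Finite V] (H : SimpleGraph V), paths V H → 0 < Nat.card V →
      ∃ ψ' S', Unrolling H (Nat.card V) ψ' S' ∧ S' = Set.Ico 0 (Nat.card V : ℤ) :=
    fun V _ H hH hV => (exists_unrolling_path hV hH).imp fun ψ h => ⟨_, h, rfl⟩
  have hcV : ∀ (V : Type) [Finite V] (H : SimpleGraph V), cycles V H →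
      ∃ ψ' S', Unrolling H (Nat.card V) ψ' S' ∧ S' = Set.univ :=
    fun V _ H hH => (exists_unrolling_cycle hH.1 hH.2).imp fun ψ h => ⟨_, h, rfl⟩
  rcases hfam with h | h | h <;> rw [h]
  · refine ⟨_, _, _, hp, hψp, subset_rfl, fun V _ H hH hV => ?_⟩
    obtain ⟨ψ', S', h1, h2⟩ := hpV V H hH hV
    exact ⟨ψ', S', h1, Or.inr ⟨rfl, h2⟩⟩
  · refine ⟨_, _, _, hc, hψc, Set.subset_univ _, fun V _ H hH hV => ?_⟩
    obtain ⟨ψ', S', h1, h2⟩ := hcV V H hH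
    exact ⟨ψ', S', h1, Or.inl h2⟩
  -- A path is taken as representative since its rule also treats ends; on cycles that part of the
  -- rule is never needed.
  · refine ⟨_, _, _, Or.inl hp, hψp, subset_rfl, fun V _ H hH hV => ?_⟩
    rcases hH with hH | hH
    · obtain ⟨ψ', S', h1, h2⟩ := hpV V H hH hV
      exact ⟨ψ', S', h1, Or.inr ⟨rfl, h2⟩⟩
    · obtain ⟨ψ', S', h1, h2⟩ := hcV V H hH
      exact ⟨ψ', S', h1, Or.inl h2⟩

end Families

/-- Either the problem can be solved in `O(log* n)` rounds or each algorithm in the online-LOCAL model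
has linear locality. -/
theorem exists_const_le {In Out : Type*} [Inhabited In] [Nonempty Out] [Finite In] [Finite Out]
    {P : Problem In Out} (hfam : P.family = paths ∨ P.family = cycles ∨ P.family = pathsAndCycles)
    {A : Algorithm In Out} {T : ℕ → ℕ} (hA : SolvesOnline P A T) {c : ℕ} {T' : ℕ → ℕ}
    (hT' : ∀ n t, LocalSolvable c P n t → T' n ≤ t) :
    ∃ C, ∀ n, T' n ≤ C * (T n + logStar n + 1) := by
  have hcard : ∀ n, T' n ≤ n := fun n => hT' n n <|
    localSolvable_card (fun V _ G hG => preconnected_of_family hfam V G hG)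
      (fun V _ G hG I => exists_feasible hA hG I) n
  obtain ⟨h, hh, hrule⟩ := exists_isCutRule P
  obtain ⟨C₁, B, hBC, hB, hlocal⟩ := exists_local_labeling P c h hh
  obtain ⟨C₂, hC₂⟩ := hrule B
  -- One good size `N` is enough, and the rule obtained from it serves all `n`. If there is none,
  -- `T` is linear.
  by_cases hN : ∃ N, (C₂ + 3) * (T N + 1) ≤ N
  · obtain ⟨N, hN⟩ := hN
    have hN3 : 3 ≤ N := by nlinarith [Nat.zero_le (C₂ * (T N + 1)), Nat.zero_le (T N)]
    have hNC : C₂ * (T N + 1) ≤ N := by nlinarith [Nat.zero_le (T N)]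
    obtain ⟨G, ψ, S, hG, hψ, hS, hunroll⟩ := exists_representative hfam hN3
    obtain ⟨D, hD⟩ := hC₂ A N (T N) G hNC (fun I σ => by
      have := hA (Fin N) G hG I σ
      rwa [Nat.card_fin] at this) ψ S hψ hS
    refine ⟨2 * C₁ + 2, fun n => ?_⟩
    -- For smaller `n`, the view could wrap around a cycle, but then `n` itself is `O(log* n)` and
    -- everything can be gathered.
    by_cases hn : 2 * (C₁ * (logStar n + 1)) + 2 ≤ n
    · have hC₁ : C₁ ≤ C₁ * (logStar n + 1) := Nat.le_mul_of_pos_right _ (by omega)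
      obtain ⟨F, hF, hcheck⟩ := hlocal n (by omega) _ D hD
      have := hT' n _ (localSolvable_of_loc hn (by omega) hF hcheck fun V _ H hH hV => by
        have := hunroll V H hH (by omega)
        rwa [hV] at this)
      nlinarith [Nat.zero_le (C₁ * T n), Nat.zero_le (C₁ * logStar n)]
    · have := hcard n
      nlinarith [Nat.zero_le (C₁ * T n), Nat.zero_le (C₁ * logStar n)]
  · push Not at hN
    refine ⟨C₂ + 3, fun n => ?_⟩
    have h1 := hcard n
    have h2 := hN n
    nlinarith [Nat.zero_le ((C₂ + 3) * logStar n)]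

end OnlineLocal

theorem mainTheorem2 {In Out : Type*} (P : OnlineLocal.Problem In Out) (hP : P.IsLCL)
    (hfam : P.family = OnlineLocal.paths ∨ P.family = OnlineLocal.cycles ∨
      P.family = OnlineLocal.pathsAndCycles)
    (T : ℕ → ℕ) (hT : OnlineLocal.IsLocalityOnline P T) (c : ℕ) (hc : 1 ≤ c) :
    ∃ T' : ℕ → ℕ, OnlineLocal.IsLocalityLocal c P T' ∧
      (fun n => (T' n : ℝ)) =O[atTop] (fun n => (T n : ℝ) + (OnlineLocal.logStar n : ℝ)) := by
  obtain ⟨hIn, hOut, -⟩ := hP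
  obtain ⟨⟨T₀, hT₀, A, hA⟩, -⟩ := hT
  -- The algorithm must answer on every view, even an empty one.
  have : Nonempty Out := ⟨A.out 0 ⟨Empty, ⊥, Empty.elim, []⟩⟩
  obtain ⟨T', hT', C, hC⟩ : ∃ T', OnlineLocal.IsLocalityLocal c P T' ∧
      ∃ C, ∀ n, T' n ≤ C * (T₀ n + OnlineLocal.logStar n + 1) := by
    -- Without input labels only the graph without nodes has an input, and feasibility is vacuous.
    rcases isEmpty_or_nonempty In with hempty | hnonempty
    · obtain ⟨T', hT', hle⟩ := OnlineLocal.exists_isLocalityLocal (c := c) (P := P) (F := 0)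
        fun n => ⟨fun _ => Classical.arbitrary Out, fun _ _ _ => rfl,
          fun V _ G _ _ I _ _ _ v => isEmptyElim (I v)⟩
      refine ⟨T', hT', 0, fun n => ?_⟩
      rw [zero_mul]
      exact hle n 0 ⟨fun _ => Classical.arbitrary Out, fun _ _ _ => rfl,
          fun V _ G _ _ I _ _ _ v => isEmptyElim (I v)⟩
    · have := Classical.inhabited_of_nonempty hnonempty
      obtain ⟨T', hT', hle⟩ := OnlineLocal.exists_isLocalityLocal (c := c) (P := P) (F := id)
        (OnlineLocal.localSolvable_card
          (fun V _ G hG => OnlineLocal.preconnected_of_family hfam V G hG)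
          fun V _ G hG I => OnlineLocal.exists_feasible hA hG I)
      exact ⟨T', hT', OnlineLocal.exists_const_le hfam hA hle⟩
  -- The factor `2` absorbs the summand `1`, as `logStar n ≥ 1` for `n ≥ 2`.
  refine ⟨T', hT', IsBigO.of_bound (2 * C) ?_⟩
  filter_upwards [eventually_ge_atTop 2] with n hn
  have h1 := OnlineLocal.one_le_logStar hn
  have h2 : T' n ≤ 2 * C * (T n + OnlineLocal.logStar n) := by
    refine (hC n).trans ?_
    rw [mul_comm 2 C, mul_assoc]
    exact Nat.mul_le_mul_left C (by have : T₀ n ≤ T n := hT₀ n; omega)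
  rw [Real.norm_of_nonneg (by positivity), Real.norm_of_nonneg (by positivity)]
  exact_mod_cast h2
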